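/- Let $n_t,T\ge 1$ and $n_r\ge n_t$ be integers and put $\kappa=n_tT$. Consider the quasi-static Rayleigh fading channel $Y=HX+W$ with $X\in\mathbb C^{n_t\times T}$, where $H\in\mathbb C^{n_r\times n_t}$ and $W\in\mathbb C^{n_r\times T}$ have i.i.d. circularly symmetric complex Gaussian entries of unit variance. Let $D_1,\dots,D_\kappa\in\mathbb C^{n_t\times T}$ be linearly independent dispersion matrices and let $G=[\mathrm{vec}(D_1)\ \cdots\ \mathrm{vec}(D_\kappa)]\in\mathbb C^{\kappa\times\kappa}$ be the generator matrix. At signal-to-noise ratio $\rho$ the codebook $\mathcal X$ consists of all $X=\theta\sum_{i=1}^\kappa s_iD_i$ with $s_i\in\mathbb S_\eta=\{s:\ \mathrm{Re}(s),\mathrm{Im}(s)\in\mathbb Z\cap[-\eta,\eta]\}$, where $\theta,\eta>0$ depend on $\rho$ in such a way that $\frac1{|\mathcal X|}\sum_{X\in\mathcal X}\|X\|_F^2=\rho T$ and that the multiplexing gain is $r=\lim_{\rho\to\infty}\frac1T\frac{\log|\mathcal X|}{\log\rho}$. The symbol vector $s$ is uniform on $\mathbb S_\eta^\kappa$, and $s$,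 $H$, $W$ are independent. The diversity gain is $d(r)=-\lim_{\rho\to\infty}\log P(\hat X_{ML}\ne X)/\log\rho$, assumed to exist and to be finite, where $\hat X_{ML}$ is a minimizer of $\|Y-H\hat X\|_F$ over $\hat X\in\mathcal X$. Let $M=\theta(I_T\otimes H)G=QR$ be a thin QR decomposition ($Q^HQ=I$, $R$ upper triangular), let $\mathbf r=Q^H\mathrm{vec}(Y)$, let $\mathbf r_k$ be the last $k$ entries of $\mathbf r$ and $R_k$ the lower right $k\times k$ corner of $R$. For a non-random search radius $\xi=\xi(\rho)>0$ with $\log\xi/\log\rho\to0$ as $\rho\to\infty$, the sphere decoder visits $$N=\sum_{k=1}^{\kappa}\big|\{\hat s_k\in\mathbb S_\eta^k:\ \|\mathbf r_k-R_k\hat s_k\|^2\le\xi^2\}\big|$$ nodes. Its complexity exponent is $c(r)=\inf\{x\in\mathbb R:\ \Psi(x)>d(r)\}$, where $\Psi(x)=-\lim_{\rho\to\infty}\log P(N\ge\rho^x)/\log\rho$ (with $\log 0=-\infty$; at an $x$ where the limit does not exist, $\Psi(x)$ may be any value between the lower and the upper limit). Let $$\bar c(r)=\max_{\alpha}\ \sum_{i=1}^{n_t}T\Big(\min\big(\tfrac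 r{n_t}-1+\alpha_i,\ \tfrac r{n_t}\big)\Big)^{+}\quad\text{s.t.}\quad \sum_{i=1}^{n_t}(n_r-n_t+2i-1)\alpha_i\le d(r),\quad \alpha_1\ge\dots\ge\alpha_{n_t}\ge0 .$$ Suppose that for each $p=1,\dots,n_t$ there is a matrix $U_p\in\mathbb C^{n_t\times p}$ with $U_p^HU_p=I_p$ and $\mathrm{rank}\big((I_T\otimes U_p^H)G_{|p}\big)=pT$, where $G_{|p}$ consists of the first $pT$ columns of $G$. Then, for every $r\in[0,n_t]$, the maximum defining $\bar c(r)$ is attained and $c(r)=\bar c(r)$. -/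

import Mathlib

open Filter Topology MeasureTheory ProbabilityTheory
open scoped ENNReal NNReal Matrix Kronecker

noncomputable section

namespace SphereDecoding

/-! ## Linear dispersive codes -/

/-- Squared Euclidean norm of a complex vector. -/
def sqNorm {ι : Type*} [Fintype ι] (v : ι → ℂ) : ℝ := ∑ i, ‖v i‖ ^ 2

/-- Squared Frobenius norm of a complex matrix. -/
def frobSq {m n : Type*} [Fintype m] [Fintype n] (A : Matrix m n ℂ) : ℝ :=
  ∑ i, ∑ j, ‖A i j‖ ^ 2

open scoped Classical in
/-- The QAM constellation of all Gaussian integers `a + b i` with `a, b ∈ ℤ ∩ [-η, η]`. -/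
def constellation (η : ℝ) : Finset ℂ :=
  (Finset.Icc (-⌊η⌋) ⌊η⌋ ×ˢ Finset.Icc (-⌊η⌋) ⌊η⌋).image
    fun p : ℤ × ℤ => (⟨(p.1 : ℝ), (p.2 : ℝ)⟩ : ℂ)

theorem mem_constellation (η : ℝ) (s : ℂ) :
    s ∈ constellation η ↔
      ∃ a b : ℤ, |(a : ℝ)| ≤ η ∧ |(b : ℝ)| ≤ η ∧ s = ⟨(a : ℝ), (b : ℝ)⟩ := by
  have key : ∀ a : ℤ, (-⌊η⌋ ≤ a ∧ a ≤ ⌊η⌋) ↔ |(a : ℝ)| ≤ η := by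
    intro a
    rw [abs_le, Int.le_floor, neg_le, Int.le_floor, Int.cast_neg, neg_le]
  simp only [constellation, Finset.mem_image, Finset.mem_product, Finset.mem_Icc, key,
    Prod.exists]
  constructor
  · rintro ⟨a, b, ⟨ha, hb⟩, rfl⟩
    exact ⟨a, b, ha, hb, rfl⟩
  · rintro ⟨a, b, ha, hb, rfl⟩
    exact ⟨a, b, ⟨ha, hb⟩, rfl⟩

/-- The set of all length-`k` vectors of constellation symbols. -/
def symbolVectors (k : ℕ) (η : ℝ) : Finset (Fin k → ℂ) :=
  Fintype.piFinset fun _ => constellation η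

/-- The codeword `X = θ ∑ᵢ sᵢ Dᵢ` of a full rate code (`κ = n_t T` dispersion matrices). -/
def codeword {nt T : ℕ} (D : Fin (nt * T) → Matrix (Fin nt) (Fin T) ℂ) (θ : ℝ)
    (s : Fin (nt * T) → ℂ) : Matrix (Fin nt) (Fin T) ℂ :=
  (θ : ℂ) • ∑ i, s i • D i

open scoped Classical in
/-- The codebook: all codewords whose symbols lie in the constellation. -/
def codebook {nt T : ℕ} (D : Fin (nt * T) → Matrix (Fin nt) (Fin T) ℂ) (θ η : ℝ) :
    Finset (Matrix (Fin nt) (Fin T) ℂ) :=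
  (symbolVectors (nt * T) η).image (codeword D θ)

/-- The generator matrix, whose columns are `vec(D₁), …, vec(D_κ)` (column stacking). -/
def generator {nt T : ℕ} (D : Fin (nt * T) → Matrix (Fin nt) (Fin T) ℂ) :
    Matrix (Fin T × Fin nt) (Fin (nt * T)) ℂ :=
  Matrix.of fun row col => (D col).vec row

/-- The first `p T` columns of a matrix with `n_t T` columns. -/
def firstColumns {nt T : ℕ} (G : Matrix (Fin T × Fin nt) (Fin (nt * T)) ℂ)
    (p : ℕ) (hp : p ≤ nt) : Matrix (Fin T × Fin nt) (Fin (p * T)) ℂ :=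
  G.submatrix id (Fin.castLE (Nat.mul_le_mul_right T hp))

/-- For every `p = 1, …, n_t` there is `U` of size `n_t × p` with `Uᴴ U = I` such that
`(I_T ⊗ Uᴴ) G_{|p}` has rank `p T`. -/
def RankCondition {nt T : ℕ} (G : Matrix (Fin T × Fin nt) (Fin (nt * T)) ℂ) : Prop :=
  ∀ (p : ℕ) (_ : 1 ≤ p) (hp : p ≤ nt), ∃ U : Matrix (Fin nt) (Fin p) ℂ,
    Uᴴ * U = 1 ∧
      (((1 : Matrix (Fin T) (Fin T) ℂ) ⊗ₖ Uᴴ) * firstColumns G p hp).rank = p * T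

/-- `θ` and `η`, as functions of the SNR `ρ`, scale the code so that it has average codeword
energy `ρ T` and multiplexing gain `r`. -/
structure IsCodeScaling {nt T : ℕ} (D : Fin (nt * T) → Matrix (Fin nt) (Fin T) ℂ) (r : ℝ)
    (θ η : ℝ → ℝ) : Prop where
  theta_pos : ∀ᶠ ρ in atTop, 0 < θ ρ
  eta_pos : ∀ᶠ ρ in atTop, 0 < η ρ
  power : ∀ᶠ ρ in atTop,
    (∑ X ∈ codebook D (θ ρ) (η ρ), frobSq X) / ((codebook D (θ ρ) (η ρ)).card : ℝ) = ρ * T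
  rate : Tendsto
    (fun ρ => 1 / (T : ℝ) *
      (Real.log ((codebook D (θ ρ) (η ρ)).card : ℝ) / Real.log ρ)) atTop (𝓝 r)

/-! ## The random experiment -/

/-- The standard circularly symmetric complex Gaussian distribution: independent real and
imaginary parts of variance `1/2`. -/
def complexGaussian : Measure ℂ :=
  ((gaussianReal 0 (1 / 2)).prod (gaussianReal 0 (1 / 2))).map
    fun p : ℝ × ℝ => (⟨p.1, p.2⟩ : ℂ)

/-- A realization of the channel gains, the noise and the transmitted symbols. -/
abbrev Sample (nt nr T : ℕ) : Type :=
  (Fin nr → Fin nt → ℂ) × (Fin nr → Fin T → ℂ) × (Fin (nt * T) → ℂ)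

/-- The joint law: i.i.d. Gaussian channel gains, i.i.d. Gaussian noise, and uniformly
distributed symbol vectors, all independent. -/
def sampleLaw (nt nr T : ℕ) (η : ℝ) : Measure (Sample nt nr T) :=
  (Measure.pi fun _ => Measure.pi fun _ => complexGaussian).prod
    ((Measure.pi fun _ => Measure.pi fun _ => complexGaussian).prod
      (uniformOn (symbolVectors (nt * T) η : Set (Fin (nt * T) → ℂ))))

/-- The channel matrix `H`. -/
def Sample.channel {nt nr T : ℕ} (ω : Sample nt nr T) : Matrix (Fin nr) (Fin nt) ℂ :=
  Matrix.of ω.1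

/-- The noise matrix `W`. -/
def Sample.noise {nt nr T : ℕ} (ω : Sample nt nr T) : Matrix (Fin nr) (Fin T) ℂ :=
  Matrix.of ω.2.1

/-- The transmitted symbol vector `s`. -/
def Sample.symbols {nt nr T : ℕ} (ω : Sample nt nr T) : Fin (nt * T) → ℂ := ω.2.2

/-- The received block `Y = H X + W`. -/
def received {nt nr T : ℕ} (D : Fin (nt * T) → Matrix (Fin nt) (Fin T) ℂ) (θ : ℝ)
    (ω : Sample nt nr T) : Matrix (Fin nr) (Fin T) ℂ :=
  ω.channel * codeword D θ ω.symbols + ω.noise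

/-! ## Maximum likelihood decoding and the diversity gain -/

/-- A coherent ML decoder for a codebook: from `Y` and `H` it selects a codeword minimizing
`‖Y - H X‖`, with an arbitrary rule for breaking ties. -/
def IsMLDecoder {nt nr T : ℕ} (C : Finset (Matrix (Fin nt) (Fin T) ℂ))
    (dec : Matrix (Fin nr) (Fin T) ℂ → Matrix (Fin nr) (Fin nt) ℂ → Matrix (Fin nt) (Fin T) ℂ) :
    Prop :=
  ∀ Y H, dec Y H ∈ C ∧ ∀ X ∈ C, frobSq (Y - H * dec Y H) ≤ frobSq (Y - H * X)

/-- The probability that a decoder does not return the transmitted codeword. -/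
def errorProb {nt nr T : ℕ} (D : Fin (nt * T) → Matrix (Fin nt) (Fin T) ℂ) (θ η : ℝ)
    (dec : Matrix (Fin nr) (Fin T) ℂ → Matrix (Fin nr) (Fin nt) ℂ → Matrix (Fin nt) (Fin T) ℂ) :
    ℝ≥0∞ :=
  sampleLaw nt nr T η
    {ω | dec (received D θ ω) ω.channel ≠ codeword D θ ω.symbols}

/-- `- log p(ρ) / log ρ`, with `log 0 = -∞`. -/
def decayRate (p : ℝ → ℝ≥0∞) (ρ : ℝ) : EReal :=
  -(ENNReal.log (p ρ) / ((Real.log ρ : ℝ) : EReal))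

/-! ## The sphere decoder -/

/-- The code-channel generator matrix `M = θ (I_T ⊗ H) G`. -/
def codeChannel {nt nr T : ℕ} (D : Fin (nt * T) → Matrix (Fin nt) (Fin T) ℂ) (θ : ℝ)
    (H : Matrix (Fin nr) (Fin nt) ℂ) : Matrix (Fin T × Fin nr) (Fin (nt * T)) ℂ :=
  (θ : ℂ) • (((1 : Matrix (Fin T) (Fin T) ℂ) ⊗ₖ H) * generator D)

/-- Thin QR decomposition `Q R = M`: `Q` has orthonormal columns and `R` is upper triangular. -/
def IsThinQR {m : Type*} [Fintype m] {n : ℕ} (M : Matrix m (Fin n) ℂ)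
    (Q : Matrix m (Fin n) ℂ) (R : Matrix (Fin n) (Fin n) ℂ) : Prop :=
  Qᴴ * Q = 1 ∧ R.BlockTriangular id ∧ Q * R = M

/-- The indices of the last `k` out of `n` components. -/
def lastIdx {n k : ℕ} (h : k ≤ n) (j : Fin k) : Fin n := ⟨n - k + j, by omega⟩

open scoped Classical in
/-- The visited nodes at layer `k`: the vectors `ŝ_k` of `k` constellation symbols with
`‖r_k - R_k ŝ_k‖² ≤ ξ²`, where `r_k` holds the last `k` components of `rv` and `R_k` is the
lower right `k × k` corner of `R`. -/
def visitedNodes {n : ℕ} (rv : Fin n → ℂ) (R : Matrix (Fin n) (Fin n) ℂ) (η ξ : ℝ)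
    (k : ℕ) (hk : k ≤ n) : Finset (Fin k → ℂ) :=
  (symbolVectors k η).filter fun s =>
    sqNorm ((fun j => rv (lastIdx hk j)) - R.submatrix (lastIdx hk) (lastIdx hk) *ᵥ s) ≤ ξ ^ 2

/-- The total number of visited nodes in the layers `1, …, n`. -/
def numVisited {n : ℕ} (rv : Fin n → ℂ) (R : Matrix (Fin n) (Fin n) ℂ) (η ξ : ℝ) : ℕ :=
  ∑ k : Fin n, (visitedNodes rv R η ξ (k + 1) k.isLt).card

/-- The number `N` of nodes the sphere decoder visits, when it uses the thin QR decomposition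
`(Q H, R H)` of the code-channel matrix of `H`; the data vector is `Qᴴ vec(Y)`. -/
def complexity {nt nr T : ℕ} (D : Fin (nt * T) → Matrix (Fin nt) (Fin T) ℂ) (θ η ξ : ℝ)
    (Q : Matrix (Fin nr) (Fin nt) ℂ → Matrix (Fin T × Fin nr) (Fin (nt * T)) ℂ)
    (R : Matrix (Fin nr) (Fin nt) ℂ → Matrix (Fin (nt * T)) (Fin (nt * T)) ℂ)
    (ω : Sample nt nr T) : ℕ :=
  numVisited ((Q ω.channel)ᴴ *ᵥ (received D θ ω).vec) (R ω.channel) η ξ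

/-- The probability that `N ≥ ρ ^ x`. -/
def complexityTail {nt nr T : ℕ} (D : Fin (nt * T) → Matrix (Fin nt) (Fin T) ℂ)
    (θ η ξ : ℝ → ℝ)
    (Q : ℝ → Matrix (Fin nr) (Fin nt) ℂ → Matrix (Fin T × Fin nr) (Fin (nt * T)) ℂ)
    (R : ℝ → Matrix (Fin nr) (Fin nt) ℂ → Matrix (Fin (nt * T)) (Fin (nt * T)) ℂ)
    (x ρ : ℝ) : ℝ≥0∞ :=
  sampleLaw nt nr T (η ρ)
    {ω | ρ ^ x ≤ (complexity D (θ ρ) (η ρ) (ξ ρ) (Q ρ) (R ρ) ω : ℝ)}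

/-- `Ψ x` is the limit of `-log p_x(ρ) / log ρ` as `ρ → ∞` for every `x` for which this limit
exists; for every other `x` it may be any value between the lower and the upper limit. -/
def IsDecayExponent (p : ℝ → ℝ → ℝ≥0∞) (Ψ : ℝ → EReal) : Prop :=
  ∀ x, liminf (decayRate (p x)) atTop ≤ Ψ x ∧ Ψ x ≤ limsup (decayRate (p x)) atTop

/-- The complexity exponent `inf {x | Ψ x > d}`. -/
def complexityExponent (Ψ : ℝ → EReal) (d : ℝ) : EReal :=
  sInf ((fun x : ℝ => (x : EReal)) '' {x : ℝ | (d : EReal) < Ψ x})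

/-! ## The upper bound -/

/-- The feasible set of the optimization problem (the index `i : Fin nt` stands for `i + 1`). -/
def feasible (nt nr : ℕ) (d : ℝ) : Set (Fin nt → ℝ) :=
  {α | ∑ i : Fin nt, ((nr : ℝ) - nt + 2 * ((i : ℝ) + 1) - 1) * α i ≤ d ∧
    Antitone α ∧ ∀ i, 0 ≤ α i}

/-- The objective of the optimization problem. -/
def objective (nt T : ℕ) (r : ℝ) (α : Fin nt → ℝ) : ℝ :=
  ∑ i : Fin nt, (T : ℝ) * max (min (r / nt - 1 + α i) (r / nt)) 0

/-- The upper bound on the complexity exponent. -/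
def cBar (nt nr T : ℕ) (r d : ℝ) : ℝ :=
  sSup (objective nt T r '' feasible nt nr d)

end SphereDecoding

end

/-!
A node of layer `k` of the sphere decoder is a point of a lattice box whose image under the
triangular matrix lies in a ball of radius `ξ = ρ ^ o(1)`. If the singular values of `H` decay like
`ρ ^ (-α_i / 2)`, then in each of the `T` channel uses the code-channel matrix stretches the
direction `i` of the codeword space by `θ ρ ^ (-α_i / 2)`, where `θ = ρ ^ ((1 - r / n_t) / 2 + o(1))`,
while the box has side `η = ρ ^ (r / (2 n_t) + o(1))`. A ball therefore contains about `ρ ^ g(α)`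
points, where `g` is the objective of the optimization problem, and the exponents `α` occur with
probability `ρ ^ (-∑ (n_r - n_t + 2 i - 1) α_i + o(1))`. So `N ≥ ρ ^ x` has a probability that
decays no faster than `ρ ^ (-d)` when `x < c̄`, and strictly faster when `x > c̄`.

Singular values and the Wishart density are avoided: the role of the singular values is played by
the diagonal of the triangular factor that the Gram-Schmidt process gives for the columns of `H`.
Processing the columns one by one and using the unitary invariance of Gaussian vectors, the
probability that the entries of this factor are small in prescribed rows is bounded on both sides by
products of one-dimensional Gaussian probabilities (`pi_gaussianVector_rowBound_le`,
`exists_le_pi_gaussianVector_decay`); the weight of row `j` (from `0`) is `n_r + n_t - 2 j - 1`,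
so that `j` corresponds to `i = n_t - j`.

For `x > c̄`, the columns of `H` are permuted into pivoted order, in which the triangular factor is
a diagonal matrix times a unit triangular matrix with entries of modulus at most `1`. This makes the
number of nodes in every layer at most a constant times a product over the diagonal entries
(`exists_card_visitedNodes_le`), whatever the noise and the transmitted symbols. A finite grid of
exponents and a union bound give `lt_liminf_decayRate_complexityTail`.

For `x < c̄`, take an optimal `α` and let the `p` strong directions be those with
`α_i ≤ 1 - r / n_t`, which contribute nothing to `g`. The rank condition supplies a unitary change
of basis after which the last `(n_t - p) T` symbols can be completed to a full symbol vector whose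
codeword has no component in the strong directions (`exists_lift_avoiding`). In the layer
`k = (n_t - p) T` the triangular system then contracts as much as the weak directions do, and by
the pigeonhole principle at least half of the transmitted symbol vectors have many neighbours in
their ball (`exists_le_card_visitedNodes`). This gives `limsup_decayRate_complexityTail_le`.
-/

namespace SphereDecoding

open InnerProductSpace

/-! ### The complex Gaussian distribution -/

instance : IsProbabilityMeasure complexGaussian := by
  unfold complexGaussian
  refine Measure.isProbabilityMeasure_map ?_
  exact (Complex.measurableEquivRealProd.symm.measurable).aemeasurable

theorem measurable_complexMk : Measurable fun p : ℝ × ℝ => (⟨p.1, p.2⟩ : ℂ) :=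
  Complex.measurableEquivRealProd.symm.measurable

theorem gaussianReal_half_le {s : Set ℝ} :
    gaussianReal 0 (1 / 2) s ≤ volume s := by
  rw [gaussianReal_apply _ (by norm_num)]
  calc ∫⁻ x in s, gaussianPDF 0 (1 / 2) x ≤ ∫⁻ _ in s, 1 := by
        refine lintegral_mono fun x => ?_
        rw [gaussianPDF_def, gaussianPDFReal_def, ENNReal.ofReal_le_one]
        have h1 : (1 : ℝ) ≤ √(2 * Real.pi * ((1 / 2 : ℝ≥0) : ℝ)) := by
          rw [Real.one_le_sqrt]
          push_cast
          nlinarith [Real.pi_gt_three]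
        have h2 : (√(2 * Real.pi * ((1 / 2 : ℝ≥0) : ℝ)))⁻¹ ≤ 1 := inv_le_one_of_one_le₀ h1
        have h3 : Real.exp (-(x - 0) ^ 2 / (2 * ((1 / 2 : ℝ≥0) : ℝ))) ≤ 1 := by
          rw [Real.exp_le_one_iff]
          apply div_nonpos_of_nonpos_of_nonneg
          · nlinarith [sq_nonneg (x - 0)]
          · positivity
        exact mul_le_one₀ h2 (Real.exp_nonneg _) h3
    _ = volume s := by simp

/-- On `[-2, 2]` the density of the real Gaussian distribution of variance `1 / 2` is bounded
below. -/
theorem exists_le_gaussianReal_half :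
    ∃ c : ℝ, 0 < c ∧ ∀ s : Set ℝ, MeasurableSet s → s ⊆ Set.Icc (-2) 2 →
      ENNReal.ofReal c * volume s ≤ gaussianReal 0 (1 / 2) s := by
  refine ⟨gaussianPDFReal 0 (1 / 2) 2, gaussianPDFReal_pos _ _ _ (by norm_num), ?_⟩
  intro s hs hs2
  rw [gaussianReal_apply _ (by norm_num), ← setLIntegral_const]
  refine setLIntegral_mono' hs fun x hx => ?_
  rw [gaussianPDF_def]
  refine ENNReal.ofReal_le_ofReal ?_
  simp only [gaussianPDFReal_def]
  refine mul_le_mul_of_nonneg_left ?_ (by positivity)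
  rw [Real.exp_le_exp]
  refine div_le_div_of_nonneg_right ?_ (by positivity)
  have := hs2 hx
  have h := abs_le.mpr ⟨this.1, this.2⟩
  have := sq_le_sq' this.1 this.2
  nlinarith

theorem complexGaussian_reProdIm {s t : Set ℝ} (hs : MeasurableSet s) (ht : MeasurableSet t) :
    complexGaussian (s ×ℂ t) = gaussianReal 0 (1 / 2) s * gaussianReal 0 (1 / 2) t := by
  rw [complexGaussian, Measure.map_apply measurable_complexMk, ← Measure.prod_prod]
  · congr 1
  · exact (Complex.measurable_re hs).inter (Complex.measurable_im ht)

theorem complexGaussian_closedBall_le (ε : ℝ) (hε : 0 ≤ ε) :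
    complexGaussian (Metric.closedBall 0 ε) ≤ ENNReal.ofReal (4 * ε ^ 2) := by
  calc complexGaussian (Metric.closedBall 0 ε)
      ≤ complexGaussian (Set.Icc (-ε) ε ×ℂ Set.Icc (-ε) ε) := by
        refine measure_mono fun z hz => ?_
        rw [mem_closedBall_zero_iff] at hz
        rw [Complex.mem_reProdIm]
        exact ⟨abs_le.mp ((Complex.abs_re_le_norm z).trans hz),
          abs_le.mp ((Complex.abs_im_le_norm z).trans hz)⟩
    _ ≤ volume (Set.Icc (-ε) ε) * volume (Set.Icc (-ε) ε) := by
        rw [complexGaussian_reProdIm measurableSet_Icc measurableSet_Icc]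
        exact mul_le_mul' gaussianReal_half_le gaussianReal_half_le
    _ = ENNReal.ofReal (4 * ε ^ 2) := by
        rw [Real.volume_Icc, ← ENNReal.ofReal_mul (by linarith)]
        congr 1; ring

theorem complexGaussian_singleton_zero : complexGaussian {0} = 0 := by
  have h := complexGaussian_closedBall_le 0 le_rfl
  simpa using h

theorem exists_le_complexGaussian_closedBall :
    ∃ c : ℝ, 0 < c ∧ ∀ ε : ℝ, 0 ≤ ε → ε ≤ 1 →
      ENNReal.ofReal (c * ε ^ 2) ≤ complexGaussian (Metric.closedBall 0 ε) := by
  obtain ⟨c, hc, h⟩ := exists_le_gaussianReal_half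
  refine ⟨c ^ 2, by positivity, fun ε h0 h1 => ?_⟩
  have key : ENNReal.ofReal (c * ε) ≤ gaussianReal 0 (1 / 2) (Set.Icc (-(ε / 2)) (ε / 2)) := by
    refine le_trans (le_of_eq ?_) (h _ measurableSet_Icc ?_)
    · rw [Real.volume_Icc, ← ENNReal.ofReal_mul hc.le]
      congr 1; ring
    · exact Set.Icc_subset_Icc (by linarith) (by linarith)
  calc ENNReal.ofReal (c ^ 2 * ε ^ 2) = ENNReal.ofReal (c * ε) * ENNReal.ofReal (c * ε) := by
        rw [← ENNReal.ofReal_mul (by positivity)]; congr 1; ring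
    _ ≤ _ := mul_le_mul' key key
    _ = complexGaussian (Set.Icc (-(ε / 2)) (ε / 2) ×ℂ Set.Icc (-(ε / 2)) (ε / 2)) :=
        (complexGaussian_reProdIm measurableSet_Icc measurableSet_Icc).symm
    _ ≤ _ := by
        refine measure_mono fun z hz => ?_
        rw [Complex.mem_reProdIm] at hz
        rw [mem_closedBall_zero_iff]
        have h1 := abs_le.mpr hz.1
        have h2 := abs_le.mpr hz.2
        linarith [Complex.norm_le_abs_re_add_abs_im z]

theorem complexGaussian_one_le_norm_pos : 0 < complexGaussian {z | 1 ≤ ‖z‖} := by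
  obtain ⟨c, hc, h⟩ := exists_le_gaussianReal_half
  have key : 0 < gaussianReal 0 (1 / 2) (Set.Icc 1 2) := by
    refine lt_of_lt_of_le ?_ (h _ measurableSet_Icc (Set.Icc_subset_Icc (by norm_num) le_rfl))
    rw [Real.volume_Icc, ← ENNReal.ofReal_mul hc.le]
    exact ENNReal.ofReal_pos.mpr (by linarith)
  calc 0 < complexGaussian (Set.Icc 1 2 ×ℂ Set.Icc 1 2) := by
        rw [complexGaussian_reProdIm measurableSet_Icc measurableSet_Icc]
        exact ENNReal.mul_pos key.ne' key.ne'
    _ ≤ _ := by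
        refine measure_mono fun z hz => ?_
        rw [Complex.mem_reProdIm] at hz
        exact hz.1.1.trans ((le_abs_self _).trans (Complex.abs_re_le_norm z))

theorem charFun_complexGaussian (t : ℂ) :
    charFun complexGaussian t = Complex.exp (-(‖t‖ : ℂ) ^ 2 / 4) := by
  have h1 : charFun complexGaussian t =
      charFun (gaussianReal 0 (1 / 2)) t.re * charFun (gaussianReal 0 (1 / 2)) t.im := by
    rw [charFun_apply, complexGaussian, integral_map measurable_complexMk.aemeasurable
      (by fun_prop), charFun_apply, charFun_apply, ← integral_prod_mul]
    congr 1
    ext p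
    rw [← Complex.exp_add, ← add_mul]
    congr 2
    simp [Complex.inner]
  rw [h1, charFun_gaussianReal, charFun_gaussianReal, ← Complex.exp_add]
  congr 1
  have : ((‖t‖ : ℝ) : ℂ) ^ 2 = (t.re : ℂ) ^ 2 + (t.im : ℂ) ^ 2 := by
    rw [← Complex.ofReal_pow, Complex.sq_norm, Complex.normSq_apply]
    push_cast; ring
  rw [this]
  push_cast
  ring

/-- The law of a vector with i.i.d. standard circularly symmetric complex Gaussian entries. -/
noncomputable def gaussianVector (n : ℕ) : Measure (EuclideanSpace ℂ (Fin n)) :=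
  (Measure.pi fun _ : Fin n => complexGaussian).map (WithLp.toLp 2)

theorem measurePreserving_toLp_gaussianVector (n : ℕ) :
    MeasurePreserving (WithLp.toLp 2) (Measure.pi fun _ : Fin n => complexGaussian)
      (gaussianVector n) :=
  ⟨by fun_prop, rfl⟩

instance (n : ℕ) : IsProbabilityMeasure (gaussianVector n) :=
  Measure.isProbabilityMeasure_map (by fun_prop)

theorem measurePreserving_ofLp_gaussianVector (n : ℕ) :
    MeasurePreserving (WithLp.ofLp (p := 2)) (gaussianVector n)
      (Measure.pi fun _ : Fin n => complexGaussian) := by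
  have := (measurePreserving_toLp_gaussianVector n).symm (MeasurableEquiv.toLp 2 (Fin n → ℂ))
  exact this

theorem charFun_gaussianVector (n : ℕ) (t : EuclideanSpace ℂ (Fin n)) :
    charFun (gaussianVector n) t = Complex.exp (-(‖t‖ : ℂ) ^ 2 / 4) := by
  have := charFun_pi (μ := fun _ : Fin n => complexGaussian) t
  rw [gaussianVector]
  refine this.trans ?_
  simp_rw [charFun_complexGaussian, ← Complex.exp_sum]
  congr 1
  rw [← Finset.sum_div, Finset.sum_neg_distrib, ← Complex.ofReal_pow, EuclideanSpace.norm_sq_eq]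
  push_cast
  rfl

/-- The law of a Gaussian vector is invariant under unitary maps. -/
theorem measurePreserving_isometry_gaussianVector {n : ℕ}
    (L : EuclideanSpace ℂ (Fin n) ≃ₗᵢ[ℂ] EuclideanSpace ℂ (Fin n)) :
    MeasurePreserving L (gaussianVector n) (gaussianVector n) := by
  refine ⟨L.continuous.measurable, ?_⟩
  have : IsProbabilityMeasure ((gaussianVector n).map L) :=
    Measure.isProbabilityMeasure_map L.continuous.measurable.aemeasurable
  refine Measure.ext_of_charFun (funext fun t => ?_)
  have h : charFun ((gaussianVector n).map L) t = charFun (gaussianVector n) (L.symm t) := by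
    rw [charFun_apply, integral_map L.continuous.measurable.aemeasurable (by fun_prop),
      charFun_apply]
    congr 1
    ext x
    have : inner ℝ (L x) t = inner ℝ x (L.symm t) := by
      have h1 : ‖L x - t‖ = ‖x - L.symm t‖ := by
        rw [← L.norm_map (x - L.symm t), map_sub, L.apply_symm_apply]
      rw [real_inner_eq_norm_mul_self_add_norm_mul_self_sub_norm_sub_mul_self_div_two,
        real_inner_eq_norm_mul_self_add_norm_mul_self_sub_norm_sub_mul_self_div_two, h1,
        L.norm_map, L.symm.norm_map]
    rw [this]
  rw [h, charFun_gaussianVector, charFun_gaussianVector, L.symm.norm_map]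

/-- The coordinates of a Gaussian vector in an orthonormal basis are i.i.d. Gaussian. -/
theorem gaussianVector_setOf_repr_mem {n : ℕ}
    (b : OrthonormalBasis (Fin n) ℂ (EuclideanSpace ℂ (Fin n)))
    (A : Fin n → Set ℂ) (hA : ∀ i, MeasurableSet (A i)) :
    gaussianVector n {h | ∀ i, b.repr h i ∈ A i} = ∏ i, complexGaussian (A i) := by
  have h1 : MeasurePreserving (fun h => WithLp.ofLp (b.repr h)) (gaussianVector n)
      (Measure.pi fun _ : Fin n => complexGaussian) :=
    (measurePreserving_ofLp_gaussianVector n).comp (measurePreserving_isometry_gaussianVector b.repr)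
  rw [← Measure.pi_pi, ← h1.measure_preimage (MeasurableSet.univ_pi hA).nullMeasurableSet]
  congr 1
  ext h
  simp

/-! ### Probabilities of events that are described column by column -/

section

section Sequential

variable {Z : Type*} [MeasurableSpace Z] (μ : Measure Z) [IsProbabilityMeasure μ]

theorem pi_succ_apply (n : ℕ) {s : Set (Fin (n + 1) → Z)} (hs : MeasurableSet s) :
    Measure.pi (fun _ => μ) s =
      ∫⁻ g, μ {x | (Fin.snoc g x : Fin (n + 1) → Z) ∈ s} ∂Measure.pi (fun _ : Fin n => μ) := by
  have h := (measurePreserving_piFinSuccAbove (fun _ : Fin (n + 1) => μ) (Fin.last n)).symm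
  rw [← h.measure_preimage hs.nullMeasurableSet, Measure.prod_apply_symm
    ((MeasurableEquiv.piFinSuccAbove (fun _ => Z) (Fin.last n)).symm.measurable hs)]
  congr 1
  ext g
  congr 1
  ext x
  have : (MeasurableEquiv.piFinSuccAbove (fun _ => Z) (Fin.last n)).symm (x, g)
      = (Fin.snoc g x : Fin (n + 1) → Z) := by
    simp [MeasurableEquiv.piFinSuccAbove, Fin.insertNthEquiv, Fin.insertNth_last']
  change (MeasurableEquiv.piFinSuccAbove (fun _ => Z) (Fin.last n)).symm (x, g) ∈ s ↔ _
  rw [this]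
  rfl

/-- If an event about `n + 1` independent variables restricts to an event about the first `n`,
and the conditional probability of the last step is always at most `c n`, then the probabilities
are at most `∏ c i`. -/
theorem pi_le_prod_of_sections (E : ∀ n : ℕ, Set (Fin n → Z)) (hE : ∀ n, MeasurableSet (E n))
    (c : ℕ → ℝ≥0∞) (N : ℕ)
    (hinit : ∀ n < N, ∀ (g : Fin n → Z) x, (Fin.snoc g x : Fin (n + 1) → Z) ∈ E (n + 1) → g ∈ E n)
    (hsec : ∀ n < N, ∀ g ∈ E n, μ {x | (Fin.snoc g x : Fin (n + 1) → Z) ∈ E (n + 1)} ≤ c n) :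
    ∀ n ≤ N, Measure.pi (fun _ => μ) (E n) ≤ ∏ i ∈ Finset.range n, c i := by
  intro n
  induction n with
  | zero => intro _; simpa using prob_le_one
  | succ n ih =>
    intro hn
    rw [pi_succ_apply μ n (hE _), Finset.prod_range_succ, mul_comm]
    calc _ ≤ ∫⁻ g, (E n).indicator (fun _ => c n) g ∂Measure.pi (fun _ : Fin n => μ) := by
          refine lintegral_mono fun g => ?_
          by_cases hg : g ∈ E n
          · simpa [hg] using hsec n hn g hg
          · have : {x | (Fin.snoc g x : Fin (n + 1) → Z) ∈ E (n + 1)} = ∅ := by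
              ext x
              simpa using fun h => hg (hinit n hn g x h)
            simp [this]
      _ = c n * Measure.pi (fun _ => μ) (E n) := by
          rw [lintegral_indicator_const (hE n)]
      _ ≤ _ := by gcongr; exact ih (by omega)

/-- The lower bound that goes with `pi_le_prod_of_sections`; here membership of the first `n` variables
in `E n` is only used as a condition. -/
theorem prod_le_pi_of_sections (E : ∀ n : ℕ, Set (Fin n → Z)) (hE : ∀ n, MeasurableSet (E n))
    (h0 : E 0 = Set.univ) (c : ℕ → ℝ≥0∞) (N : ℕ)
    (hsec : ∀ n < N, ∀ g ∈ E n, c n ≤ μ {x | (Fin.snoc g x : Fin (n + 1) → Z) ∈ E (n + 1)}) :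
    ∀ n ≤ N, ∏ i ∈ Finset.range n, c i ≤ Measure.pi (fun _ => μ) (E n) := by
  intro n
  induction n with
  | zero => intro _; simp [h0]
  | succ n ih =>
    intro hn
    rw [pi_succ_apply μ n (hE _), Finset.prod_range_succ, mul_comm]
    calc c n * ∏ i ∈ Finset.range n, c i ≤ c n * Measure.pi (fun _ => μ) (E n) := by
          gcongr; exact ih (by omega)
      _ = ∫⁻ g, (E n).indicator (fun _ => c n) g ∂Measure.pi (fun _ : Fin n => μ) := by
          rw [lintegral_indicator_const (hE n)]
      _ ≤ _ := by
          refine lintegral_mono fun g => ?_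
          by_cases hg : g ∈ E n
          · simpa [hg] using hsec n hn g hg
          · simp [hg]

end Sequential

/-! ### The triangular coefficients of the Gram-Schmidt process -/

section GramSchmidt

variable {V : Type*} [NormedAddCommGroup V] [InnerProductSpace ℂ V]

/-- The entry in row `j` and column `l` of the triangular factor of the QR decomposition of
`f₀, …, fₙ₋₁` that the Gram-Schmidt process produces. -/
noncomputable def qrCoeff {n : ℕ} (f : Fin n → V) (j l : Fin n) : ℂ :=
  inner ℂ (gramSchmidtNormed ℂ f j) (f l)

theorem gramSchmidt_eq_sub {n : ℕ} (f : Fin n → V) (l : Fin n) :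
    gramSchmidt ℂ f l = f l - ∑ j ∈ Finset.Iio l, qrCoeff f j l • gramSchmidtNormed ℂ f j := by
  rw [gramSchmidt_def]
  congr 1
  refine Finset.sum_congr rfl fun j _ => ?_
  rw [Submodule.starProjection_singleton, qrCoeff, gramSchmidtNormed, inner_smul_left, smul_smul]
  congr 1
  simp only [map_inv₀, Complex.coe_algebraMap, Complex.conj_ofReal, Complex.ofReal_pow]
  rw [div_eq_mul_inv, pow_two, mul_inv]
  ring

theorem gramSchmidt_snoc_castSucc {n : ℕ} (f : Fin n → V) (x : V) (j : Fin n) :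
    gramSchmidt ℂ (Fin.snoc f x : Fin (n + 1) → V) j.castSucc = gramSchmidt ℂ f j := by
  induction j using WellFoundedLT.induction with
  | _ j ih =>
    rw [gramSchmidt_def, gramSchmidt_def, Fin.Iio_castSucc, Finset.sum_map, Fin.snoc_castSucc]
    congr 1
    refine Finset.sum_congr rfl fun i hi => ?_
    rw [Fin.castSuccEmb_apply, ih i (Finset.mem_Iio.mp hi)]

theorem gramSchmidtNormed_snoc_castSucc {n : ℕ} (f : Fin n → V) (x : V) (j : Fin n) :
    gramSchmidtNormed ℂ (Fin.snoc f x : Fin (n + 1) → V) j.castSucc = gramSchmidtNormed ℂ f j := by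
  rw [gramSchmidtNormed, gramSchmidtNormed, gramSchmidt_snoc_castSucc]

theorem qrCoeff_snoc_castSucc {n : ℕ} (f : Fin n → V) (x : V) (j l : Fin n) :
    qrCoeff (Fin.snoc f x : Fin (n + 1) → V) j.castSucc l.castSucc = qrCoeff f j l := by
  rw [qrCoeff, qrCoeff, gramSchmidtNormed_snoc_castSucc, Fin.snoc_castSucc]

theorem qrCoeff_snoc_last {n : ℕ} (f : Fin n → V) (x : V) (j : Fin n) :
    qrCoeff (Fin.snoc f x : Fin (n + 1) → V) j.castSucc (Fin.last n)
      = inner ℂ (gramSchmidtNormed ℂ f j) x := by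
  rw [qrCoeff, gramSchmidtNormed_snoc_castSucc, Fin.snoc_last]

theorem qrCoeff_eq_inner_gramSchmidt {n : ℕ} (f : Fin n → V) {j l : Fin n} (h : l ≤ j) :
    qrCoeff f j l = inner ℂ (gramSchmidtNormed ℂ f j) (gramSchmidt ℂ f l) := by
  rw [gramSchmidt_eq_sub, inner_sub_right, inner_sum, Finset.sum_eq_zero, sub_zero, qrCoeff]
  intro i hi
  have hij : j ≠ i := (lt_of_lt_of_le (Finset.mem_Iio.mp hi) h).ne'
  simp [gramSchmidtNormed, inner_smul_left, inner_smul_right, gramSchmidt_orthogonal ℂ f hij]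

theorem qrCoeff_self {n : ℕ} (f : Fin n → V) (l : Fin n) :
    qrCoeff f l l = (‖gramSchmidt ℂ f l‖ : ℂ) := by
  rw [qrCoeff_eq_inner_gramSchmidt f le_rfl, gramSchmidtNormed, inner_smul_left,
    inner_self_eq_norm_sq_to_K]
  by_cases h : ‖gramSchmidt ℂ f l‖ = 0
  · simp [h]
  · have h' : (‖gramSchmidt ℂ f l‖ : ℂ) ≠ 0 := by exact_mod_cast h
    simp only [map_inv₀, Complex.coe_algebraMap, Complex.conj_ofReal]
    field_simp

theorem qrCoeff_eq_zero {n : ℕ} (f : Fin n → V) {j l : Fin n} (h : l < j) : qrCoeff f j l = 0 := by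
  rw [qrCoeff_eq_inner_gramSchmidt f h.le, gramSchmidtNormed, inner_smul_left,
    gramSchmidt_orthogonal ℂ f h.ne', mul_zero]

theorem orthonormal_gramSchmidtNormed {n : ℕ} {f : Fin n → V} (h : ∀ l, gramSchmidt ℂ f l ≠ 0) :
    Orthonormal ℂ (gramSchmidtNormed ℂ f) := by
  refine ⟨fun i => gramSchmidtNormed_unit_length' ?_, fun i j hij => ?_⟩
  · rw [gramSchmidtNormed]
    simpa using h i
  · simp [gramSchmidtNormed, inner_smul_left, inner_smul_right, gramSchmidt_orthogonal ℂ f hij]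

/-- The QR decomposition of a matrix with columns `f l`. -/
theorem sum_qrCoeff_smul {n : ℕ} {f : Fin n → V} (h : ∀ l, gramSchmidt ℂ f l ≠ 0) (l : Fin n) :
    f l = ∑ j, qrCoeff f j l • gramSchmidtNormed ℂ f j := by
  have h1 : f l = ∑ j ∈ Finset.Iio l, qrCoeff f j l • gramSchmidtNormed ℂ f j
      + qrCoeff f l l • gramSchmidtNormed ℂ f l := by
    have h2 : qrCoeff f l l • gramSchmidtNormed ℂ f l = gramSchmidt ℂ f l := by
      rw [qrCoeff_self, gramSchmidtNormed, smul_smul]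
      have : (‖gramSchmidt ℂ f l‖ : ℂ) ≠ 0 := by exact_mod_cast norm_ne_zero_iff.mpr (h l)
      simp [this]
    rw [h2, gramSchmidt_eq_sub]
    abel
  have h3 : ∑ j ∈ Finset.Iio l, qrCoeff f j l • gramSchmidtNormed ℂ f j
      + qrCoeff f l l • gramSchmidtNormed ℂ f l
      = ∑ j ∈ Finset.Iic l, qrCoeff f j l • gramSchmidtNormed ℂ f j := by
    rw [← Finset.Iio_insert, Finset.sum_insert (by simp), add_comm]
  rw [h1, h3]
  refine Finset.sum_subset (Finset.subset_univ _) fun j _ hj => ?_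
  rw [qrCoeff_eq_zero f (by simpa using hj), zero_smul]

/-- The norm of a combination of the columns, read off from the triangular factor. -/
theorem norm_sq_sum_smul_eq {n : ℕ} {f : Fin n → V} (h : ∀ l, gramSchmidt ℂ f l ≠ 0)
    (y : Fin n → ℂ) :
    ‖∑ l, y l • f l‖ ^ 2 = ∑ j, ‖∑ l, qrCoeff f j l * y l‖ ^ 2 := by
  have h1 : ∑ l, y l • f l = ∑ j, (∑ l, qrCoeff f j l * y l) • gramSchmidtNormed ℂ f j := by
    simp_rw [Finset.sum_smul]
    rw [Finset.sum_comm]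
    refine Finset.sum_congr rfl fun l _ => ?_
    conv_lhs => rw [sum_qrCoeff_smul h l]
    rw [Finset.smul_sum]
    refine Finset.sum_congr rfl fun j _ => ?_
    rw [smul_smul, mul_comm]
  rw [h1]
  have h2 := (orthonormal_gramSchmidtNormed h).inner_sum
    (fun j => ∑ l, qrCoeff f j l * y l) (fun j => ∑ l, qrCoeff f j l * y l) Finset.univ
  have h3 := inner_self_eq_norm_sq_to_K (𝕜 := ℂ)
    (∑ j, (∑ l, qrCoeff f j l * y l) • gramSchmidtNormed ℂ f j)
  rw [h2] at h3
  have h4 : ∑ j, (starRingEnd ℂ) (∑ l, qrCoeff f j l * y l) * (∑ l, qrCoeff f j l * y l)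
      = ((∑ j, ‖∑ l, qrCoeff f j l * y l‖ ^ 2 : ℝ) : ℂ) := by
    push_cast
    refine Finset.sum_congr rfl fun j _ => ?_
    rw [mul_comm, Complex.mul_conj, Complex.normSq_eq_norm_sq]
    push_cast
    rfl
  rw [h4] at h3
  refine Complex.ofReal_injective (Eq.trans ?_ h3.symm)
  rw [Complex.ofReal_pow]
  rfl

theorem measurable_gramSchmidt [MeasurableSpace V] [BorelSpace V] [SecondCountableTopology V]
    {n : ℕ} (l : Fin n) : Measurable fun f : Fin n → V => gramSchmidt ℂ f l := by
  induction l using WellFoundedLT.induction with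
  | _ l ih =>
    simp_rw [gramSchmidt_def ℂ _ l, Submodule.starProjection_singleton]
    refine (measurable_pi_apply l).sub (Finset.measurable_sum _ fun j hj => ?_)
    have hj' := ih j (Finset.mem_Iio.mp hj)
    have h1 : Measurable fun f : Fin n → V => inner ℂ (gramSchmidt ℂ f j) (f l) :=
      hj'.inner (measurable_pi_apply l)
    have h2 : Measurable fun f : Fin n → V => ((‖gramSchmidt ℂ f j‖ ^ 2 : ℝ) : ℂ) :=
      Complex.measurable_ofReal.comp (hj'.norm.pow_const 2)
    exact (h1.div h2).smul hj'

theorem measurable_qrCoeff [MeasurableSpace V] [BorelSpace V] [SecondCountableTopology V]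
    {n : ℕ} (j l : Fin n) : Measurable fun f : Fin n → V => qrCoeff f j l := by
  have h1 : Measurable fun f : Fin n → V => ((‖gramSchmidt ℂ f j‖ : ℂ))⁻¹ :=
    (Complex.measurable_ofReal.comp (measurable_gramSchmidt j).norm).inv
  exact (h1.smul (measurable_gramSchmidt j)).inner (measurable_pi_apply l)

end GramSchmidt

/-! ### Gaussian columns with prescribed triangular coefficients -/

/-- The event that `f₀, …, fₙ₋₁` are linearly independent, that the off-diagonal entries in row `j`
of the triangular factor of their QR decomposition have absolute values in `A j`, and that the
absolute value of the `l`-th diagonal entry lies in `B l`. -/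
def qrEvent {N : ℕ} (A B : ℕ → Set ℝ) (n : ℕ) : Set (Fin n → EuclideanSpace ℂ (Fin N)) :=
  {f | ∀ l, gramSchmidt ℂ f l ≠ 0 ∧ (∀ j < l, ‖qrCoeff f j l‖ ∈ A j) ∧ ‖gramSchmidt ℂ f l‖ ∈ B l}

theorem measurableSet_qrEvent {N : ℕ} {A B : ℕ → Set ℝ} (hA : ∀ i, MeasurableSet (A i))
    (hB : ∀ i, MeasurableSet (B i)) (n : ℕ) : MeasurableSet (qrEvent (N := N) A B n) := by
  have : qrEvent (N := N) A B n = ⋂ l, ({f | gramSchmidt ℂ f l = 0}ᶜ ∩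
      ((⋂ j : Fin n, ⋂ _ : j < l, {f | ‖qrCoeff f j l‖ ∈ A j}) ∩
      {f | ‖gramSchmidt ℂ f l‖ ∈ B l})) := by
    ext f
    simp [qrEvent]
  rw [this]
  refine MeasurableSet.iInter fun l => ?_
  refine (measurableSet_eq_fun (measurable_gramSchmidt l) measurable_const).compl.inter
    ((MeasurableSet.iInter fun j => MeasurableSet.iInter fun _ => ?_).inter ?_)
  · exact (measurable_qrCoeff j l).norm (hA _)
  · exact (measurable_gramSchmidt l).norm (hB _)

theorem snoc_mem_qrEvent {N : ℕ} {A B : ℕ → Set ℝ} {n : ℕ}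
    {g : Fin n → EuclideanSpace ℂ (Fin N)} {x : EuclideanSpace ℂ (Fin N)} :
    (Fin.snoc g x : Fin (n + 1) → _) ∈ qrEvent A B (n + 1) ↔
      g ∈ qrEvent A B n ∧
        gramSchmidt ℂ (Fin.snoc g x : Fin (n + 1) → EuclideanSpace ℂ (Fin N)) (Fin.last n) ≠ 0 ∧
        (∀ j : Fin n, ‖inner ℂ (gramSchmidtNormed ℂ g j) x‖ ∈ A j) ∧
        ‖gramSchmidt ℂ (Fin.snoc g x : Fin (n + 1) → EuclideanSpace ℂ (Fin N)) (Fin.last n)‖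
          ∈ B n := by
  constructor
  · intro h
    refine ⟨fun l => ?_, (h (Fin.last n)).1, fun j => ?_, (h (Fin.last n)).2.2⟩
    · obtain ⟨h1, h2, h3⟩ := h l.castSucc
      rw [gramSchmidt_snoc_castSucc] at h1 h3
      refine ⟨h1, fun j hj => ?_, h3⟩
      have := h2 j.castSucc (Fin.castSucc_lt_castSucc_iff.mpr hj)
      rwa [qrCoeff_snoc_castSucc] at this
    · have := (h (Fin.last n)).2.1 j.castSucc (Fin.castSucc_lt_last j)
      rwa [qrCoeff_snoc_last] at this
  · rintro ⟨h1, h2, h3, h4⟩ l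
    refine Fin.lastCases ⟨h2, fun j hj => ?_, h4⟩ (fun l => ?_) l
    · obtain ⟨j, rfl⟩ := Fin.exists_castSucc_eq.mpr hj.ne
      rw [qrCoeff_snoc_last]
      exact h3 j
    · obtain ⟨h1, h5, h6⟩ := h1 l
      rw [gramSchmidt_snoc_castSucc]
      refine ⟨h1, fun j hj => ?_, h6⟩
      obtain ⟨j, rfl⟩ := Fin.exists_castSucc_eq.mpr (hj.trans (Fin.castSucc_lt_last l)).ne
      rw [qrCoeff_snoc_castSucc]
      exact h5 j (Fin.castSucc_lt_castSucc_iff.mp hj)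

/-- The Gram-Schmidt vectors of linearly independent columns extend to an orthonormal basis, in
which the residual of a further column consists of the coordinates from `n` on. -/
theorem exists_orthonormalBasis_gramSchmidt {N n : ℕ} (hn : n < N)
    {g : Fin n → EuclideanSpace ℂ (Fin N)} (hg : ∀ l, gramSchmidt ℂ g l ≠ 0) :
    ∃ b : OrthonormalBasis (Fin N) ℂ (EuclideanSpace ℂ (Fin N)),
      (∀ (j : Fin n) x, b.repr x (Fin.castLE hn.le j) = inner ℂ (gramSchmidtNormed ℂ g j) x) ∧
      ∀ x, ‖gramSchmidt ℂ (Fin.snoc g x : Fin (n + 1) → EuclideanSpace ℂ (Fin N)) (Fin.last n)‖ ^ 2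
        = ∑ i : Fin N, if (i : ℕ) < n then 0 else ‖b.repr x i‖ ^ 2 := by
  classical
  let v : Fin N → EuclideanSpace ℂ (Fin N) := fun i =>
    if h : (i : ℕ) < n then gramSchmidtNormed ℂ g ⟨i, h⟩ else 0
  have hv : Orthonormal ℂ (({i : Fin N | (i : ℕ) < n} : Set (Fin N)).domRestrict v) := by
    have h1 := (orthonormal_gramSchmidtNormed hg).comp
      (fun i : {i : Fin N | (i : ℕ) < n} => (⟨i.1, i.2⟩ : Fin n))
      (fun i j hij => by
        have := congrArg Fin.val hij
        exact Subtype.ext (Fin.ext this))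
    have h2 : ({i : Fin N | (i : ℕ) < n} : Set (Fin N)).domRestrict v =
        gramSchmidtNormed ℂ g ∘ fun i : {i : Fin N | (i : ℕ) < n} => (⟨i.1, i.2⟩ : Fin n) := by
      funext i
      have : ((i : Fin N) : ℕ) < n := i.2
      simp [v, this]
    rw [h2]
    exact h1
  obtain ⟨b, hb⟩ := hv.exists_orthonormalBasis_extension_of_card_eq (by simp)
  have hbj : ∀ j : Fin n, b (Fin.castLE hn.le j) = gramSchmidtNormed ℂ g j := by
    intro j
    rw [hb _ (by simp)]
    simp [v]
  refine ⟨b, fun j x => by rw [OrthonormalBasis.repr_apply_apply, hbj], fun x => ?_⟩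
  have h2 : gramSchmidt ℂ (Fin.snoc g x : Fin (n + 1) → EuclideanSpace ℂ (Fin N)) (Fin.last n)
      = x - ∑ j : Fin n, b.repr x (Fin.castLE hn.le j) • b (Fin.castLE hn.le j) := by
    rw [gramSchmidt_eq_sub, Fin.Iio_last_eq_map, Finset.sum_map, Fin.snoc_last]
    congr 1
    refine Finset.sum_congr rfl fun j _ => ?_
    rw [Fin.castSuccEmb_apply, qrCoeff_snoc_last, gramSchmidtNormed_snoc_castSucc, hbj,
      OrthonormalBasis.repr_apply_apply, hbj]
  rw [h2, ← b.repr.norm_map, EuclideanSpace.norm_sq_eq]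
  refine Finset.sum_congr rfl fun i _ => ?_
  have h3 : (b.repr (x - ∑ j : Fin n, b.repr x (Fin.castLE hn.le j) • b (Fin.castLE hn.le j))) i
      = if (i : ℕ) < n then 0 else b.repr x i := by
    simp only [map_sub, map_sum, map_smul, OrthonormalBasis.repr_self, PiLp.sub_apply,
      WithLp.ofLp_sum, Finset.sum_apply, PiLp.smul_apply, smul_eq_mul, PiLp.single_apply]
    split_ifs with h
    · rw [Finset.sum_eq_single ⟨i, h⟩]
      · simp
      · intro j _ hj
        have : i ≠ Fin.castLE hn.le j := fun h' => hj (Fin.ext (by simp [h']))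
        simp [this]
      · simp
    · rw [Finset.sum_eq_zero, sub_zero]
      intro j _
      have : i ≠ Fin.castLE hn.le j := fun h' => h (by simp [h'])
      simp [this]
  rw [h3]
  split_ifs <;> simp

end

theorem complexGaussian_diff_singleton_zero {s : Set ℂ} :
    complexGaussian (s \ {0}) = complexGaussian s :=
  measure_sdiff_null complexGaussian_singleton_zero

theorem gaussianVector_setOf_norm_repr_mem {n : ℕ}
    (b : OrthonormalBasis (Fin n) ℂ (EuclideanSpace ℂ (Fin n)))
    (A : Fin n → Set ℝ) (hA : ∀ i, MeasurableSet (A i)) :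
    gaussianVector n {h | ∀ i, ‖b.repr h i‖ ∈ A i}
      = ∏ i, complexGaussian {z | ‖z‖ ∈ A i} :=
  gaussianVector_setOf_repr_mem b (fun i => {z | ‖z‖ ∈ A i}) fun i => measurable_norm (hA i)

/-- In an orthonormal basis that continues the Gram-Schmidt vectors, column `l` has `N` independent
coordinates. The first `l` of them are its off-diagonal entries, and all the others are bounded by
its diagonal entry. -/
theorem pi_gaussianVector_qrEvent_le {N : ℕ} {A : ℕ → Set ℝ} (hA : ∀ j, MeasurableSet (A j))
    (hdown : ∀ j x y, 0 ≤ x → x ≤ y → y ∈ A j → x ∈ A j) {n : ℕ} (hn : n ≤ N) :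
    Measure.pi (fun _ => gaussianVector N) (qrEvent A A n) ≤
      ∏ l ∈ Finset.range n, ∏ i : Fin N, complexGaussian {z | ‖z‖ ∈ A (min i l)} := by
  refine pi_le_prod_of_sections (gaussianVector N) (fun n => qrEvent A A n)
    (measurableSet_qrEvent hA hA) _ N (fun n _ g x h => (snoc_mem_qrEvent.mp h).1) ?_ n hn
  intro n hn g hg
  obtain ⟨b, hb1, hb2⟩ := exists_orthonormalBasis_gramSchmidt hn (fun l => (hg l).1)
  rw [← gaussianVector_setOf_norm_repr_mem b (fun i => A (min i n)) (fun i => hA _)]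
  refine measure_mono fun x hx i => ?_
  obtain ⟨-, -, h1, h2⟩ := snoc_mem_qrEvent.mp hx
  by_cases hi : (i : ℕ) < n
  · rw [min_eq_left hi.le]
    have := h1 ⟨i, hi⟩
    rw [← hb1] at this
    exact this
  · rw [min_eq_right (not_lt.mp hi)]
    refine hdown _ _ _ (norm_nonneg _) ?_ h2
    refine le_of_sq_le_sq ?_ (norm_nonneg _)
    rw [hb2]
    refine le_trans (le_of_eq ?_) (Finset.single_le_sum (fun j _ => ?_) (Finset.mem_univ i))
    · simp [hi]
    · split_ifs <;> positivity

/-- Here `S l i` constrains the coordinate `i` of column `l`, in an orthonormal basis that continues the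
Gram-Schmidt vectors of the previous columns; `t` is the resulting diagonal entry. -/
theorem le_pi_gaussianVector_qrEvent {N : ℕ} {A B : ℕ → Set ℝ} (hA : ∀ j, MeasurableSet (A j))
    (hB : ∀ j, MeasurableSet (B j)) {S : ℕ → ℕ → Set ℝ} (hS : ∀ l i, MeasurableSet (S l i))
    (hSA : ∀ l i, i < l → S l i = A i)
    (hSB : ∀ l < N, ∀ a : Fin N → ℝ, (∀ i, 0 ≤ a i) → (∀ i : Fin N, l ≤ (i : ℕ) → a i ∈ S l i) →
      ∀ t, 0 ≤ t → t ^ 2 = (∑ i : Fin N, if (i : ℕ) < l then 0 else a i ^ 2) → t ∈ B l ∧ t ≠ 0)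
    {n : ℕ} (hn : n ≤ N) :
    ∏ l ∈ Finset.range n, ∏ i : Fin N, complexGaussian {z | ‖z‖ ∈ S l i} ≤
      Measure.pi (fun _ => gaussianVector N) (qrEvent A B n) := by
  refine prod_le_pi_of_sections (gaussianVector N) (fun n => qrEvent A B n)
    (measurableSet_qrEvent hA hB) ?_ _ N ?_ n hn
  · ext f
    simp [qrEvent]
  intro n hn g hg
  obtain ⟨b, hb1, hb2⟩ := exists_orthonormalBasis_gramSchmidt hn (fun l => (hg l).1)
  rw [← gaussianVector_setOf_norm_repr_mem b (fun i => S n i) (fun i => hS _ _)]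
  refine measure_mono fun x hx => ?_
  have h1 := hSB n hn (fun i => ‖b.repr x i‖) (fun i => norm_nonneg _) (fun i _ => hx i) _
    (norm_nonneg _) (hb2 x)
  refine snoc_mem_qrEvent.mpr ⟨hg, norm_ne_zero_iff.mp h1.2, fun j => ?_, h1.1⟩
  have := hx (Fin.castLE hn.le j)
  rw [hSA _ _ (by simp), hb1] at this
  exact this

/-- In the QR decomposition of an `N × n` matrix, `N + n - 2 j - 1` entries of the orthonormal
coordinates of the columns are as small as the `j`-th diagonal entry: the `N - j` remaining
coordinates of column `j`, and one coordinate of each later column. -/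
theorem sum_sum_min_eq (N n : ℕ) (hn : n ≤ N) (β : ℕ → ℝ) :
    ∑ l ∈ Finset.range n, ∑ i : Fin N, β (min i l)
      = ∑ j ∈ Finset.range n, ((N : ℝ) + n - 2 * j - 1) * β j := by
  induction n with
  | zero => simp
  | succ n ih =>
    rw [Finset.sum_range_succ, ih (by omega), Finset.sum_range_succ]
    have h1 : ∑ i : Fin N, β (min i n) = ∑ j ∈ Finset.range n, β j + ((N : ℝ) - n) * β n := by
      rw [Fin.sum_univ_eq_sum_range (fun i => β (min i n)) N,
        ← Finset.sum_range_add_sum_Ico _ (show n ≤ N by omega)]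
      congr 1
      · refine Finset.sum_congr rfl fun j hj => ?_
        rw [min_eq_left (Finset.mem_range.mp hj).le]
      · rw [Finset.sum_congr rfl (g := fun _ => β n)]
        · rw [Finset.sum_const, Nat.card_Ico, nsmul_eq_mul, Nat.cast_sub (by omega)]
        · intro j hj
          rw [min_eq_right (Finset.mem_Ico.mp hj).1]
    have h2 : ∑ j ∈ Finset.range n, ((N : ℝ) + (n + 1 : ℕ) - 2 * j - 1) * β j
        = ∑ j ∈ Finset.range n, ((N : ℝ) + n - 2 * j - 1) * β j + ∑ j ∈ Finset.range n, β j := by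
      rw [← Finset.sum_add_distrib]
      refine Finset.sum_congr rfl fun j _ => ?_
      push_cast; ring
    rw [h1, h2]
    push_cast; ring

theorem prod_ofReal_const_mul_rpow (N n : ℕ) (hn : n ≤ N) (β : ℕ → ℝ) {C ρ : ℝ} (hC : 0 ≤ C)
    (hρ : 0 < ρ) :
    ∏ l ∈ Finset.range n, ∏ i : Fin N, ENNReal.ofReal (C * ρ ^ (-β (min i l)))
      = ENNReal.ofReal (C ^ (N * n) *
        ρ ^ (-∑ j ∈ Finset.range n, ((N : ℝ) + n - 2 * j - 1) * β j)) := by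
  have h1 : ∀ l, ∏ i : Fin N, ENNReal.ofReal (C * ρ ^ (-β (min i l)))
      = ENNReal.ofReal (C ^ N * ρ ^ (-∑ i : Fin N, β (min i l))) := by
    intro l
    rw [← ENNReal.ofReal_prod_of_nonneg (fun i _ => by positivity), Finset.prod_mul_distrib,
      Finset.prod_const, ← Finset.sum_neg_distrib, ← Real.rpow_sum_of_pos hρ]
    simp
  simp_rw [h1]
  rw [← ENNReal.ofReal_prod_of_nonneg (fun i _ => by positivity), Finset.prod_mul_distrib,
    Finset.prod_const, ← Real.rpow_sum_of_pos hρ, Finset.sum_neg_distrib, sum_sum_min_eq N n hn,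
    pow_mul, Finset.card_range]

/-- The bound `r_j ≤ ρ ^ (-β_j / 2)` on the `j`-th row, which is void when `β_j = 0`. -/
def rowBound (ρ : ℝ) (β : ℕ → ℝ) (j : ℕ) : Set ℝ := {x | β j = 0 ∨ x ≤ ρ ^ (-(β j / 2))}

theorem measurableSet_rowBound (ρ : ℝ) (β : ℕ → ℝ) (j : ℕ) : MeasurableSet (rowBound ρ β j) := by
  by_cases h : β j = 0
  · simp [rowBound, h]
  · simp only [rowBound, h, false_or]
    exact measurableSet_Iic

theorem rpow_neg_half_sq {ρ : ℝ} (hρ : 0 < ρ) (b : ℝ) : (ρ ^ (-(b / 2))) ^ 2 = ρ ^ (-b) := by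
  rw [← Real.rpow_natCast, ← Real.rpow_mul hρ.le]
  congr 1
  push_cast; ring

theorem pi_gaussianVector_rowBound_le {N n : ℕ} (hn : n ≤ N) (β : ℕ → ℝ) {ρ : ℝ} (hρ : 0 < ρ) :
    Measure.pi (fun _ => gaussianVector N) (qrEvent (rowBound ρ β) (rowBound ρ β) n) ≤
      ENNReal.ofReal (4 ^ (N * n) *
        ρ ^ (-∑ j ∈ Finset.range n, ((N : ℝ) + n - 2 * j - 1) * β j)) := by
  refine (pi_gaussianVector_qrEvent_le (measurableSet_rowBound ρ β) ?_ hn).trans ?_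
  · rintro j x y - hxy (h | h)
    · exact Or.inl h
    · exact Or.inr (hxy.trans h)
  rw [← prod_ofReal_const_mul_rpow N n hn β (by norm_num) hρ]
  refine Finset.prod_le_prod' fun l _ => Finset.prod_le_prod' fun i _ => ?_
  by_cases h : β (min i l) = 0
  · refine prob_le_one.trans ?_
    rw [h, neg_zero, Real.rpow_zero]
    simp
  · refine le_trans (measure_mono ?_)
      ((complexGaussian_closedBall_le (ρ ^ (-(β (min i l) / 2))) (by positivity)).trans ?_)
    · intro z hz
      rw [mem_closedBall_zero_iff]
      exact hz.resolve_left h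
    · rw [rpow_neg_half_sq hρ]

/-- The off-diagonal bounds of the event in which the first `p` columns are of constant order and
nearly orthogonal, and the others decay with the exponents `β j / 2`. -/
def offDiagBound (p : ℕ) (δ ρ : ℝ) (β : ℕ → ℝ) (j : ℕ) : Set ℝ :=
  if j < p then Set.Iic δ else Set.Iic (ρ ^ (-(β j / 2)))

/-- The diagonal bounds that go with `offDiagBound`. -/
def diagBound (p : ℕ) (ρ : ℝ) (β : ℕ → ℝ) (j : ℕ) : Set ℝ :=
  if j < p then Set.Ici 1 else Set.Iic (ρ ^ (-(β j / 2)))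

theorem measurableSet_offDiagBound (p : ℕ) (δ ρ : ℝ) (β : ℕ → ℝ) (j : ℕ) :
    MeasurableSet (offDiagBound p δ ρ β j) := by
  rw [offDiagBound]
  split_ifs <;> exact measurableSet_Iic

theorem measurableSet_diagBound (p : ℕ) (ρ : ℝ) (β : ℕ → ℝ) (j : ℕ) :
    MeasurableSet (diagBound p ρ β j) := by
  rw [diagBound]
  split_ifs
  exacts [measurableSet_Ici, measurableSet_Iic]

/-- The columns `j < p` are kept of constant order and nearly orthogonal, at the price of a constant
factor in the probability only. -/
theorem exists_le_pi_gaussianVector_decay {N n : ℕ} (hn : n ≤ N) (p : ℕ) {δ : ℝ} (hδ : 0 < δ)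
    (hδ1 : δ ≤ 1) (β : ℕ → ℝ) (hβ : ∀ j, 0 ≤ β j) (hβp : ∀ j < p, β j = 0) :
    ∃ c : ℝ, 0 < c ∧ ∀ ρ : ℝ, 1 ≤ ρ →
      ENNReal.ofReal (c * ρ ^ (-∑ j ∈ Finset.range n, ((N : ℝ) + n - 2 * j - 1) * β j)) ≤
      Measure.pi (fun _ => gaussianVector N)
        (qrEvent (offDiagBound p δ ρ β) (diagBound p ρ β) n) := by
  obtain ⟨c, hc, hball⟩ := exists_le_complexGaussian_closedBall
  obtain ⟨c1, hc1, hge⟩ : ∃ c1 : ℝ, 0 < c1 ∧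
      ENNReal.ofReal c1 ≤ complexGaussian {z | 1 ≤ ‖z‖} :=
    ⟨_, ENNReal.toReal_pos complexGaussian_one_le_norm_pos.ne' (measure_ne_top _ _),
      ENNReal.ofReal_toReal_le⟩
  rcases Nat.eq_zero_or_pos N with hN | hN
  · obtain rfl : n = 0 := by omega
    refine ⟨1, one_pos, fun ρ hρ => ?_⟩
    have : qrEvent (N := N) (offDiagBound p δ ρ β) (diagBound p ρ β) 0 = Set.univ := by
      ext f; simp [qrEvent]
    rw [this]
    simp
  have hN' : (1 : ℝ) ≤ N := by exact_mod_cast hN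
  set κ : ℝ := min (min 1 (c * δ ^ 2)) (min c1 (c / N ^ 2)) with hκ
  have hκ0 : 0 < κ := by
    have : 0 < c / (N : ℝ) ^ 2 := by positivity
    have : 0 < c * δ ^ 2 := by positivity
    simp only [hκ, lt_min_iff]
    exact ⟨⟨one_pos, this⟩, hc1, by positivity⟩
  have hκ1 : κ ≤ 1 := (min_le_left _ _).trans (min_le_left _ _)
  have hκ2 : κ ≤ c * δ ^ 2 := (min_le_left _ _).trans (min_le_right _ _)
  have hκ3 : κ ≤ c1 := (min_le_right _ _).trans (min_le_left _ _)
  have hκ4 : κ ≤ c / N ^ 2 := (min_le_right _ _).trans (min_le_right _ _)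
  refine ⟨κ ^ (N * n), by positivity, fun ρ hρ => ?_⟩
  have hρ0 : 0 < ρ := by linarith
  let S : ℕ → ℕ → Set ℝ := fun l i =>
    if i < l then offDiagBound p δ ρ β i
    -- the coordinates from `l` on make up the diagonal entry, hence the factor `1 / N`
    else if l < p then (if i = l then Set.Ici 1 else Set.univ)
    else Set.Ioc 0 (ρ ^ (-(β l / 2)) / N)
  have hSm : ∀ l i, MeasurableSet (S l i) := by
    intro l i
    simp only [S, offDiagBound]
    split_ifs <;> measurability
  have hε : ∀ j, ρ ^ (-(β j / 2)) ≤ 1 := fun j =>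
    Real.rpow_le_one_of_one_le_of_nonpos hρ (by linarith [hβ j])
  refine le_trans ?_ (le_pi_gaussianVector_qrEvent (S := S) ?_ ?_ hSm ?_ ?_ hn)
  · rw [← prod_ofReal_const_mul_rpow N n hn β hκ0.le hρ0]
    refine Finset.prod_le_prod' fun l _ => Finset.prod_le_prod' fun i _ => ?_
    simp only [S, offDiagBound]
    by_cases h1 : (i : ℕ) < l
    · rw [min_eq_left h1.le]
      simp only [h1, if_true]
      by_cases h2 : (i : ℕ) < p
      · simp only [h2, if_true, hβp _ h2, neg_zero, Real.rpow_zero, mul_one]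
        refine (ENNReal.ofReal_le_ofReal hκ2).trans ((hball δ hδ.le hδ1).trans (measure_mono ?_))
        intro z hz
        simpa using hz
      · simp only [h2, if_false]
        refine le_trans (ENNReal.ofReal_le_ofReal ?_)
          ((hball (ρ ^ (-(β i / 2))) (by positivity) (hε _)).trans (measure_mono ?_))
        · rw [rpow_neg_half_sq hρ0]
          refine mul_le_mul_of_nonneg_right (hκ2.trans ?_) (by positivity)
          exact mul_le_of_le_one_right hc.le (pow_le_one₀ hδ.le hδ1)
        · intro z hz
          simpa using hz
    · rw [min_eq_right (not_lt.mp h1)]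
      simp only [h1, if_false]
      by_cases h2 : l < p
      · simp only [h2, if_true, hβp _ h2, neg_zero, Real.rpow_zero, mul_one]
        by_cases h3 : (i : ℕ) = l
        · simp only [h3, if_true]
          exact (ENNReal.ofReal_le_ofReal hκ3).trans hge
        · simp only [h3, if_false]
          simpa using hκ1
      · simp only [h2, if_false]
        have h4 : ρ ^ (-(β l / 2)) / N ≤ 1 :=
          (div_le_self (by positivity) hN').trans (hε l)
        refine le_trans (ENNReal.ofReal_le_ofReal ?_)
          ((hball (ρ ^ (-(β l / 2)) / N) (by positivity) h4).trans ?_)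
        · rw [div_pow, rpow_neg_half_sq hρ0]
          calc κ * ρ ^ (-β l) ≤ c / N ^ 2 * ρ ^ (-β l) :=
                mul_le_mul_of_nonneg_right hκ4 (by positivity)
            _ = _ := by ring
        · rw [← complexGaussian_diff_singleton_zero]
          refine measure_mono fun z hz => ?_
          have := mem_closedBall_zero_iff.mp hz.1
          exact ⟨norm_pos_iff.mpr hz.2, this⟩
  · exact measurableSet_offDiagBound p δ ρ β
  · exact measurableSet_diagBound p ρ β
  · intro l i h
    simp [S, h]
  · intro l hl a ha haS t ht htsum
    have hsingle : a ⟨l, hl⟩ ^ 2 ≤ t ^ 2 := by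
      rw [htsum]
      refine le_trans (le_of_eq ?_)
        (Finset.single_le_sum (fun j _ => ?_) (Finset.mem_univ (⟨l, hl⟩ : Fin N)))
      · simp
      · split_ifs <;> positivity
    have hl' := haS ⟨l, hl⟩ le_rfl
    have hat : a ⟨l, hl⟩ ≤ t := le_of_sq_le_sq hsingle ht
    by_cases h2 : l < p
    · simp only [S, lt_irrefl, if_false, h2, if_true, Set.mem_Ici] at hl'
      simp only [diagBound, h2, if_true, Set.mem_Ici]
      exact ⟨hl'.trans hat, by linarith⟩
    · simp only [S, lt_irrefl, if_false, h2, Set.mem_Ioc] at hl'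
      simp only [diagBound, h2, if_false, Set.mem_Iic]
      refine ⟨le_of_sq_le_sq ?_ (by positivity), by linarith⟩
      rw [htsum]
      calc (∑ i : Fin N, if (i : ℕ) < l then 0 else a i ^ 2)
          ≤ ∑ i : Fin N, (ρ ^ (-(β l / 2)) / N) ^ 2 := by
            refine Finset.sum_le_sum fun i _ => ?_
            split_ifs with h3
            · positivity
            · have := haS i (not_lt.mp h3)
              simp only [S, h3, if_false, h2, Set.mem_Ioc] at this
              exact pow_le_pow_left₀ (ha i) this.2 2
        _ = (ρ ^ (-(β l / 2))) ^ 2 / N := by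
            rw [Finset.sum_const, Finset.card_univ, Fintype.card_fin, nsmul_eq_mul]
            field_simp
        _ ≤ _ := div_le_self (by positivity) hN'

/-! ### The columns of a Gaussian matrix after a unitary change of coordinates -/

/-- The law of a matrix with i.i.d. standard complex Gaussian entries, as a product over rows. -/
noncomputable def gaussianMatrix (m n : ℕ) : Measure (Fin m → Fin n → ℂ) :=
  Measure.pi fun _ => Measure.pi fun _ => complexGaussian

instance (m n : ℕ) : IsProbabilityMeasure (gaussianMatrix m n) := by
  unfold gaussianMatrix; infer_instance

theorem measurePreserving_transpose_gaussianMatrix (m n : ℕ) :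
    MeasurePreserving (fun (H : Fin m → Fin n → ℂ) j i => H i j) (gaussianMatrix m n)
      (gaussianMatrix n m) := by
  have hcurry : ∀ a b : ℕ, MeasurePreserving (MeasurableEquiv.curry (Fin a) (Fin b) ℂ)
      (Measure.pi fun _ : Fin a × Fin b => complexGaussian) (gaussianMatrix a b) := by
    intro a b
    refine ⟨MeasurableEquiv.measurable _, ?_⟩
    have := Measure.infinitePi_map_curry (fun (_ : Fin a) (_ : Fin b) => complexGaussian)
    rw [gaussianMatrix]
    simpa only [Measure.infinitePi_eq_pi] using this
  have hswap := measurePreserving_piCongrLeft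
    (fun _ : Fin n × Fin m => complexGaussian) (Equiv.prodComm (Fin m) (Fin n))
  have h := ((hcurry n m).comp hswap).comp (hcurry m n).symm
  convert h using 1
  ext H j i
  simp [MeasurableEquiv.piCongrLeft, Equiv.piCongrLeft, Equiv.piCongrLeft']

theorem measurePreserving_vecMul {n : ℕ} {W : Matrix (Fin n) (Fin n) ℂ}
    (hW : W ∈ Matrix.unitaryGroup (Fin n) ℂ) :
    MeasurePreserving (fun h : Fin n → ℂ => h ᵥ* W) (Measure.pi fun _ => complexGaussian)
      (Measure.pi fun _ => complexGaussian) := by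
  have hW' : Wᵀ ∈ Matrix.unitaryGroup (Fin n) ℂ := Matrix.transpose_mem_unitaryGroup_iff.mpr hW
  let u : unitary (EuclideanSpace ℂ (Fin n) →L[ℂ] EuclideanSpace ℂ (Fin n)) :=
    ⟨Matrix.toEuclideanCLM (𝕜 := ℂ) Wᵀ, Unitary.map_mem _ hW'⟩
  have h := ((measurePreserving_ofLp_gaussianVector n).comp
    (measurePreserving_isometry_gaussianVector (Unitary.linearIsometryEquiv u))).comp
    (measurePreserving_toLp_gaussianVector n)
  convert h using 1
  ext x i
  have h1 : (Unitary.linearIsometryEquiv u) (WithLp.toLp 2 x) = WithLp.toLp 2 (Wᵀ *ᵥ x) :=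
    Matrix.toEuclideanCLM_toLp Wᵀ x
  simp [h1, Matrix.mulVec_transpose]

/-- The columns of `H W`, as vectors of a Hilbert space. -/
noncomputable def columns {m n : ℕ} (W : Matrix (Fin n) (Fin n) ℂ) (H : Fin m → Fin n → ℂ) :
    Fin n → EuclideanSpace ℂ (Fin m) :=
  fun j => WithLp.toLp 2 fun i => (Matrix.of H * W) i j

theorem measurePreserving_columns {m n : ℕ} {W : Matrix (Fin n) (Fin n) ℂ}
    (hW : W ∈ Matrix.unitaryGroup (Fin n) ℂ) :
    MeasurePreserving (columns W) (gaussianMatrix m n)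
      (Measure.pi fun _ : Fin n => gaussianVector m) := by
  have h1 : MeasurePreserving (fun (H : Fin m → Fin n → ℂ) i => H i ᵥ* W)
      (gaussianMatrix m n) (gaussianMatrix m n) :=
    measurePreserving_pi _ _ fun _ => measurePreserving_vecMul hW
  have h2 : MeasurePreserving (fun (H : Fin n → Fin m → ℂ) j => WithLp.toLp 2 (H j))
      (gaussianMatrix n m) (Measure.pi fun _ : Fin n => gaussianVector m) :=
    measurePreserving_pi _ _ fun _ => measurePreserving_toLp_gaussianVector m
  exact (h2.comp (measurePreserving_transpose_gaussianMatrix m n)).comp h1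

/-! ### Counting lattice points with cells -/

/-- Complex numbers of modulus at most `b` are divided into at most `(2 b / c + 3) ^ 2` squares of side
`c`. -/
theorem exists_cells {α ι : Type*} [Fintype ι] (F : Finset α) (f : ι → α → ℂ) (b : ι → ℝ)
    {c : ℝ} (hc : 0 < c) (hb : ∀ i, ∀ s ∈ F, ‖f i s‖ ≤ b i) (hb0 : ∀ i, 0 ≤ b i) :
    ∃ (φ : α → ι → ℤ × ℤ) (K : Finset (ι → ℤ × ℤ)), (∀ s ∈ F, φ s ∈ K) ∧
      (K.card : ℝ) ≤ ∏ i, (2 * b i / c + 3) ^ 2 ∧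
      ∀ s s', φ s = φ s' → ∀ i, ‖f i s - f i s'‖ ≤ 2 * c := by
  classical
  have hfl : ∀ x y : ℝ, |x| ≤ y → ⌊x / c⌋ ∈ Finset.Icc ⌊-(y / c)⌋ ⌊y / c⌋ := by
    intro x y h
    rw [Finset.mem_Icc, ← neg_div]
    have := abs_le.mp h
    exact ⟨Int.floor_le_floor (div_le_div_of_nonneg_right this.1 hc.le),
      Int.floor_le_floor (div_le_div_of_nonneg_right this.2 hc.le)⟩
  have hcard : ∀ y : ℝ, 0 ≤ y → ((Finset.Icc ⌊-(y / c)⌋ ⌊y / c⌋).card : ℝ) ≤ 2 * y / c + 3 := by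
    intro y hy
    have hyc : 0 ≤ y / c := by positivity
    have h1 : (0 : ℤ) ≤ ⌊y / c⌋ + 1 - ⌊-(y / c)⌋ := by
      have : ⌊-(y / c)⌋ ≤ ⌊y / c⌋ := Int.floor_le_floor (by linarith)
      linarith
    rw [Int.card_Icc, ← Int.cast_natCast (R := ℝ), Int.toNat_of_nonneg h1]
    push_cast
    have h2 := Int.floor_le (y / c)
    have h3 := Int.lt_floor_add_one (-(y / c))
    have h4 : 2 * y / c = 2 * (y / c) := by ring
    linarith
  have hdist : ∀ x y : ℝ, ⌊x / c⌋ = ⌊y / c⌋ → |x - y| ≤ c := by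
    intro x y h
    have h1 := Int.abs_sub_lt_one_of_floor_eq_floor h
    rw [← sub_div, abs_div, abs_of_pos hc, div_lt_one hc] at h1
    exact h1.le
  refine ⟨fun s i => (⌊(f i s).re / c⌋, ⌊(f i s).im / c⌋),
    Fintype.piFinset fun i => Finset.Icc ⌊-(b i / c)⌋ ⌊b i / c⌋ ×ˢ Finset.Icc ⌊-(b i / c)⌋ ⌊b i / c⌋,
    ?_, ?_, ?_⟩
  · intro s hs
    rw [Fintype.mem_piFinset]
    intro i
    rw [Finset.mem_product]
    exact ⟨hfl _ _ ((Complex.abs_re_le_norm _).trans (hb i s hs)),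
      hfl _ _ ((Complex.abs_im_le_norm _).trans (hb i s hs))⟩
  · rw [Fintype.card_piFinset]
    push_cast
    refine Finset.prod_le_prod (fun i _ => by positivity) fun i _ => ?_
    rw [Finset.card_product, pow_two]
    push_cast
    exact mul_self_le_mul_self (by positivity) (hcard _ (hb0 i))
  · intro s s' h i
    have h1 := congrFun h i
    rw [Prod.mk.injEq] at h1
    have h2 := hdist _ _ h1.1
    have h3 := hdist _ _ h1.2
    have h4 := Complex.norm_le_abs_re_add_abs_im (f i s - f i s')
    rw [Complex.sub_re, Complex.sub_im] at h4
    linarith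

theorem norm_le_of_mem_constellation {η : ℝ} {s : ℂ} (h : s ∈ constellation η) : ‖s‖ ≤ 2 * η := by
  obtain ⟨a, b, ha, hb, rfl⟩ := (mem_constellation η s).mp h
  refine (Complex.norm_le_abs_re_add_abs_im _).trans ?_
  simp only
  linarith

theorem eq_of_norm_sub_lt_one {η : ℝ} {s t : ℂ} (hs : s ∈ constellation η)
    (ht : t ∈ constellation η) (h : ‖s - t‖ < 1) : s = t := by
  obtain ⟨a, b, -, -, rfl⟩ := (mem_constellation η s).mp hs
  obtain ⟨a', b', -, -, rfl⟩ := (mem_constellation η t).mp ht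
  have h1 := (Complex.abs_re_le_norm _).trans_lt h
  have h2 := (Complex.abs_im_le_norm _).trans_lt h
  simp only [Complex.sub_re, Complex.sub_im] at h1 h2
  have h3 : |a - a'| < 1 := by exact_mod_cast h1
  have h4 : |b - b'| < 1 := by exact_mod_cast h2
  rw [Int.abs_lt_one_iff, sub_eq_zero] at h3 h4
  rw [h3, h4]

theorem norm_toLp_le {k : ℕ} (x : Fin k → ℂ) {B : ℝ} (hB : 0 ≤ B) (h : ∀ i, ‖x i‖ ≤ B) :
    ‖WithLp.toLp 2 x‖ ≤ k * B := by
  refine le_of_sq_le_sq ?_ (by positivity)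
  rw [EuclideanSpace.norm_sq_eq]
  calc ∑ i, ‖x i‖ ^ 2 ≤ ∑ i : Fin k, B ^ 2 :=
        Finset.sum_le_sum fun i _ => pow_le_pow_left₀ (norm_nonneg _) (h i) 2
    _ = k * B ^ 2 := by simp
    _ ≤ (k * B) ^ 2 := by
        rcases Nat.eq_zero_or_pos k with rfl | hk
        · simp
        · have : (1 : ℝ) ≤ k := by exact_mod_cast hk
          nlinarith [sq_nonneg B, mul_nonneg (sub_nonneg.mpr this) (sq_nonneg B)]

/-- Symbol vectors `s = L (w s)` are counted by cells for those coordinates `w s i` which are known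
to vary little (`i ∈ J`) and, for the remaining coordinates, by cells in the image `W` of the
coordinate subspace that they span, where the bound `η` on the symbols is used instead. -/
theorem card_le_of_separated {k : ℕ} {ι : Type*} [Fintype ι] [DecidableEq ι]
    (L : (ι → ℂ) →ₗ[ℂ] (Fin k → ℂ)) {C : ℝ} (hC : 0 ≤ C)
    (hL : ∀ w B, 0 ≤ B → (∀ i, ‖w i‖ ≤ B) → ∀ j, ‖L w j‖ ≤ C * B)
    {η : ℝ} (hη : 0 ≤ η) (F : Finset (Fin k → ℂ)) (hF : F ⊆ symbolVectors k η)
    (w : (Fin k → ℂ) → ι → ℂ) (hw : ∀ s ∈ F, L (w s) = s) (b : ι → ℝ) (hb0 : ∀ i, 0 ≤ b i)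
    (hb : ∀ s ∈ F, ∀ s' ∈ F, ∀ i, ‖w s i - w s' i‖ ≤ b i) (J : Finset ι)
    {c : ℝ} (hc : 0 < c) (hc1 : 4 * (k + 1 : ℝ) ^ 2 * (1 + C) * c ≤ 1) :
    (F.card : ℝ) ≤ (∏ i ∈ J, (2 * b i / c + 3) ^ 2) *
      ((4 * k * η / c + 3) ^ 2) ^ (Jᶜ.card) := by
  classical
  rcases F.eq_empty_or_nonempty with rfl | ⟨s₀, hs₀⟩
  · simp only [Finset.card_empty, Nat.cast_zero]
    positivity
  let S : Submodule ℂ (ι → ℂ) := ⨅ i ∈ J, LinearMap.ker (LinearMap.proj i : (ι → ℂ) →ₗ[ℂ] ℂ)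
  have hS : ∀ x, x ∈ S ↔ ∀ i ∈ J, x i = 0 := by
    intro x; simp [S]
  have hSdim : Module.finrank ℂ S ≤ Jᶜ.card := by
    let r : S →ₗ[ℂ] ((Jᶜ : Finset ι) → ℂ) :=
      (LinearMap.funLeft ℂ ℂ (fun i : (Jᶜ : Finset ι) => (i : ι))).comp S.subtype
    have hr : Function.Injective r := by
      rw [← LinearMap.ker_eq_bot, LinearMap.ker_eq_bot']
      intro x hx
      ext i
      by_cases hi : i ∈ J
      · exact (hS x.1).mp x.2 i hi
      · have := congrFun hx ⟨i, by simpa using hi⟩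
        exact this
    have := LinearMap.finrank_le_finrank_of_injective hr
    rwa [Module.finrank_fintype_fun_eq_card, Fintype.card_coe] at this
  let L' : (ι → ℂ) →ₗ[ℂ] EuclideanSpace ℂ (Fin k) :=
    (WithLp.linearEquiv 2 ℂ (Fin k → ℂ)).symm.toLinearMap.comp L
  let W := S.map L'
  have hWdim : Module.finrank ℂ W ≤ Jᶜ.card := (Submodule.finrank_map_le L' S).trans hSdim
  have hWk : Module.finrank ℂ W ≤ k := (Submodule.finrank_le W).trans (by simp)
  let u := stdOrthonormalBasis ℂ W
  let f : J ⊕ Fin (Module.finrank ℂ W) → (Fin k → ℂ) → ℂ := fun a s =>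
    match a with
    | .inl i => w s i - w s₀ i
    | .inr l => inner ℂ ((u l : W) : EuclideanSpace ℂ (Fin k)) (WithLp.toLp 2 s)
  let b' : J ⊕ Fin (Module.finrank ℂ W) → ℝ := fun a =>
    match a with
    | .inl i => b i
    | .inr _ => k * (2 * η)
  have hunorm : ∀ l, ‖((u l : W) : EuclideanSpace ℂ (Fin k))‖ = 1 := fun l => u.orthonormal.1 l
  have hb' : ∀ a, ∀ s ∈ F, ‖f a s‖ ≤ b' a := by
    rintro (i | l) s hs
    · exact hb s hs s₀ hs₀ i
    · refine (norm_inner_le_norm _ _).trans ?_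
      rw [hunorm, one_mul]
      refine norm_toLp_le s (by positivity) fun i => ?_
      exact norm_le_of_mem_constellation (Fintype.mem_piFinset.mp (hF hs) i)
  have hb0' : ∀ a, 0 ≤ b' a := by
    rintro (i | l)
    · exact hb0 i
    · simp only [b']; positivity
  obtain ⟨φ, K, hφK, hKcard, hφ⟩ := exists_cells F f b' hc hb' hb0'
  have hinj : Set.InjOn φ F := by
    intro s hs s' hs' hss
    have hcell := hφ s s' hss
    have hs1 := Finset.mem_coe.mp hs
    have hs1' := Finset.mem_coe.mp hs'
    set d : ι → ℂ := w s - w s' with hd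
    let dJ : ι → ℂ := fun i => if i ∈ J then d i else 0
    have hdJ : ∀ i, ‖dJ i‖ ≤ 2 * c := by
      intro i
      by_cases hi : i ∈ J
      · have := hcell (.inl ⟨i, hi⟩)
        simp only [f, sub_sub_sub_cancel_right] at this
        simpa [dJ, hi, hd] using this
      · simp [dJ, hi, hc.le]
    -- up to the small vector `dJ`, the difference is in the coordinate subspace
    have hfS : d - dJ ∈ S := by
      rw [hS]
      intro i hi
      simp [dJ, hi]
    let x : EuclideanSpace ℂ (Fin k) := L' d
    let e := L' dJ
    have hx : x = WithLp.toLp 2 s - WithLp.toLp 2 s' := by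
      simp only [x, hd, map_sub, L', LinearMap.comp_apply, hw s hs1, hw s' hs1']
      rfl
    have he : ‖e‖ ≤ k * (C * (2 * c)) :=
      norm_toLp_le _ (by positivity) (hL dJ (2 * c) (by positivity) hdJ)
    let g : W := ⟨L' (d - dJ), Submodule.mem_map_of_mem hfS⟩
    have hg : (g : EuclideanSpace ℂ (Fin k)) = x - e := map_sub L' _ _
    have hgnorm : ‖g‖ ≤ k * (2 * c + ‖e‖) := by
      rw [← u.sum_repr g]
      refine (norm_sum_le _ _).trans ?_
      calc ∑ l, ‖u.repr g l • u l‖ ≤ ∑ l : Fin (Module.finrank ℂ W), (2 * c + ‖e‖) := by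
            refine Finset.sum_le_sum fun l _ => ?_
            rw [norm_smul, u.orthonormal.1 l, mul_one, OrthonormalBasis.repr_apply_apply,
              Submodule.coe_inner, hg, inner_sub_right]
            refine (norm_sub_le _ _).trans (add_le_add ?_ ?_)
            · have := hcell (.inr l)
              simp only [f, ← inner_sub_right] at this
              rwa [← hx] at this
            · refine (norm_inner_le_norm _ _).trans ?_
              rw [hunorm, one_mul]
        _ = Module.finrank ℂ W * (2 * c + ‖e‖) := by
            rw [Finset.sum_const, Finset.card_univ, Fintype.card_fin, nsmul_eq_mul]
        _ ≤ k * (2 * c + ‖e‖) := by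
            have : (Module.finrank ℂ W : ℝ) ≤ k := by exact_mod_cast hWk
            gcongr
    -- two symbol vectors in one cell differ by less than the minimum distance of the constellation
    have hxnorm : ‖x‖ < 1 := by
      have h1 : x = g + e := by rw [hg]; abel
      have h2 : ‖x‖ ≤ ‖g‖ + ‖e‖ := by rw [h1]; exact norm_add_le _ _
      have hk : (0 : ℝ) ≤ k := Nat.cast_nonneg k
      have h3 : ‖x‖ ≤ 2 * c * k + (k + 1) * (k * (C * (2 * c))) := by
        nlinarith
      have h4 : 0 < c * (1 + C) := by positivity
      have hCc : 0 ≤ C * c := by positivity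
      nlinarith [mul_nonneg hk hk, mul_nonneg hk hCc, mul_nonneg (mul_nonneg hk hk) hCc,
        mul_nonneg hk hc.le, mul_nonneg (mul_nonneg hk hk) hc.le]
    funext i
    have h1 := Fintype.mem_piFinset.mp (hF hs1) i
    have h2 := Fintype.mem_piFinset.mp (hF hs1') i
    refine eq_of_norm_sub_lt_one h1 h2 (lt_of_le_of_lt ?_ hxnorm)
    have := PiLp.norm_apply_le x i
    rw [hx] at this ⊢
    exact this
  have hcard : F.card ≤ K.card := Finset.card_le_card_of_injOn φ hφK hinj
  calc (F.card : ℝ) ≤ K.card := by exact_mod_cast hcard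
    _ ≤ _ := hKcard
    _ = (∏ i ∈ J, (2 * b i / c + 3) ^ 2) *
        ((4 * k * η / c + 3) ^ 2) ^ (Module.finrank ℂ W) := by
        rw [Fintype.prod_sum_type]
        congr 1
        · exact Finset.prod_coe_sort J fun i => (2 * b i / c + 3) ^ 2
        · simp only [b', Finset.prod_const, Finset.card_univ, Fintype.card_fin]
          congr 3
          ring
    _ ≤ _ := by
        refine mul_le_mul_of_nonneg_left (pow_le_pow_right₀ ?_ hWdim) ?_
        · have : (0 : ℝ) ≤ 4 * k * η / c := by positivity
          exact one_le_pow₀ (by linarith)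
        · exact Finset.prod_nonneg fun i _ => by positivity

/-! ### The code-channel matrix in triangular coordinates -/

theorem sqNorm_nonneg {ι : Type*} [Fintype ι] (v : ι → ℂ) : 0 ≤ sqNorm v :=
  Finset.sum_nonneg fun _ _ => by positivity

theorem norm_sq_le_sqNorm {ι : Type*} [Fintype ι] (v : ι → ℂ) (i : ι) : ‖v i‖ ^ 2 ≤ sqNorm v :=
  Finset.single_le_sum (f := fun i => ‖v i‖ ^ 2) (fun _ _ => by positivity) (Finset.mem_univ i)

theorem sqNorm_eq_norm_toLp_sq {n : ℕ} (v : Fin n → ℂ) : sqNorm v = ‖WithLp.toLp 2 v‖ ^ 2 := by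
  rw [EuclideanSpace.norm_sq_eq]; rfl

theorem ofReal_sqNorm {ι : Type*} [Fintype ι] (v : ι → ℂ) : ((sqNorm v : ℝ) : ℂ) = star v ⬝ᵥ v := by
  simp only [sqNorm, dotProduct, Pi.star_apply, Complex.ofReal_sum]
  refine Finset.sum_congr rfl fun i _ => ?_
  rw [RCLike.star_def, mul_comm, Complex.mul_conj, Complex.normSq_eq_norm_sq]

theorem sqNorm_mulVec_of_conjTranspose_mul_self {m : Type*} [Fintype m] {n : ℕ}
    {Q : Matrix m (Fin n) ℂ} (hQ : Qᴴ * Q = 1) (v : Fin n → ℂ) : sqNorm (Q *ᵥ v) = sqNorm v := by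
  apply Complex.ofReal_injective
  rw [ofReal_sqNorm, ofReal_sqNorm, Matrix.star_mulVec, ← Matrix.dotProduct_mulVec,
    Matrix.mulVec_mulVec, hQ, Matrix.one_mulVec]

theorem IsThinQR.sqNorm_mulVec {m : Type*} [Fintype m] {n : ℕ} {M Q : Matrix m (Fin n) ℂ}
    {R : Matrix (Fin n) (Fin n) ℂ} (h : IsThinQR M Q R) (v : Fin n → ℂ) :
    sqNorm (R *ᵥ v) = sqNorm (M *ᵥ v) := by
  rw [← h.2.2, ← Matrix.mulVec_mulVec, sqNorm_mulVec_of_conjTranspose_mul_self h.1]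

theorem lastIdx_injective {n k : ℕ} (h : k ≤ n) : Function.Injective (lastIdx h) := by
  intro a b hab
  have := congrArg Fin.val hab
  simp only [lastIdx] at this
  exact Fin.ext (by omega)

theorem exists_lastIdx_eq {n k : ℕ} (h : k ≤ n) {i : Fin n} (hi : n - k ≤ i) :
    ∃ j, lastIdx h j = i :=
  ⟨⟨i - (n - k), by omega⟩, Fin.ext (by simp only [lastIdx]; omega)⟩

/-- The last rows of an upper triangular system only involve the last unknowns. -/
theorem mulVec_lastIdx {n k : ℕ} (h : k ≤ n) {R : Matrix (Fin n) (Fin n) ℂ}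
    (hR : R.BlockTriangular id) (v : Fin n → ℂ) (j : Fin k) :
    (R *ᵥ v) (lastIdx h j) =
      (R.submatrix (lastIdx h) (lastIdx h) *ᵥ fun i => v (lastIdx h i)) j := by
  simp only [Matrix.mulVec, dotProduct, Matrix.submatrix_apply]
  rw [← Finset.sum_image (f := fun i => R (lastIdx h j) i * v i) (s := Finset.univ)
    (g := lastIdx h) (fun a _ b _ hab => lastIdx_injective h hab)]
  symm
  refine Finset.sum_subset (Finset.subset_univ _) fun i _ hi => ?_
  have : i < lastIdx h j := by
    by_contra hlt
    have h1 : n - k ≤ (i : ℕ) := by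
      have := Fin.le_def.mp (not_lt.mp hlt)
      simp only [lastIdx] at this
      omega
    obtain ⟨j', rfl⟩ := exists_lastIdx_eq h h1
    exact hi (Finset.mem_image_of_mem _ (Finset.mem_univ _))
  have hz : R (lastIdx h j) i = 0 := hR this
  rw [hz, zero_mul]

theorem sqNorm_comp_lastIdx_le {n k : ℕ} (h : k ≤ n) (v : Fin n → ℂ) :
    sqNorm (fun j => v (lastIdx h j)) ≤ sqNorm v := by
  simp only [sqNorm]
  rw [← Finset.sum_image (f := fun i => ‖v i‖ ^ 2) (s := Finset.univ)
    (g := lastIdx h) (fun a _ b _ hab => lastIdx_injective h hab)]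
  exact Finset.sum_le_sum_of_subset_of_nonneg (Finset.subset_univ _) fun _ _ _ => by positivity

/-- For each channel use `t` the coordinates, in the basis given by the columns of the unitary
matrix `W`, of the column `t` of the codeword with symbols `v` (without the scaling). -/
noncomputable def rotatedCoords {nt T : ℕ} (D : Fin (nt * T) → Matrix (Fin nt) (Fin T) ℂ)
    (W : Matrix (Fin nt) (Fin nt) ℂ) : (Fin (nt * T) → ℂ) →ₗ[ℂ] (Fin T → Fin nt → ℂ) :=
  LinearMap.pi fun t => (Matrix.mulVecLin Wᴴ).comp
    (LinearMap.pi fun l => (LinearMap.proj (t, l)).comp (generator D).mulVecLin)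

theorem rotatedCoords_apply {nt T : ℕ} (D : Fin (nt * T) → Matrix (Fin nt) (Fin T) ℂ)
    (W : Matrix (Fin nt) (Fin nt) ℂ) (v : Fin (nt * T) → ℂ) (t : Fin T) :
    rotatedCoords D W v t = Wᴴ *ᵥ fun l => (generator D *ᵥ v) (t, l) := rfl

theorem sqNorm_codeChannel_mulVec {nt nr T : ℕ} (D : Fin (nt * T) → Matrix (Fin nt) (Fin T) ℂ)
    {W : Matrix (Fin nt) (Fin nt) ℂ} (hW : W ∈ Matrix.unitaryGroup (Fin nt) ℂ) (θ : ℝ)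
    (H : Fin nr → Fin nt → ℂ) (v : Fin (nt * T) → ℂ) :
    sqNorm (codeChannel D θ (Matrix.of H) *ᵥ v) =
      θ ^ 2 * ∑ t, ‖∑ l, rotatedCoords D W v t l • columns W H l‖ ^ 2 := by
  have h1 : ∀ t i, (codeChannel D θ (Matrix.of H) *ᵥ v) (t, i)
      = θ * (∑ l, rotatedCoords D W v t l • columns W H l) i := by
    intro t i
    have h2 : (∑ l, rotatedCoords D W v t l • columns W H l) i
        = ((Matrix.of H * W) *ᵥ rotatedCoords D W v t) i := by
      simp only [columns, Matrix.mulVec, dotProduct, WithLp.ofLp_sum, Finset.sum_apply,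
        PiLp.smul_apply, smul_eq_mul]
      exact Finset.sum_congr rfl fun l _ => mul_comm _ _
    rw [h2, rotatedCoords_apply, Matrix.mulVec_mulVec, Matrix.mul_assoc,
      show W * Wᴴ = 1 from Matrix.mem_unitaryGroup_iff.mp hW, Matrix.mul_one, codeChannel,
      Matrix.smul_mulVec, Pi.smul_apply, smul_eq_mul, ← Matrix.mulVec_mulVec]
    congr 1
    simp only [Matrix.mulVec, dotProduct, Matrix.kroneckerMap_apply, Fintype.sum_prod_type,
      Matrix.one_apply]
    rw [Finset.sum_eq_single t]
    · simp
    · intro b _ hb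
      exact Finset.sum_eq_zero fun j _ => by simp [hb.symm]
    · simp
  simp only [sqNorm]
  rw [Fintype.sum_prod_type, Finset.mul_sum]
  refine Finset.sum_congr rfl fun t _ => ?_
  rw [EuclideanSpace.norm_sq_eq, Finset.mul_sum]
  refine Finset.sum_congr rfl fun i _ => ?_
  rw [h1, norm_mul, mul_pow, Complex.norm_real, Real.norm_eq_abs, sq_abs]

theorem sqNorm_codeChannel_mulVec_eq_qrCoeff {nt nr T : ℕ}
    (D : Fin (nt * T) → Matrix (Fin nt) (Fin T) ℂ)
    {W : Matrix (Fin nt) (Fin nt) ℂ} (hW : W ∈ Matrix.unitaryGroup (Fin nt) ℂ) (θ : ℝ)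
    {H : Fin nr → Fin nt → ℂ} (hH : ∀ l, gramSchmidt ℂ (columns W H) l ≠ 0)
    (v : Fin (nt * T) → ℂ) :
    sqNorm (codeChannel D θ (Matrix.of H) *ᵥ v) =
      θ ^ 2 * ∑ t, ∑ j, ‖∑ l, qrCoeff (columns W H) j l * rotatedCoords D W v t l‖ ^ 2 := by
  rw [sqNorm_codeChannel_mulVec D hW]
  simp_rw [norm_sq_sum_smul_eq hH]

theorem generator_mulVec_injective {nt T : ℕ} {D : Fin (nt * T) → Matrix (Fin nt) (Fin T) ℂ}
    (hD : LinearIndependent ℂ D) : Function.Injective (generator D).mulVecLin := by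
  rw [← LinearMap.ker_eq_bot, LinearMap.ker_eq_bot']
  intro v hv
  have h1 : ∑ i, v i • D i = 0 := by
    ext l t
    have := congrFun hv (t, l)
    simp only [Matrix.mulVecLin_apply, Matrix.mulVec, dotProduct, generator, Matrix.of_apply,
      Matrix.vec, Pi.zero_apply] at this
    rw [Matrix.sum_apply, Matrix.zero_apply, ← this]
    exact Finset.sum_congr rfl fun i _ => by simp [mul_comm]
  funext i
  exact Fintype.linearIndependent_iff.mp hD v h1 i

/-- An injective linear map between finite-dimensional coordinate spaces is bounded below. -/
theorem exists_norm_le_of_injective {ι κ : Type*} [Fintype ι] [Fintype κ]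
    (f : (ι → ℂ) →ₗ[ℂ] (κ → ℂ)) (hf : Function.Injective f) :
    ∃ C : ℝ, 0 < C ∧ ∀ v, ‖v‖ ≤ C * ‖f v‖ := by
  obtain ⟨K, hK, h⟩ := (LinearMap.injective_iff_antilipschitz f).mp hf
  exact ⟨K, hK, fun v => by simpa using h.le_mul_dist v 0⟩

theorem norm_mulVec_apply_le {m n : Type*} [Fintype n] (A : Matrix m n ℂ) {x : n → ℂ} {a B : ℝ}
    (ha : ∀ i j, ‖A i j‖ ≤ a) (hx : ∀ j, ‖x j‖ ≤ B) (i : m) :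
    ‖(A *ᵥ x) i‖ ≤ Fintype.card n * (a * B) := by
  refine (norm_sum_le _ _).trans ?_
  calc ∑ j, ‖A i j * x j‖ ≤ ∑ _j : n, a * B := by
        refine Finset.sum_le_sum fun j _ => ?_
        rw [norm_mul]
        exact mul_le_mul (ha i j) (hx j) (norm_nonneg _) ((norm_nonneg _).trans (ha i j))
    _ = _ := by simp

/-- Linear independence of the dispersion matrices bounds the symbols by the coordinates of the
codeword, uniformly in the basis. -/
theorem exists_norm_le_rotatedCoords {nt T : ℕ} {D : Fin (nt * T) → Matrix (Fin nt) (Fin T) ℂ}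
    (hD : LinearIndependent ℂ D) :
    ∃ C : ℝ, 0 < C ∧ ∀ W ∈ Matrix.unitaryGroup (Fin nt) ℂ, ∀ v B, 0 ≤ B →
      (∀ t l, ‖rotatedCoords D W v t l‖ ≤ B) → ∀ i, ‖v i‖ ≤ C * B := by
  obtain ⟨C, hC, h⟩ := exists_norm_le_of_injective _ (generator_mulVec_injective hD)
  refine ⟨C * (nt + 1), by positivity, fun W hW v B hB hv i => ?_⟩
  have h1 : ‖generator D *ᵥ v‖ ≤ (nt + 1) * B := by
    rw [pi_norm_le_iff_of_nonneg (by positivity)]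
    rintro ⟨t, l⟩
    have h2 : (generator D *ᵥ v) (t, l) = (W *ᵥ rotatedCoords D W v t) l := by
      rw [rotatedCoords_apply, Matrix.mulVec_mulVec,
        show W * Wᴴ = 1 from Matrix.mem_unitaryGroup_iff.mp hW, Matrix.one_mulVec]
    rw [h2]
    refine (norm_mulVec_apply_le W (fun i j => entry_norm_bound_of_unitary hW i j) (hv t) l).trans ?_
    rw [Fintype.card_fin, one_mul]
    nlinarith
  calc ‖v i‖ ≤ ‖v‖ := norm_le_pi_norm v i
    _ ≤ C * ‖generator D *ᵥ v‖ := h v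
    _ ≤ C * ((nt + 1) * B) := by gcongr
    _ = _ := by ring

theorem exists_norm_rotatedCoords_le {nt T : ℕ} (D : Fin (nt * T) → Matrix (Fin nt) (Fin T) ℂ) :
    ∃ C : ℝ, 0 < C ∧ ∀ W ∈ Matrix.unitaryGroup (Fin nt) ℂ, ∀ v B, 0 ≤ B →
      (∀ i, ‖v i‖ ≤ B) → ∀ t l, ‖rotatedCoords D W v t l‖ ≤ C * B := by
  let a : ℝ := ∑ i, ∑ j, ‖generator D i j‖
  have ha : ∀ i j, ‖generator D i j‖ ≤ a := by
    intro i j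
    refine (Finset.single_le_sum (f := fun j => ‖generator D i j‖) (fun _ _ => norm_nonneg _)
      (Finset.mem_univ j)).trans ?_
    exact Finset.single_le_sum (f := fun i => ∑ j, ‖generator D i j‖)
      (fun _ _ => Finset.sum_nonneg fun _ _ => norm_nonneg _) (Finset.mem_univ i)
  have ha0 : 0 ≤ a := Finset.sum_nonneg fun _ _ => Finset.sum_nonneg fun _ _ => norm_nonneg _
  refine ⟨nt * (nt * T * a) + 1, by positivity, fun W hW v B hB hv t l => ?_⟩
  rw [rotatedCoords_apply]
  refine (norm_mulVec_apply_le Wᴴ (a := 1) (fun i j => ?_)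
    (fun l => norm_mulVec_apply_le _ ha hv (t, l)) l).trans ?_
  · rw [Matrix.conjTranspose_apply, norm_star]
    exact entry_norm_bound_of_unitary hW j i
  · simp only [Fintype.card_fin]
    push_cast
    nlinarith

/-! ### Column pivoting -/

theorem gramSchmidt_congr {V : Type*} [NormedAddCommGroup V] [InnerProductSpace ℂ V] {n : ℕ}
    {f g : Fin n → V} (j : Fin n) (h : ∀ i ≤ j, f i = g i) :
    gramSchmidt ℂ f j = gramSchmidt ℂ g j := by
  induction j using WellFoundedLT.induction with
  | _ j ih =>
    rw [gramSchmidt_def, gramSchmidt_def, h j le_rfl]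
    congr 1
    refine Finset.sum_congr rfl fun i hi => ?_
    have hij := Finset.mem_Iio.mp hi
    rw [ih i hij fun a ha => h a (ha.trans hij.le)]

/-- Columns are in pivoted order if each diagonal entry of the triangular factor dominates its
row and all later diagonal entries. -/
def IsPivoted {V : Type*} [NormedAddCommGroup V] [InnerProductSpace ℂ V] {n : ℕ}
    (f : Fin n → V) : Prop :=
  ∀ j l, j ≤ l → ‖qrCoeff f j l‖ ≤ ‖gramSchmidt ℂ f j‖ ∧ ‖gramSchmidt ℂ f l‖ ≤ ‖gramSchmidt ℂ f j‖

/-- A pivoted order is one that maximizes the diagonal of the triangular factor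
lexicographically. -/
theorem exists_perm_isPivoted {V : Type*} [NormedAddCommGroup V] [InnerProductSpace ℂ V] {n : ℕ}
    (f : Fin n → V) : ∃ σ : Equiv.Perm (Fin n), IsPivoted (f ∘ σ) := by
  obtain ⟨σ, hσ⟩ := Finite.exists_max fun σ : Equiv.Perm (Fin n) =>
    toLex fun j => ‖gramSchmidt ℂ (f ∘ σ) j‖
  refine ⟨σ, ?_⟩
  set g := f ∘ σ with hg
  -- otherwise a transposition would increase the diagonal lexicographically
  have key : ∀ j l, j ≤ l → ‖gramSchmidt ℂ (g ∘ Equiv.swap j l) j‖ ≤ ‖gramSchmidt ℂ g j‖ := by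
    intro j l hjl
    by_contra hlt
    refine absurd (hσ (σ * Equiv.swap j l)) (not_le.mpr ?_)
    refine ⟨j, fun i hi => ?_, not_le.mp hlt⟩
    have : gramSchmidt ℂ (f ∘ σ) i = gramSchmidt ℂ (f ∘ (σ * Equiv.swap j l : Equiv.Perm _)) i := by
      refine gramSchmidt_congr i fun a ha => ?_
      have h1 : a < j := ha.trans_lt hi
      simp [Equiv.swap_apply_of_ne_of_ne h1.ne (h1.trans_le hjl).ne]
    exact congrArg norm this
  -- The residual of column `l` at step `j` has the entries `i ≥ j` of column `l` as coordinates.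
  have hcoeff : ∀ j l i, j ≤ l → j ≤ i → ‖qrCoeff g i l‖ ≤ ‖gramSchmidt ℂ g j‖ := by
    intro j l i hjl hji
    have h1 : qrCoeff g i l
        = inner ℂ (gramSchmidtNormed ℂ g i) (gramSchmidt ℂ (g ∘ Equiv.swap j l) j) := by
      rw [gramSchmidt_def, inner_sub_right, inner_sum, Finset.sum_eq_zero, sub_zero]
      · simp [qrCoeff]
      · intro a ha
        have haj := Finset.mem_Iio.mp ha
        have h2 : gramSchmidt ℂ (g ∘ Equiv.swap j l) a = gramSchmidt ℂ g a := by
          refine gramSchmidt_congr a fun b hb => ?_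
          have h1 : b < j := hb.trans_lt haj
          simp [Equiv.swap_apply_of_ne_of_ne h1.ne (h1.trans_le hjl).ne]
        rw [h2, Submodule.starProjection_singleton, inner_smul_right, gramSchmidtNormed,
          inner_smul_left, gramSchmidt_orthogonal ℂ g (haj.trans_le hji).ne', mul_zero, mul_zero]
    rw [h1]
    refine (norm_inner_le_norm _ _).trans ?_
    have h3 : ‖gramSchmidtNormed ℂ g i‖ ≤ 1 := by
      by_cases h : gramSchmidtNormed ℂ g i = 0
      · simp [h]
      · exact (gramSchmidtNormed_unit_length' h).le
    calc _ ≤ 1 * ‖gramSchmidt ℂ (g ∘ Equiv.swap j l) j‖ := by gcongr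
      _ ≤ _ := by rw [one_mul]; exact key j l hjl
  refine fun j l hjl => ⟨hcoeff j l j hjl le_rfl, ?_⟩
  have := hcoeff j l l hjl hjl
  rwa [qrCoeff_self, Complex.norm_real, norm_norm] at this

/-- The permutation matrix that puts column `σ j` in position `j`. -/
def columnPerm {n : ℕ} (σ : Equiv.Perm (Fin n)) : Matrix (Fin n) (Fin n) ℂ :=
  (1 : Matrix (Fin n) (Fin n) ℂ).submatrix id σ

theorem columnPerm_mem_unitaryGroup {n : ℕ} (σ : Equiv.Perm (Fin n)) :
    columnPerm σ ∈ Matrix.unitaryGroup (Fin n) ℂ := by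
  rw [Matrix.mem_unitaryGroup_iff', columnPerm, Matrix.star_eq_conjTranspose,
    Matrix.conjTranspose_submatrix, Matrix.conjTranspose_one,
    ← Matrix.submatrix_mul _ _ _ _ _ Function.bijective_id, Matrix.mul_one,
    Matrix.submatrix_one_equiv]

theorem columns_columnPerm {m n : ℕ} (σ : Equiv.Perm (Fin n)) (H : Fin m → Fin n → ℂ) :
    columns (columnPerm σ) H = columns 1 H ∘ σ := by
  funext j
  simp only [columns, columnPerm, Function.comp_apply, Matrix.mul_one]
  congr 1
  funext i
  simp [Matrix.mul_apply, Matrix.one_apply]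

/-- Back substitution in a unit upper triangular system whose entries are at most `1`. -/
theorem norm_le_of_unit_upperTriangular {n : ℕ} {P : Fin n → Fin n → ℂ} (h1 : ∀ j, P j j = 1)
    (h0 : ∀ j l, l < j → P j l = 0) (hle : ∀ j l, ‖P j l‖ ≤ 1) {y : Fin n → ℂ} {B : ℝ}
    (hB : 0 ≤ B) (hy : ∀ j, ‖∑ l, P j l * y l‖ ≤ B) (j : Fin n) : ‖y j‖ ≤ (n + 1) ^ n * B := by
  have key : ∀ a : ℕ, ∀ j : Fin n, n - a ≤ j → ‖y j‖ ≤ (n + 1) ^ a * B := by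
    intro a
    induction a with
    | zero => intro j hj; omega
    | succ a ih =>
      intro j hj
      have hsplit : ∑ l, P j l * y l = y j + ∑ l ∈ Finset.univ.erase j, P j l * y l := by
        rw [← Finset.add_sum_erase _ _ (Finset.mem_univ j), h1, one_mul]
      have h2 : ‖∑ l ∈ Finset.univ.erase j, P j l * y l‖ ≤ n * ((n + 1) ^ a * B) := by
        refine (norm_sum_le _ _).trans ?_
        calc ∑ l ∈ Finset.univ.erase j, ‖P j l * y l‖
            ≤ ∑ l ∈ Finset.univ.erase j, ((n + 1) ^ a * B : ℝ) := by
              refine Finset.sum_le_sum fun l hl => ?_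
              rcases lt_trichotomy l j with h | h | h
              · rw [h0 j l h, zero_mul, norm_zero]; positivity
              · exact absurd h (Finset.ne_of_mem_erase hl)
              · rw [norm_mul]
                have := ih l (by have := Fin.lt_def.mp h; omega)
                calc ‖P j l‖ * ‖y l‖ ≤ 1 * ((n + 1) ^ a * B) :=
                      mul_le_mul (hle j l) this (norm_nonneg _) zero_le_one
                  _ = _ := one_mul _
          _ ≤ ∑ _l : Fin n, ((n + 1) ^ a * B : ℝ) :=
              Finset.sum_le_sum_of_subset_of_nonneg (Finset.subset_univ _)
                fun _ _ _ => by positivity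
          _ = _ := by simp
      have h3 : y j = ∑ l, P j l * y l - ∑ l ∈ Finset.univ.erase j, P j l * y l := by
        rw [hsplit]; ring
      have h4 : (1 : ℝ) ≤ (n + 1) ^ a := one_le_pow₀ (by linarith [Nat.cast_nonneg (α := ℝ) n])
      calc ‖y j‖ ≤ B + n * ((n + 1) ^ a * B) := by
            rw [h3]
            exact (norm_sub_le _ _).trans (add_le_add (hy j) h2)
        _ ≤ (n + 1) ^ a * B + n * ((n + 1) ^ a * B) := by nlinarith
        _ = _ := by ring
  exact key n j (by omega)

/-! ### The upper bound on the number of visited nodes -/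

theorem lowerBlock_det_ne_zero {n k : ℕ} (h : k ≤ n) {R : Matrix (Fin n) (Fin n) ℂ}
    (hR : R.BlockTriangular id) (hdet : R.det ≠ 0) :
    (R.submatrix (lastIdx h) (lastIdx h)).det ≠ 0 := by
  have h1 : (R.submatrix (lastIdx h) (lastIdx h)).BlockTriangular id := by
    intro i j hij
    exact hR (show lastIdx h j < lastIdx h i by
      have := Fin.lt_def.mp hij
      rw [Fin.lt_def]
      simp only [lastIdx]
      simp only [id] at this
      omega)
  rw [Matrix.det_of_isUpperTriangular h1]
  rw [Matrix.det_of_isUpperTriangular hR] at hdet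
  rw [Finset.prod_ne_zero_iff] at hdet ⊢
  exact fun i _ => hdet _ (Finset.mem_univ _)

/-- Partial symbol vectors lift to full ones for which the upper rows of the triangular system
vanish. -/
theorem exists_lift_lastIdx {n k : ℕ} (h : k ≤ n) {R : Matrix (Fin n) (Fin n) ℂ}
    (hR : R.BlockTriangular id) (hdet : R.det ≠ 0) :
    ∃ lift : (Fin k → ℂ) →ₗ[ℂ] (Fin n → ℂ), (∀ s j, lift s (lastIdx h j) = s j) ∧
      ∀ s, sqNorm (R *ᵥ lift s) = sqNorm (R.submatrix (lastIdx h) (lastIdx h) *ᵥ s) := by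
  set Rk := R.submatrix (lastIdx h) (lastIdx h) with hRk
  have hRkdet : IsUnit Rk.det := (lowerBlock_det_ne_zero h hR hdet).isUnit
  have hRlift : ∀ s, R *ᵥ (R⁻¹ *ᵥ Function.extend (lastIdx h) (Rk *ᵥ s) 0)
      = Function.extend (lastIdx h) (Rk *ᵥ s) 0 := by
    intro s
    simp only [Matrix.mulVec_mulVec, Matrix.mul_nonsing_inv R hdet.isUnit, Matrix.one_mulVec]
  refine ⟨R⁻¹.mulVecLin.comp ((Function.ExtendByZero.linearMap ℂ (lastIdx h)).comp Rk.mulVecLin),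
    fun s => ?_, fun s => ?_⟩
  · have h1 : Rk *ᵥ (fun j => (R⁻¹ *ᵥ Function.extend (lastIdx h) (Rk *ᵥ s) 0) (lastIdx h j))
        = Rk *ᵥ s := by
      funext j
      rw [← mulVec_lastIdx h hR, hRlift, (lastIdx_injective h).extend_apply]
    have h2 := congrArg (Rk⁻¹ *ᵥ ·) h1
    simp only [Matrix.mulVec_mulVec, Matrix.nonsing_inv_mul Rk hRkdet, Matrix.one_mulVec] at h2
    exact congrFun h2
  · change sqNorm (R *ᵥ (R⁻¹ *ᵥ Function.extend (lastIdx h) (Rk *ᵥ s) 0)) = _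
    rw [hRlift]
    simp only [sqNorm]
    symm
    rw [Finset.sum_congr rfl fun j _ => by
        rw [← (lastIdx_injective h).extend_apply (Rk *ᵥ s) 0 j],
      ← Finset.sum_image (f := fun i => ‖Function.extend (lastIdx h) (Rk *ᵥ s) 0 i‖ ^ 2)
      (s := Finset.univ) (g := lastIdx h) (fun a _ b _ hab => lastIdx_injective h hab)]
    refine Finset.sum_subset (Finset.subset_univ _) fun i _ hi => ?_
    rw [Function.extend_apply']
    · simp
    · rintro ⟨a, rfl⟩
      exact hi (Finset.mem_image_of_mem _ (Finset.mem_univ _))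

/-- In pivoted order, two nodes in the same ball differ by at most `2 ξ / (θ d_j)` in the coordinates
`(t, j)`, where `d_j` is the `j`-th diagonal entry. This is used for the directions with
`ξ / (θ d_j) ≤ η`, and in the others the size of the constellation is used. -/
theorem exists_card_visitedNodes_le {nt T : ℕ} (nr : ℕ)
    {D : Fin (nt * T) → Matrix (Fin nt) (Fin T) ℂ} (hD : LinearIndependent ℂ D) :
    ∃ K : ℝ, 0 < K ∧ ∀ (θ η ξ : ℝ), 0 < θ → 0 ≤ η → 0 < ξ →
      ∀ (H : Fin nr → Fin nt → ℂ) (W : Matrix (Fin nt) (Fin nt) ℂ),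
      W ∈ Matrix.unitaryGroup (Fin nt) ℂ → (∀ l, gramSchmidt ℂ (columns W H) l ≠ 0) →
      IsPivoted (columns W H) →
      ∀ (Q : Matrix (Fin T × Fin nr) (Fin (nt * T)) ℂ)
        (R : Matrix (Fin (nt * T)) (Fin (nt * T)) ℂ),
      IsThinQR (codeChannel D θ (Matrix.of H)) Q R →
      ∀ (rv : Fin (nt * T) → ℂ) (k : ℕ) (hk : k ≤ nt * T),
        ((visitedNodes rv R η ξ k hk).card : ℝ) ≤
          K * ∏ j, (1 + min (ξ / (θ * ‖gramSchmidt ℂ (columns W H) j‖)) η) ^ (2 * T) := by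
  classical
  obtain ⟨C₀, hC₀, hcoords⟩ := exists_norm_le_rotatedCoords hD
  set C : ℝ := C₀ * (nt + 1) ^ nt with hC
  have hCpos : 0 < C := by positivity
  set c : ℝ := 1 / (4 * ((nt * T : ℕ) + 1 : ℝ) ^ 2 * (1 + C)) with hc
  have hcpos : 0 < c := by positivity
  set K₀ : ℝ := (4 * (nt * T : ℕ) + 4) / c + 3 with hK₀
  have hK₀pos : 0 < K₀ := by positivity
  refine ⟨∏ _j : Fin nt, K₀ ^ (2 * T), by positivity, ?_⟩
  intro θ η ξ hθ hη hξ H W hW hli hpiv Q R hQR rv k hk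
  set f := columns W H with hf
  set d : Fin nt → ℝ := fun j => ‖gramSchmidt ℂ f j‖ with hd
  have hd0 : ∀ j, 0 < d j := fun j => norm_pos_iff.mpr (hli j)
  let P : Fin nt → Fin nt → ℂ := fun j l => qrCoeff f j l / d j
  have hdC : ∀ j, (d j : ℂ) ≠ 0 := fun j => by exact_mod_cast (hd0 j).ne'
  have hP1 : ∀ j, P j j = 1 := fun j => by
    simp only [P, qrCoeff_self]
    exact div_self (hdC j)
  have hP0 : ∀ j l, l < j → P j l = 0 := fun j l h => by simp [P, qrCoeff_eq_zero f h]
  have hPle : ∀ j l, ‖P j l‖ ≤ 1 := by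
    intro j l
    rcases lt_or_ge l j with h | h
    · simp [hP0 j l h]
    · simp only [P, norm_div, Complex.norm_real, Real.norm_eq_abs, abs_of_pos (hd0 j)]
      exact div_le_one_of_le₀ (hpiv j l h).1 (hd0 j).le
  -- the coordinates in which the code-channel matrix becomes diagonal
  let Z : (Fin (nt * T) → ℂ) →ₗ[ℂ] (Fin T × Fin nt → ℂ) :=
    LinearMap.pi fun a => ∑ l, P a.2 l • (LinearMap.proj l).comp
      ((LinearMap.proj a.1).comp (rotatedCoords D W))
  have hZ : ∀ v a, Z v a = ∑ l, P a.2 l * rotatedCoords D W v a.1 l := by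
    intro v a
    simp [Z, LinearMap.sum_apply]
  have hZbound : ∀ v B, 0 ≤ B → (∀ a, ‖Z v a‖ ≤ B) → ∀ i, ‖v i‖ ≤ C * B := by
    intro v B hB hv i
    have h1 := hcoords W hW v ((nt + 1) ^ nt * B) (by positivity) (fun t l =>
      norm_le_of_unit_upperTriangular hP1 hP0 hPle hB
        (fun j => by simpa [hZ] using hv (t, j)) l) i
    calc _ ≤ _ := h1
      _ = _ := by rw [hC]; ring
  have hZinj : Function.Injective Z := by
    rw [← LinearMap.ker_eq_bot, LinearMap.ker_eq_bot']
    intro v hv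
    funext i
    have := hZbound v 0 le_rfl (fun a => by simp [hv]) i
    simpa using this
  let e := LinearEquiv.ofInjectiveOfFinrankEq Z hZinj (by simp [mul_comm])
  have he : ∀ v, e v = Z v := fun v => rfl
  have hnormZ : ∀ v, sqNorm (R *ᵥ v) = θ ^ 2 * ∑ t, ∑ j, d j ^ 2 * ‖Z v (t, j)‖ ^ 2 := by
    intro v
    rw [hQR.sqNorm_mulVec, sqNorm_codeChannel_mulVec_eq_qrCoeff D hW θ hli]
    congr 1
    refine Finset.sum_congr rfl fun t _ => Finset.sum_congr rfl fun j _ => ?_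
    have : ∑ l, qrCoeff f j l * rotatedCoords D W v t l = d j * Z v (t, j) := by
      rw [hZ, Finset.mul_sum]
      refine Finset.sum_congr rfl fun l _ => ?_
      have := hdC j
      simp only [P]
      field_simp
    rw [this, norm_mul, mul_pow, Complex.norm_real, Real.norm_eq_abs, sq_abs]
  -- the channel has full column rank, and so has the code-channel matrix
  have hRdet : R.det ≠ 0 := by
    rw [Ne, ← Matrix.exists_mulVec_eq_zero_iff]
    rintro ⟨v, hv0, hv⟩
    refine hv0 (hZinj ?_)
    have h1 := hnormZ v
    rw [hv] at h1
    rw [map_zero]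
    funext a
    have h2 : 0 = θ ^ 2 * ∑ t, ∑ j, d j ^ 2 * ‖Z v (t, j)‖ ^ 2 := by
      rw [← h1]; simp [sqNorm]
    have h3 : ∑ t, ∑ j, d j ^ 2 * ‖Z v (t, j)‖ ^ 2 = 0 := by
      rcases mul_eq_zero.mp h2.symm with h | h
      · exact absurd h (by positivity)
      · exact h
    rw [Finset.sum_eq_zero_iff_of_nonneg (fun _ _ => Finset.sum_nonneg fun _ _ => by positivity)]
      at h3
    have h4 := h3 a.1 (Finset.mem_univ _)
    rw [Finset.sum_eq_zero_iff_of_nonneg (fun _ _ => by positivity)] at h4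
    have h5 := h4 a.2 (Finset.mem_univ _)
    have h6 := (hd0 a.2).ne'
    simpa [h6] using h5
  obtain ⟨lift, hlift, hnormlift⟩ := exists_lift_lastIdx hk hQR.2.1 hRdet
  let F := visitedNodes rv R η ξ k hk
  let L : (Fin T × Fin nt → ℂ) →ₗ[ℂ] (Fin k → ℂ) :=
    (LinearMap.funLeft ℂ ℂ (lastIdx hk)).comp e.symm.toLinearMap
  have hL : ∀ w B, 0 ≤ B → (∀ a, ‖w a‖ ≤ B) → ∀ j, ‖L w j‖ ≤ C * B := by
    intro w B hB hw j
    refine hZbound (e.symm w) B hB (fun a => ?_) (lastIdx hk j)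
    rw [← he, e.apply_symm_apply]
    exact hw a
  have hLw : ∀ s, L (Z (lift s)) = s := by
    intro s
    funext j
    change e.symm (Z (lift s)) (lastIdx hk j) = s j
    rw [← he, e.symm_apply_apply, hlift]
  let b : Fin T × Fin nt → ℝ := fun a => 2 * (ξ / (θ * d a.2))
  have hb0 : ∀ a, 0 ≤ b a := fun a => by
    have := hd0 a.2
    positivity
  have hFmem : ∀ s ∈ F, s ∈ symbolVectors k η ∧
      sqNorm ((fun j => rv (lastIdx hk j)) - R.submatrix (lastIdx hk) (lastIdx hk) *ᵥ s)
        ≤ ξ ^ 2 := fun s hs => Finset.mem_filter.mp hs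
  have hb : ∀ s ∈ F, ∀ s' ∈ F, ∀ a, ‖Z (lift s) a - Z (lift s') a‖ ≤ b a := by
    intro s hs s' hs' a
    have h1 : sqNorm (R *ᵥ lift (s - s')) ≤ (2 * ξ) ^ 2 := by
      rw [hnormlift]
      have h2 := (hFmem s hs).2
      have h3 := (hFmem s' hs').2
      rw [sqNorm_eq_norm_toLp_sq] at h2 h3 ⊢
      have h4 := abs_le_of_sq_le_sq h2 hξ.le
      have h5 := abs_le_of_sq_le_sq h3 hξ.le
      rw [abs_norm] at h4 h5
      refine pow_le_pow_left₀ (norm_nonneg _) ?_ 2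
      have h6 : WithLp.toLp 2 (R.submatrix (lastIdx hk) (lastIdx hk) *ᵥ (s - s'))
          = WithLp.toLp 2 ((fun j => rv (lastIdx hk j)) -
              R.submatrix (lastIdx hk) (lastIdx hk) *ᵥ s')
            - WithLp.toLp 2 ((fun j => rv (lastIdx hk j)) -
              R.submatrix (lastIdx hk) (lastIdx hk) *ᵥ s) := by
        rw [← WithLp.toLp_sub, Matrix.mulVec_sub]
        congr 1
        abel
      rw [h6]
      refine (norm_sub_le _ _).trans ?_
      linarith
    rw [hnormZ] at h1
    have h2 : θ ^ 2 * (d a.2 ^ 2 * ‖Z (lift (s - s')) a‖ ^ 2) ≤ (2 * ξ) ^ 2 := by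
      refine le_trans ?_ h1
      refine mul_le_mul_of_nonneg_left ?_ (by positivity)
      refine le_trans ?_ (Finset.single_le_sum (f := fun t => ∑ j, d j ^ 2 *
        ‖Z (lift (s - s')) (t, j)‖ ^ 2) (fun _ _ => Finset.sum_nonneg fun _ _ => by positivity)
        (Finset.mem_univ a.1))
      exact Finset.single_le_sum (f := fun j => d j ^ 2 * ‖Z (lift (s - s')) (a.1, j)‖ ^ 2)
        (fun _ _ => by positivity) (Finset.mem_univ a.2)
    have h3 : (θ * d a.2 * ‖Z (lift (s - s')) a‖) ^ 2 ≤ (2 * ξ) ^ 2 := by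
      refine le_trans (le_of_eq ?_) h2
      ring
    have h4 := (abs_le_of_sq_le_sq' h3 (by positivity)).2
    have h5 : Z (lift s) a - Z (lift s') a = Z (lift (s - s')) a := by
      rw [map_sub, map_sub, Pi.sub_apply]
    have h6 : 0 < θ * d a.2 := mul_pos hθ (hd0 a.2)
    rw [h5]
    simp only [b]
    rw [← mul_div_assoc, le_div_iff₀ h6]
    linarith
  -- the directions in which the ball is shorter than the constellation
  let J : Finset (Fin T × Fin nt) := Finset.univ.filter fun a => ξ / (θ * d a.2) ≤ η
  have hkn : (k : ℝ) ≤ (nt * T : ℕ) := by exact_mod_cast hk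
  have hc1 : 4 * (k + 1 : ℝ) ^ 2 * (1 + C) * c ≤ 1 := by
    rw [hc, mul_one_div]
    refine div_le_one_of_le₀ ?_ (by positivity)
    gcongr
  have hcard := card_le_of_separated L hCpos.le hL hη F (fun s hs => (hFmem s hs).1)
    (fun s => Z (lift s)) (fun s _ => hLw s) b hb0 hb J hcpos hc1
  refine hcard.trans ?_
  have hfac : ∀ a : Fin T × Fin nt, 0 ≤ min (ξ / (θ * d a.2)) η := fun a =>
    le_min (div_nonneg hξ.le (mul_pos hθ (hd0 _)).le) hη
  have h4c : 0 < 4 / c := by positivity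
  have hJ : ∀ a ∈ J, (2 * b a / c + 3) ^ 2 ≤ (K₀ * (1 + min (ξ / (θ * d a.2)) η)) ^ 2 := by
    intro a ha
    have h1 := (Finset.mem_filter.mp ha).2
    rw [min_eq_left h1]
    refine pow_le_pow_left₀ (by have := hb0 a; positivity) ?_ 2
    have h2 : 0 ≤ ξ / (θ * d a.2) := div_nonneg hξ.le (mul_pos hθ (hd0 _)).le
    have h3 : 2 * b a / c = 4 / c * (ξ / (θ * d a.2)) := by simp only [b]; ring
    have h5 : 4 / c + 3 ≤ K₀ := by
      rw [hK₀]
      gcongr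
      linarith [Nat.cast_nonneg (α := ℝ) (nt * T)]
    rw [h3]
    nlinarith
  have hJc : ∀ a ∈ Jᶜ, (4 * k * η / c + 3) ^ 2 ≤ (K₀ * (1 + min (ξ / (θ * d a.2)) η)) ^ 2 := by
    intro a ha
    have h1 : ¬ ξ / (θ * d a.2) ≤ η := by simpa [J] using ha
    rw [min_eq_right (not_le.mp h1).le]
    refine pow_le_pow_left₀ (by positivity) ?_ 2
    have h3 : 4 * k * η / c = 4 * k / c * η := by ring
    have h5 : 4 * k / c + 3 ≤ K₀ := by
      rw [hK₀]
      gcongr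
      linarith
    have h6 : 0 ≤ 4 * (k : ℝ) / c := by positivity
    rw [h3]
    nlinarith
  calc (∏ a ∈ J, (2 * b a / c + 3) ^ 2) * ((4 * k * η / c + 3) ^ 2) ^ Jᶜ.card
      ≤ (∏ a ∈ J, (K₀ * (1 + min (ξ / (θ * d a.2)) η)) ^ 2) *
        ∏ a ∈ Jᶜ, (K₀ * (1 + min (ξ / (θ * d a.2)) η)) ^ 2 := by
        rw [← Finset.prod_const]
        refine mul_le_mul (Finset.prod_le_prod (fun a _ => by positivity) hJ)
          (Finset.prod_le_prod (fun a _ => by positivity) hJc)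
          (Finset.prod_nonneg fun a _ => by positivity) (Finset.prod_nonneg fun a _ => by positivity)
    _ = ∏ a : Fin T × Fin nt, (K₀ * (1 + min (ξ / (θ * d a.2)) η)) ^ 2 :=
        Finset.prod_mul_prod_compl J _
    _ = _ := by
        rw [Fintype.prod_prod_type, ← Finset.prod_mul_distrib]
        simp only
        rw [Finset.prod_const, ← Finset.prod_pow, Finset.card_univ, Fintype.card_fin]
        refine Finset.prod_congr rfl fun j _ => ?_
        rw [← pow_mul, mul_pow]

/-! ### Lifts that avoid the strong directions of the channel -/

theorem exists_unitary_extending {n p : ℕ} (hp : p ≤ n) (U : Matrix (Fin n) (Fin p) ℂ)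
    (hU : Uᴴ * U = 1) :
    ∃ W ∈ Matrix.unitaryGroup (Fin n) ℂ, ∀ i j, W i (Fin.castLE hp j) = U i j := by
  classical
  let u : Fin p → EuclideanSpace ℂ (Fin n) := fun j => WithLp.toLp 2 fun i => U i j
  have hu : Orthonormal ℂ u := by
    rw [orthonormal_iff_ite]
    intro a b
    have h := congrFun (congrFun hU a) b
    rw [Matrix.one_apply] at h
    rw [← h]
    simp [u, PiLp.inner_apply, Matrix.mul_apply, mul_comm]
  let v : Fin n → EuclideanSpace ℂ (Fin n) := fun i =>
    if h : (i : ℕ) < p then u ⟨i, h⟩ else 0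
  have hv : Orthonormal ℂ (({i : Fin n | (i : ℕ) < p} : Set (Fin n)).domRestrict v) := by
    have h1 := hu.comp (fun i : {i : Fin n | (i : ℕ) < p} => (⟨i.1, i.2⟩ : Fin p))
      (fun i j hij => by
        have := congrArg Fin.val hij
        exact Subtype.ext (Fin.ext this))
    have h2 : ({i : Fin n | (i : ℕ) < p} : Set (Fin n)).domRestrict v =
        u ∘ fun i : {i : Fin n | (i : ℕ) < p} => (⟨i.1, i.2⟩ : Fin p) := by
      funext i
      have : ((i : Fin n) : ℕ) < p := i.2
      simp [v, this]
    rw [h2]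
    exact h1
  obtain ⟨b, hb⟩ := hv.exists_orthonormalBasis_extension_of_card_eq (by simp)
  refine ⟨Matrix.of fun i j => b j i, ?_, fun i j => ?_⟩
  · rw [Matrix.mem_unitaryGroup_iff']
    ext i j
    have h := orthonormal_iff_ite.mp b.orthonormal i j
    rw [Matrix.one_apply, ← h]
    simp [PiLp.inner_apply, Matrix.mul_apply, Matrix.star_eq_conjTranspose, mul_comm]
  · rw [Matrix.of_apply, hb _ (by simp)]
    simp [v, u]

theorem mulVec_extend {m : Type*} {n k : ℕ} (G : Matrix m (Fin n) ℂ) {e : Fin k → Fin n}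
    (he : Function.Injective e) (u : Fin k → ℂ) :
    G *ᵥ Function.extend e u 0 = G.submatrix id e *ᵥ u := by
  funext i
  simp only [Matrix.mulVec, dotProduct, Matrix.submatrix_apply, id]
  symm
  rw [Finset.sum_congr rfl fun j _ => by rw [← he.extend_apply u 0 j],
    ← Finset.sum_image (f := fun l => G i l * Function.extend e u 0 l)
      (s := Finset.univ) (g := e) (fun a _ b _ hab => he hab)]
  refine Finset.sum_subset (Finset.subset_univ _) fun l _ hl => ?_
  rw [Function.extend_apply', Pi.zero_apply, mul_zero]
  rintro ⟨a, rfl⟩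
  exact hl (Finset.mem_image_of_mem _ (Finset.mem_univ _))

/-- The codeword coordinates along the first `p` columns of `W`, as functions of the first `p T`
symbols. -/
noncomputable def strongCoords {nt T : ℕ} (D : Fin (nt * T) → Matrix (Fin nt) (Fin T) ℂ)
    (W : Matrix (Fin nt) (Fin nt) ℂ) {p : ℕ} (hp : p ≤ nt) :
    (Fin (p * T) → ℂ) →ₗ[ℂ] (Fin T × Fin p → ℂ) :=
  LinearMap.pi fun a => (LinearMap.proj (Fin.castLE hp a.2)).comp ((LinearMap.proj a.1).comp
    ((rotatedCoords D W).comp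
      (Function.ExtendByZero.linearMap ℂ (Fin.castLE (Nat.mul_le_mul_right T hp)))))

theorem strongCoords_apply {nt T : ℕ} (D : Fin (nt * T) → Matrix (Fin nt) (Fin T) ℂ)
    (W : Matrix (Fin nt) (Fin nt) ℂ) {p : ℕ} (hp : p ≤ nt) (u : Fin (p * T) → ℂ)
    (a : Fin T × Fin p) :
    strongCoords D W hp u a = rotatedCoords D W
      (Function.extend (Fin.castLE (Nat.mul_le_mul_right T hp)) u 0) a.1 (Fin.castLE hp a.2) := rfl

/-- The rank condition, with the isometry `U_p` completed to a unitary matrix. -/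
theorem exists_strongCoords_injective {nt T : ℕ} {D : Fin (nt * T) → Matrix (Fin nt) (Fin T) ℂ}
    (hrank : RankCondition (generator D)) {p : ℕ} (hp : p ≤ nt) :
    ∃ W ∈ Matrix.unitaryGroup (Fin nt) ℂ, Function.Injective (strongCoords D W hp) := by
  rcases Nat.eq_zero_or_pos p with rfl | hp1
  · refine ⟨1, one_mem _, ?_⟩
    have : IsEmpty (Fin (0 * T)) := by rw [zero_mul]; infer_instance
    exact Function.injective_of_subsingleton _
  obtain ⟨U, hU, hr⟩ := hrank p hp1 hp
  obtain ⟨W, hW, hWU⟩ := exists_unitary_extending hp U hU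
  refine ⟨W, hW, ?_⟩
  set A := ((1 : Matrix (Fin T) (Fin T) ℂ) ⊗ₖ Uᴴ) * firstColumns (generator D) p hp with hA
  have h1 : ∀ u a, strongCoords D W hp u a = (A *ᵥ u) a := by
    rintro u ⟨t, j⟩
    rw [strongCoords_apply, rotatedCoords_apply, hA, ← Matrix.mulVec_mulVec, firstColumns,
      mulVec_extend _ (Fin.castLE_injective _)]
    simp only [Matrix.mulVec, dotProduct, Matrix.kroneckerMap_apply, Fintype.sum_prod_type,
      Matrix.one_apply, Matrix.conjTranspose_apply, hWU]
    rw [Finset.sum_eq_single t]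
    · simp
    · intro b _ hb
      exact Finset.sum_eq_zero fun j _ => by simp [hb.symm]
    · simp
  have h2 : strongCoords D W hp = A.mulVecLin :=
    LinearMap.ext fun u => funext fun a => h1 u a
  have h3 : Function.Injective A.mulVecLin := by
    rw [← LinearMap.ker_eq_bot]
    have h4 := LinearMap.finrank_range_add_finrank_ker A.mulVecLin
    rw [← Matrix.rank, hr] at h4
    have h5 : Module.finrank ℂ (LinearMap.ker A.mulVecLin) = 0 := by
      simp at h4
      simpa using h4
    exact Submodule.finrank_eq_zero.mp h5
  rw [h2]
  exact h3

/-- If the triangular factor is, in its first `p` rows, close to the identity up to scaling, then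
every choice `x` of the last symbols has a completion of comparable size for which the codeword
vanishes in the first `p` triangular coordinates. -/
theorem exists_lift_avoiding {nt T : ℕ} (D : Fin (nt * T) → Matrix (Fin nt) (Fin T) ℂ)
    {W : Matrix (Fin nt) (Fin nt) ℂ} (hW : W ∈ Matrix.unitaryGroup (Fin nt) ℂ) {p : ℕ}
    (hp : p ≤ nt) (hinj : Function.Injective (strongCoords D W hp))
    (hk : (nt - p) * T ≤ nt * T) :
    ∃ δ C : ℝ, 0 < δ ∧ δ ≤ 1 ∧ 0 < C ∧ ∀ P : Fin nt → Fin nt → ℂ,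
      (∀ j : Fin nt, (j : ℕ) < p → P j j = 1) →
      (∀ j l : Fin nt, (j : ℕ) < p → j ≠ l → ‖P j l‖ ≤ δ) →
      ∃ lift : (Fin ((nt - p) * T) → ℂ) →ₗ[ℂ] (Fin (nt * T) → ℂ),
        (∀ x i, lift x (lastIdx hk i) = x i) ∧
        (∀ x t, ∀ j : Fin nt, (j : ℕ) < p → ∑ l, P j l * rotatedCoords D W (lift x) t l = 0) ∧
        ∀ x B, 0 ≤ B → (∀ i, ‖x i‖ ≤ B) → ∀ i, ‖lift x i‖ ≤ C * B := by
  obtain ⟨C₁, hC₁, hbelow⟩ := exists_norm_le_of_injective _ hinj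
  obtain ⟨C₂, hC₂, habove⟩ := exists_norm_rotatedCoords_le D
  set δ : ℝ := min 1 (1 / (2 * C₁ * (nt + 1) * C₂)) with hδ
  have hδ0 : 0 < δ := by rw [hδ, lt_min_iff]; exact ⟨one_pos, by positivity⟩
  have hδ1 : δ ≤ 1 := min_le_left _ _
  have hδ2 : δ * (2 * C₁ * (nt + 1) * C₂) ≤ 1 := by
    have := min_le_right 1 (1 / (2 * C₁ * (nt + 1) * C₂))
    rwa [← hδ, le_div_iff₀ (by positivity)] at this
  refine ⟨δ, 2 * C₁ * (nt * C₂) + 1, hδ0, hδ1, by positivity, fun P hP1 hPδ => ?_⟩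
  have hPle : ∀ j l : Fin nt, (j : ℕ) < p → ‖P j l‖ ≤ 1 := by
    intro j l hj
    by_cases h : j = l
    · subst h; simp [hP1 j hj]
    · exact (hPδ j l hj h).trans hδ1
  -- the perturbed triangular coordinates along the strong directions
  let z : (Fin (nt * T) → ℂ) →ₗ[ℂ] (Fin T × Fin p → ℂ) :=
    LinearMap.pi fun a => ∑ l, P (Fin.castLE hp a.2) l • (LinearMap.proj l).comp
      ((LinearMap.proj a.1).comp (rotatedCoords D W))
  have hz : ∀ v a, z v a = ∑ l, P (Fin.castLE hp a.2) l * rotatedCoords D W v a.1 l := by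
    intro v a
    simp [z, LinearMap.sum_apply]
  have hzle : ∀ v, ‖z v‖ ≤ nt * C₂ * ‖v‖ := by
    intro v
    rw [pi_norm_le_iff_of_nonneg (by positivity)]
    intro a
    rw [hz]
    refine (norm_sum_le _ _).trans ?_
    calc ∑ l, ‖P (Fin.castLE hp a.2) l * rotatedCoords D W v a.1 l‖
        ≤ ∑ _l : Fin nt, C₂ * ‖v‖ := by
          refine Finset.sum_le_sum fun l _ => ?_
          rw [norm_mul]
          calc _ ≤ 1 * (C₂ * ‖v‖) := mul_le_mul (hPle _ _ (by simp))
                (habove W hW v ‖v‖ (norm_nonneg _) (norm_le_pi_norm v) a.1 l) (norm_nonneg _)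
                zero_le_one
            _ = _ := one_mul _
      _ = _ := by simp [mul_assoc]
  let first : (Fin (p * T) → ℂ) →ₗ[ℂ] (Fin (nt * T) → ℂ) :=
    Function.ExtendByZero.linearMap ℂ (Fin.castLE (Nat.mul_le_mul_right T hp))
  let last : (Fin ((nt - p) * T) → ℂ) →ₗ[ℂ] (Fin (nt * T) → ℂ) :=
    Function.ExtendByZero.linearMap ℂ (lastIdx hk)
  have hext : ∀ {k : ℕ} (e : Fin k → Fin (nt * T)), Function.Injective e → ∀ u : Fin k → ℂ,
      ‖Function.extend e u 0‖ ≤ ‖u‖ := by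
    intro k e he u
    rw [pi_norm_le_iff_of_nonneg (norm_nonneg _)]
    intro i
    by_cases h : ∃ a, e a = i
    · obtain ⟨a, rfl⟩ := h
      rw [he.extend_apply]
      exact norm_le_pi_norm u a
    · rw [Function.extend_apply' _ _ _ h]
      simp
  have hfirst : ∀ u, ‖first u‖ ≤ ‖u‖ := hext _ (Fin.castLE_injective _)
  have hlast : ∀ x, ‖last x‖ ≤ ‖x‖ := hext _ (lastIdx_injective hk)
  -- a small perturbation of an injective map is injective
  have hpert : ∀ u, ‖strongCoords D W hp u - z (first u)‖ ≤ nt * (δ * C₂) * ‖u‖ := by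
    intro u
    rw [pi_norm_le_iff_of_nonneg (by positivity)]
    intro a
    have hsub : strongCoords D W hp u a - z (first u) a
        = -∑ l ∈ Finset.univ.erase (Fin.castLE hp a.2),
          P (Fin.castLE hp a.2) l * rotatedCoords D W (first u) a.1 l := by
      rw [hz, ← Finset.add_sum_erase _ _ (Finset.mem_univ (Fin.castLE hp a.2)),
        hP1 _ (by simp), one_mul, strongCoords_apply, sub_add_eq_sub_sub]
      change rotatedCoords D W (first u) a.1 (Fin.castLE hp a.2)
        - rotatedCoords D W (first u) a.1 (Fin.castLE hp a.2) - _ = _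
      rw [sub_self, zero_sub]
    rw [Pi.sub_apply, hsub, norm_neg]
    refine (norm_sum_le _ _).trans ?_
    calc _ ≤ ∑ l ∈ Finset.univ.erase (Fin.castLE hp a.2), (δ * (C₂ * ‖u‖) : ℝ) := by
          refine Finset.sum_le_sum fun l hl => ?_
          rw [norm_mul]
          refine mul_le_mul (hPδ _ _ (by simp) (Finset.ne_of_mem_erase hl).symm) ?_
            (norm_nonneg _) hδ0.le
          exact habove W hW (first u) ‖u‖ (norm_nonneg _)
            (fun i => (norm_le_pi_norm _ i).trans (hfirst u)) a.1 l
      _ ≤ ∑ _l : Fin nt, (δ * (C₂ * ‖u‖) : ℝ) :=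
          Finset.sum_le_sum_of_subset_of_nonneg (Finset.subset_univ _) fun _ _ _ => by positivity
      _ = _ := by simp [mul_assoc]
  have hzbelow : ∀ u, ‖u‖ ≤ 2 * C₁ * ‖z (first u)‖ := by
    intro u
    have h1 := hbelow u
    have h2 : ‖strongCoords D W hp u‖ ≤ ‖z (first u)‖ + nt * (δ * C₂) * ‖u‖ := by
      calc _ = ‖z (first u) + (strongCoords D W hp u - z (first u))‖ := by
            rw [add_sub_cancel]
        _ ≤ _ := (norm_add_le _ _).trans (by linarith [hpert u])
    have h3 : C₁ * (nt * (δ * C₂) * ‖u‖) ≤ ‖u‖ / 2 := by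
      have : C₁ * (nt * (δ * C₂)) ≤ 1 / 2 := by nlinarith [mul_pos (mul_pos hδ0 hC₁) hC₂]
      nlinarith [norm_nonneg u]
    nlinarith
  have hzinj : Function.Injective (z.comp first) := by
    rw [← LinearMap.ker_eq_bot, LinearMap.ker_eq_bot']
    intro u hu
    have := hzbelow u
    rw [show z (first u) = 0 from hu, norm_zero, mul_zero] at this
    exact norm_le_zero_iff.mp this
  let e := LinearEquiv.ofInjectiveOfFinrankEq (z.comp first) hzinj (by simp [mul_comm])
  have he : ∀ u, e u = z (first u) := fun u => rfl
  -- the first `p T` symbols cancel the strong coordinates of the last ones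
  let lift : (Fin ((nt - p) * T) → ℂ) →ₗ[ℂ] (Fin (nt * T) → ℂ) :=
    last - first.comp (e.symm.toLinearMap.comp (z.comp last))
  have hlift : ∀ x, lift x = last x - first (e.symm (z (last x))) := fun x => rfl
  refine ⟨lift, fun x i => ?_, fun x t j hj => ?_, fun x B hB hx i => ?_⟩
  · rw [hlift, Pi.sub_apply]
    have h1 : last x (lastIdx hk i) = x i := (lastIdx_injective hk).extend_apply x 0 i
    have h2 : first (e.symm (z (last x))) (lastIdx hk i) = 0 := by
      refine Function.extend_apply' _ _ _ ?_
      rintro ⟨a, ha⟩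
      have h3 := congrArg Fin.val ha
      simp only [lastIdx, Fin.val_castLE] at h3
      have h4 := a.isLt
      have h5 : nt * T - (nt - p) * T = p * T := by
        rw [← Nat.sub_mul]
        congr 1
        omega
      omega
    rw [h1, h2, sub_zero]
  · have h1 : z (lift x) = 0 := by
      rw [hlift, map_sub, ← he, e.apply_symm_apply, sub_self]
    have h2 := congrFun h1 (t, ⟨j, hj⟩)
    rw [hz] at h2
    exact h2
  · have hxn : ‖x‖ ≤ B := (pi_norm_le_iff_of_nonneg hB).mpr hx
    have h1 := hzbelow (e.symm (z (last x)))
    rw [← he, e.apply_symm_apply] at h1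
    have h2 := hzle (last x)
    have h3 := hlast x
    have h4 := hfirst (e.symm (z (last x)))
    calc ‖lift x i‖ ≤ ‖lift x‖ := norm_le_pi_norm _ i
      _ ≤ ‖last x‖ + ‖first (e.symm (z (last x)))‖ := by rw [hlift]; exact norm_sub_le _ _
      _ ≤ B + 2 * C₁ * (nt * C₂ * B) := by
          refine add_le_add (h3.trans hxn) (h4.trans (h1.trans ?_))
          refine mul_le_mul_of_nonneg_left (h2.trans ?_) (by positivity)
          exact mul_le_mul_of_nonneg_left (h3.trans hxn) (by positivity)
      _ = _ := by ring

/-! ### The lower bound on the number of visited nodes -/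

theorem vec_codeword {nt T : ℕ} (D : Fin (nt * T) → Matrix (Fin nt) (Fin T) ℂ) (θ : ℝ)
    (s : Fin (nt * T) → ℂ) : (codeword D θ s).vec = (θ : ℂ) • (generator D).mulVecLin s := by
  funext a
  simp only [codeword, Matrix.vec_smul, Matrix.vec_sum, Pi.smul_apply, Finset.sum_apply,
    Matrix.mulVec, dotProduct, generator, Matrix.of_apply, smul_eq_mul, Matrix.mulVecLin_apply]
  congr 1
  exact Finset.sum_congr rfl fun i _ => mul_comm _ _

theorem vec_mul_codeword {nt nr T : ℕ} (D : Fin (nt * T) → Matrix (Fin nt) (Fin T) ℂ) (θ : ℝ)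
    (H : Matrix (Fin nr) (Fin nt) ℂ) (s : Fin (nt * T) → ℂ) :
    (H * codeword D θ s).vec = codeChannel D θ H *ᵥ s := by
  rw [Matrix.vec_mul_eq_mulVec, vec_codeword, Matrix.mulVec_smul, codeChannel,
    Matrix.smul_mulVec, Matrix.mulVecLin_apply, Matrix.mulVec_mulVec]

theorem sqNorm_conjTranspose_mulVec_le {m : Type*} [Fintype m] {n : ℕ}
    {Q : Matrix m (Fin n) ℂ} (hQ : Qᴴ * Q = 1) (w : m → ℂ) : sqNorm (Qᴴ *ᵥ w) ≤ sqNorm w := by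
  obtain ⟨u, hu⟩ : ∃ u, Qᴴ *ᵥ w = u := ⟨_, rfl⟩
  rw [hu]
  have h1 : ((sqNorm u : ℝ) : ℂ) = star (Q *ᵥ u) ⬝ᵥ w := by
    rw [ofReal_sqNorm, Matrix.star_mulVec, ← Matrix.dotProduct_mulVec, hu]
  have h2 : ((sqNorm (w - Q *ᵥ u) : ℝ) : ℂ) = ((sqNorm w - sqNorm u : ℝ) : ℂ) := by
    have h3 : star w ⬝ᵥ (Q *ᵥ u) = ((sqNorm u : ℝ) : ℂ) := by
      rw [Matrix.dotProduct_mulVec, ← Matrix.conjTranspose_conjTranspose Q, ← Matrix.star_mulVec,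
        hu, ofReal_sqNorm]
    rw [ofReal_sqNorm, star_sub, sub_dotProduct, dotProduct_sub, dotProduct_sub, ← h1, h3,
      ← ofReal_sqNorm, ← ofReal_sqNorm, sqNorm_mulVec_of_conjTranspose_mul_self hQ]
    push_cast; ring
  have h4 := Complex.ofReal_injective h2
  linarith [sqNorm_nonneg (w - Q *ᵥ u)]

theorem zero_mem_constellation {η : ℝ} (hη : 0 ≤ η) : (0 : ℂ) ∈ constellation η :=
  (mem_constellation η 0).mpr ⟨0, 0, by simpa, by simpa, by simp [Complex.ext_iff]⟩

theorem card_symbolVectors (k : ℕ) (η : ℝ) :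
    (symbolVectors k η).card = (constellation η).card ^ k := by
  simp [symbolVectors]

theorem card_symbolVectors_filter_lastIdx_le {n k : ℕ} (h : k ≤ n) (η : ℝ) (x : Fin k → ℂ) :
    ((symbolVectors n η).filter fun s => (fun j => s (lastIdx h j)) = x).card
      ≤ (constellation η).card ^ (n - k) := by
  rw [← card_symbolVectors]
  refine Finset.card_le_card_of_injOn (fun s i => s (Fin.castLE (Nat.sub_le n k) i)) ?_ ?_
  · intro s hs
    have hs1 := Fintype.mem_piFinset.mp (Finset.mem_filter.mp hs).1
    exact Finset.mem_coe.mpr (Fintype.mem_piFinset.mpr fun i => hs1 _)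
  · intro s hs s' hs' hss
    have h1 := (Finset.mem_filter.mp hs).2
    have h2 := (Finset.mem_filter.mp hs').2
    funext i
    by_cases hi : n - k ≤ (i : ℕ)
    · obtain ⟨j, rfl⟩ := exists_lastIdx_eq h hi
      exact congrFun (h1.trans h2.symm) j
    · exact congrFun hss ⟨i, by omega⟩

/-- If `S` is divided into at most `K` cells, then at least half of the points of `S` lie in cells
with at least `|S| / (2 K)` points. -/
theorem card_le_two_mul_card_filter_fiber {α β : Type*} [DecidableEq β] (S : Finset α)
    (φ : α → β) (K : Finset β) (hφ : ∀ s ∈ S, φ s ∈ K) :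
    S.card ≤ 2 * (S.filter fun s => S.card ≤ 2 * K.card *
      (S.filter fun s' => φ s' = φ s).card).card := by
  classical
  set bad := S.filter fun s => ¬ S.card ≤ 2 * K.card * (S.filter fun s' => φ s' = φ s).card
    with hbad
  have h1 : 2 * bad.card ≤ S.card := by
    have h2 : bad.card = ∑ b ∈ K, (bad.filter fun s => φ s = b).card :=
      Finset.card_eq_sum_card_fiberwise fun s hs => hφ s (Finset.mem_filter.mp hs).1
    have h3 : ∀ b ∈ K, 2 * K.card * (bad.filter fun s => φ s = b).card ≤ S.card := by
      intro b hb
      rcases (bad.filter fun s => φ s = b).eq_empty_or_nonempty with h | ⟨s, hs⟩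
      · simp [h]
      · obtain ⟨hs1, hs2⟩ := Finset.mem_filter.mp hs
        have hs3 := (Finset.mem_filter.mp hs1).2
        have h4 : (bad.filter fun s => φ s = b) ⊆ S.filter fun s' => φ s' = φ s := by
          intro a ha
          obtain ⟨ha1, ha2⟩ := Finset.mem_filter.mp ha
          exact Finset.mem_filter.mpr ⟨(Finset.mem_filter.mp ha1).1, ha2.trans hs2.symm⟩
        have h5 := Finset.card_le_card h4
        have h6 := Nat.mul_le_mul_left (2 * K.card) h5
        omega
    rcases K.eq_empty_or_nonempty with h | h
    · rw [h2, h]; simp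
    · have h4 : K.card * (2 * bad.card) ≤ K.card * S.card := by
        calc K.card * (2 * bad.card) = ∑ b ∈ K, 2 * K.card * (bad.filter fun s => φ s = b).card := by
              rw [← Finset.mul_sum, ← h2]; ring
          _ ≤ ∑ _b ∈ K, S.card := Finset.sum_le_sum h3
          _ = K.card * S.card := by simp
      exact Nat.le_of_mul_le_mul_left h4 h.card_pos
  have h2 := Finset.card_filter_add_card_filter_not (s := S)
    (fun s => S.card ≤ 2 * K.card * (S.filter fun s' => φ s' = φ s).card)
  rw [← hbad] at h2
  omega

/-- Here the columns `j < p` of `H W` are strong and the others are weak, of order `ρ ^ (-β_j / 2)`. In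
layer `k = (n_t - p) T`, the weak coordinates take values in boxes that are covered by a product over
the weak columns of `(1 + θ ρ ^ (-β_j / 2) η / ξ) ^ (2 T)` cells, up to a constant, and a
transmitted symbol vector visits all nodes in its own cell if the noise is at most `ξ / 2`. -/
theorem exists_le_card_visitedNodes {nt T : ℕ} (nr : ℕ) (hnt : 1 ≤ nt) (hT : 1 ≤ T)
    (D : Fin (nt * T) → Matrix (Fin nt) (Fin T) ℂ)
    {W : Matrix (Fin nt) (Fin nt) ℂ} (hW : W ∈ Matrix.unitaryGroup (Fin nt) ℂ) {p : ℕ}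
    (hp : p ≤ nt) (hinj : Function.Injective (strongCoords D W hp))
    (hk : (nt - p) * T ≤ nt * T) :
    ∃ δ K : ℝ, 0 < δ ∧ δ ≤ 1 ∧ 0 < K ∧ ∀ (θ η ξ : ℝ), 0 < θ → 0 ≤ η → 0 < ξ →
      ∀ (H : Fin nr → Fin nt → ℂ) (ρ : ℝ) (β : ℕ → ℝ), 0 ≤ ρ →
      columns W H ∈ qrEvent (offDiagBound p δ ρ β) (diagBound p ρ β) nt →
      ∀ (Q : Matrix (Fin T × Fin nr) (Fin (nt * T)) ℂ)
        (R : Matrix (Fin (nt * T)) (Fin (nt * T)) ℂ),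
      IsThinQR (codeChannel D θ (Matrix.of H)) Q R →
      ∃ good ⊆ symbolVectors (nt * T) η, (symbolVectors (nt * T) η).card ≤ 2 * good.card ∧
        ∀ s ∈ good, ∀ w : Fin nr → Fin T → ℂ, sqNorm (Matrix.of w).vec ≤ (ξ / 2) ^ 2 →
          ((constellation η).card : ℝ) ^ ((nt - p) * T) ≤
            (K * ∏ j ∈ Finset.univ.filter fun j : Fin nt => p ≤ (j : ℕ),
              (1 + θ * ρ ^ (-(β j / 2)) * η / ξ) ^ (2 * T)) *
            ((visitedNodes (Qᴴ *ᵥ (Matrix.of H * codeword D θ s + Matrix.of w).vec) R η ξ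
              ((nt - p) * T) hk).card : ℝ) := by
  classical
  obtain ⟨δ, C, hδ0, hδ1, hC, hlift⟩ := exists_lift_avoiding D hW hp hinj hk
  obtain ⟨C₂, hC₂, habove⟩ := exists_norm_rotatedCoords_le D
  have hn1 : (1 : ℝ) ≤ (nt * T : ℕ) := by exact_mod_cast Nat.mul_pos hnt hT
  set C₃ : ℝ := nt * (C₂ * (C * 2)) with hC₃
  have hC₃0 : 0 ≤ C₃ := by positivity
  set K₀ : ℝ := 2 * C₃ * (4 * (nt * T : ℕ)) + 3 with hK₀
  have hK₀pos : 0 < K₀ := by positivity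
  set weak := Finset.univ.filter fun j : Fin nt => p ≤ (j : ℕ) with hweak
  refine ⟨δ, 2 * ∏ _j ∈ weak, K₀ ^ (2 * T), hδ0, hδ1, by positivity, ?_⟩
  intro θ η ξ hθ hη hξ H ρ β hρ hH Q R hQR
  set f := columns W H with hf
  set ε : Fin nt → ℝ := fun j => ρ ^ (-(β j / 2)) with hε
  have hε0 : ∀ j, 0 ≤ ε j := fun j => Real.rpow_nonneg hρ _
  have hli : ∀ l, gramSchmidt ℂ f l ≠ 0 := fun l => (hH l).1
  let d : Fin nt → ℝ := fun j => ‖gramSchmidt ℂ f j‖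
  have hdC : ∀ j, (d j : ℂ) ≠ 0 := fun j => by exact_mod_cast norm_ne_zero_iff.mpr (hli j)
  let P : Fin nt → Fin nt → ℂ := fun j l => qrCoeff f j l / d j
  obtain ⟨lift, hlift1, hlift2, hlift3⟩ := hlift P (fun j _ => by
      simp only [P, qrCoeff_self]
      exact div_self (hdC j)) (fun j l hj hjl => by
      rcases lt_or_gt_of_ne hjl with h | h
      · have h1 := (hH l).2.1 j h
        have h2 := (hH j).2.2
        simp only [offDiagBound, diagBound, hj, if_true, Set.mem_Iic, Set.mem_Ici] at h1 h2
        simp only [P, norm_div, Complex.norm_real, Real.norm_eq_abs]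
        rw [abs_of_nonneg (norm_nonneg _)]
        exact (div_le_self (norm_nonneg _) h2).trans h1
      · simp only [P, qrCoeff_eq_zero f h, zero_div, norm_zero]
        exact hδ0.le)
  set Rk := R.submatrix (lastIdx hk) (lastIdx hk) with hRk
  -- the weak triangular coordinates of the lift of a partial symbol vector
  let g : Fin T → Fin nt → (Fin ((nt - p) * T) → ℂ) →ₗ[ℂ] ℂ := fun t j =>
    ∑ l, qrCoeff f j l • (LinearMap.proj l).comp
      ((LinearMap.proj t).comp ((rotatedCoords D W).comp lift))
  have hg : ∀ t j x, g t j x = ∑ l, qrCoeff f j l * rotatedCoords D W (lift x) t l := by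
    intro t j x
    simp [g, LinearMap.sum_apply]
  have hgstrong : ∀ t (j : Fin nt), (j : ℕ) < p → ∀ x, g t j x = 0 := by
    intro t j hj x
    have h1 : g t j x = d j * ∑ l, P j l * rotatedCoords D W (lift x) t l := by
      rw [hg, Finset.mul_sum]
      refine Finset.sum_congr rfl fun l _ => ?_
      have := hdC j
      simp only [P]
      field_simp
    rw [h1, hlift2 x t j hj, mul_zero]
  have hRknorm : ∀ x, sqNorm (Rk *ᵥ x) ≤ θ ^ 2 * ∑ t, ∑ j, ‖g t j x‖ ^ 2 := by
    intro x
    have h1 : Rk *ᵥ x = fun j => (R *ᵥ lift x) (lastIdx hk j) := by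
      funext j
      rw [mulVec_lastIdx hk hQR.2.1]
      simp_rw [hlift1]
      rfl
    rw [h1]
    refine (sqNorm_comp_lastIdx_le hk _).trans ?_
    rw [hQR.sqNorm_mulVec, sqNorm_codeChannel_mulVec_eq_qrCoeff D hW θ hli]
    simp_rw [hg]
    exact le_rfl
  have hrow : ∀ j l : Fin nt, p ≤ (j : ℕ) → ‖qrCoeff f j l‖ ≤ ε j := by
    intro j l hj
    rcases lt_trichotomy j l with h | rfl | h
    · have h1 := (hH l).2.1 j h
      simpa only [offDiagBound, not_lt.mpr hj, if_false, Set.mem_Iic] using h1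
    · have h1 := (hH j).2.2
      simp only [diagBound, not_lt.mpr hj, if_false, Set.mem_Iic] at h1
      rw [qrCoeff_self, Complex.norm_real, norm_norm]
      exact h1
    · rw [qrCoeff_eq_zero f h, norm_zero]
      exact hε0 j
  have hgweak : ∀ t (j : Fin nt), p ≤ (j : ℕ) → ∀ x, (∀ i, ‖x i‖ ≤ 2 * η) →
      ‖g t j x‖ ≤ C₃ * ε j * η := by
    intro t j hj x hx
    rw [hg]
    refine (norm_sum_le _ _).trans ?_
    calc _ ≤ ∑ _l : Fin nt, ε j * (C₂ * (C * (2 * η))) := by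
          refine Finset.sum_le_sum fun l _ => ?_
          rw [norm_mul]
          exact mul_le_mul (hrow j l hj) (habove W hW (lift x) _ (by positivity)
            (hlift3 x _ (by positivity) hx) t l) (norm_nonneg _) (hε0 j)
      _ = _ := by
          rw [Finset.sum_const, Finset.card_univ, Fintype.card_fin, nsmul_eq_mul, hC₃]
          ring
  -- cells in the weak coordinates
  set c : ℝ := ξ / (4 * θ * (nt * T : ℕ)) with hc
  have hcpos : 0 < c := by positivity
  let tail : (Fin (nt * T) → ℂ) → Fin ((nt - p) * T) → ℂ := fun s j => s (lastIdx hk j)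
  set S := symbolVectors (nt * T) η with hS
  have hStail : ∀ s ∈ S, tail s ∈ symbolVectors ((nt - p) * T) η := fun s hs =>
    Fintype.mem_piFinset.mpr fun j => Fintype.mem_piFinset.mp hs _
  obtain ⟨φ, K, hφK, hKcard, hφ⟩ := exists_cells (ι := Fin T × weak) S
    (fun a s => g a.1 a.2 (tail s)) (fun a => C₃ * ε a.2 * η) hcpos
    (fun a s hs => hgweak a.1 a.2 (Finset.mem_filter.mp a.2.2).2 _ fun i =>
      norm_le_of_mem_constellation (Fintype.mem_piFinset.mp (hStail s hs) i))
    (fun a => by have := hε0 a.2; positivity)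
  have hKcard' : (K.card : ℝ) ≤ (∏ _j ∈ weak, K₀ ^ (2 * T)) *
      ∏ j ∈ weak, (1 + θ * ε j * η / ξ) ^ (2 * T) := by
    refine hKcard.trans ?_
    rw [Fintype.prod_prod_type, ← Finset.prod_mul_distrib]
    simp only
    rw [Finset.prod_const, Finset.card_univ, Fintype.card_fin, ← Finset.prod_pow, Finset.prod_coe_sort weak
      (fun j => ((2 * (C₃ * ε j * η) / c + 3) ^ 2) ^ T)]
    refine Finset.prod_le_prod (fun j _ => by positivity) fun j _ => ?_
    rw [← pow_mul, ← mul_pow]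
    have hx : 0 ≤ θ * ε j * η / ξ := by have := hε0 j; positivity
    have h1 : 2 * (C₃ * ε j * η) / c = 2 * C₃ * (4 * (nt * T : ℕ)) * (θ * ε j * η / ξ) := by
      rw [hc]
      field_simp
    refine pow_le_pow_left₀ (by have := hε0 j; positivity) ?_ _
    rw [h1, hK₀]
    have h2 : 0 ≤ 2 * C₃ * (4 * (nt * T : ℕ)) := by positivity
    nlinarith
  have hcell : ∀ s s', φ s = φ s' → sqNorm (Rk *ᵥ (tail s - tail s')) ≤ (ξ / 2) ^ 2 := by
    intro s s' hss
    refine (hRknorm _).trans ?_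
    have h1 : ∀ t j, ‖g t j (tail s - tail s')‖ ≤ 2 * c := by
      intro t j
      by_cases hj : (j : ℕ) < p
      · rw [hgstrong t j hj, norm_zero]
        positivity
      · have h2 := hφ s s' hss (t, ⟨j, by simpa [hweak] using hj⟩)
        rwa [map_sub]
    calc θ ^ 2 * ∑ t, ∑ j, ‖g t j (tail s - tail s')‖ ^ 2
        ≤ θ ^ 2 * ∑ _t : Fin T, ∑ _j : Fin nt, (2 * c) ^ 2 := by
          gcongr with t _ j _
          exact h1 t j
      _ = ξ ^ 2 / (4 * (nt * T : ℕ)) := by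
          simp only [Finset.sum_const, Finset.card_univ, Fintype.card_fin, nsmul_eq_mul, hc]
          have : (nt : ℝ) ≠ 0 := by positivity
          have : (T : ℝ) ≠ 0 := by positivity
          push_cast
          field_simp
          ring
      _ ≤ (ξ / 2) ^ 2 := by
          rw [div_le_iff₀ (by positivity)]
          nlinarith [sq_nonneg ξ]
  refine ⟨S.filter fun s => S.card ≤ 2 * K.card * (S.filter fun s' => φ s' = φ s).card,
    Finset.filter_subset _ _, card_le_two_mul_card_filter_fiber S φ K hφK, ?_⟩
  intro s hs w hw
  obtain ⟨hs1, hs2⟩ := Finset.mem_filter.mp hs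
  set V := visitedNodes (Qᴴ *ᵥ (Matrix.of H * codeword D θ s + Matrix.of w).vec) R η ξ
    ((nt - p) * T) hk with hV
  have hrv : Qᴴ *ᵥ (Matrix.of H * codeword D θ s + Matrix.of w).vec
      = R *ᵥ s + Qᴴ *ᵥ (Matrix.of w).vec := by
    rw [Matrix.vec_add, vec_mul_codeword, Matrix.mulVec_add, ← hQR.2.2, Matrix.mulVec_mulVec,
      ← Matrix.mul_assoc, hQR.1, Matrix.one_mul]
  have hsub : (S.filter fun s' => φ s' = φ s).image tail ⊆ V := by
    intro x hx
    obtain ⟨s', hs', rfl⟩ := Finset.mem_image.mp hx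
    obtain ⟨hs'1, hs'2⟩ := Finset.mem_filter.mp hs'
    refine Finset.mem_filter.mpr ⟨hStail s' hs'1, ?_⟩
    rw [hrv]
    have h1 : (fun j => (R *ᵥ s + Qᴴ *ᵥ (Matrix.of w).vec) (lastIdx hk j))
        - R.submatrix (lastIdx hk) (lastIdx hk) *ᵥ tail s'
        = Rk *ᵥ (tail s - tail s') + fun j => (Qᴴ *ᵥ (Matrix.of w).vec) (lastIdx hk j) := by
      funext j
      simp only [Pi.sub_apply, Pi.add_apply, Matrix.mulVec_sub]
      rw [mulVec_lastIdx hk hQR.2.1]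
      ring
    rw [h1, sqNorm_eq_norm_toLp_sq, WithLp.toLp_add]
    have h2 := hcell s s' hs'2.symm
    have h3 := ((sqNorm_comp_lastIdx_le hk _).trans
      (sqNorm_conjTranspose_mulVec_le hQR.1 (Matrix.of w).vec)).trans hw
    rw [sqNorm_eq_norm_toLp_sq] at h2 h3
    have h4 := abs_le_of_sq_le_sq h2 (by positivity)
    have h5 := abs_le_of_sq_le_sq h3 (by positivity)
    rw [abs_norm] at h4 h5
    refine pow_le_pow_left₀ (norm_nonneg _) ((norm_add_le _ _).trans ?_) 2
    linarith
  -- a partial symbol vector comes from at most `q ^ (n_t T - k)` full ones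
  have hfib : (S.filter fun s' => φ s' = φ s).card ≤
      (constellation η).card ^ (nt * T - (nt - p) * T) * V.card := by
    refine (Finset.card_le_mul_card_image (f := tail) _ _ fun b _ => ?_).trans
      (Nat.mul_le_mul_left _ (Finset.card_le_card hsub))
    refine le_trans (Finset.card_le_card ?_) (card_symbolVectors_filter_lastIdx_le hk η b)
    intro a ha
    obtain ⟨ha1, ha2⟩ := Finset.mem_filter.mp ha
    exact Finset.mem_filter.mpr ⟨(Finset.mem_filter.mp ha1).1, ha2⟩
  have hq : 0 < (constellation η).card := Finset.card_pos.mpr ⟨0, zero_mem_constellation hη⟩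
  have hmain : (constellation η).card ^ ((nt - p) * T) ≤ 2 * K.card * V.card := by
    have h1 : (constellation η).card ^ (nt * T - (nt - p) * T) *
        (constellation η).card ^ ((nt - p) * T) ≤
        (constellation η).card ^ (nt * T - (nt - p) * T) * (2 * K.card * V.card) := by
      rw [← pow_add, Nat.sub_add_cancel hk, ← card_symbolVectors]
      refine hs2.trans ((Nat.mul_le_mul_left _ hfib).trans (le_of_eq ?_))
      ring
    exact Nat.le_of_mul_le_mul_left h1 (pow_pos hq _)
  calc ((constellation η).card : ℝ) ^ ((nt - p) * T) ≤ 2 * K.card * V.card := by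
        exact_mod_cast hmain
    _ ≤ _ := by
        refine mul_le_mul_of_nonneg_right ?_ (Nat.cast_nonneg _)
        rw [mul_assoc 2]
        exact mul_le_mul_of_nonneg_left hKcard' zero_le_two

/-! ### Orders of growth in the signal-to-noise ratio -/

section

/-- `f ρ = ρ ^ (a + o(1))` as `ρ → ∞`. -/
structure HasExponent (f : ℝ → ℝ) (a : ℝ) : Prop where
  pos : ∀ᶠ ρ in atTop, 0 < f ρ
  tendsto : Tendsto (fun ρ => Real.log (f ρ) / Real.log ρ) atTop (𝓝 a)

namespace HasExponent

variable {f g : ℝ → ℝ} {a b : ℝ}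

theorem congr (hf : HasExponent f a) (h : ∀ᶠ ρ in atTop, f ρ = g ρ) : HasExponent g a := by
  refine ⟨?_, hf.tendsto.congr' ?_⟩
  · filter_upwards [hf.pos, h] with ρ h1 h2
    rwa [← h2]
  · filter_upwards [h] with ρ h
    rw [h]

theorem const {c : ℝ} (hc : 0 < c) : HasExponent (fun _ => c) 0 :=
  ⟨Eventually.of_forall fun _ => hc, Real.tendsto_log_atTop.const_div_atTop _⟩

theorem rpow (a : ℝ) : HasExponent (fun ρ => ρ ^ a) a := by
  refine ⟨?_, tendsto_const_nhds.congr' ?_⟩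
  · filter_upwards [eventually_gt_atTop 0] with ρ hρ
    exact Real.rpow_pos_of_pos hρ a
  · filter_upwards [eventually_gt_atTop 1] with ρ hρ
    rw [Real.log_rpow (by linarith), mul_div_cancel_right₀ _ (Real.log_pos hρ).ne']

theorem mul (hf : HasExponent f a) (hg : HasExponent g b) :
    HasExponent (fun ρ => f ρ * g ρ) (a + b) := by
  refine ⟨?_, (hf.tendsto.add hg.tendsto).congr' ?_⟩
  · filter_upwards [hf.pos, hg.pos] with ρ h1 h2
    exact mul_pos h1 h2
  · filter_upwards [hf.pos, hg.pos] with ρ h1 h2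
    rw [Real.log_mul h1.ne' h2.ne', add_div]

theorem div (hf : HasExponent f a) (hg : HasExponent g b) :
    HasExponent (fun ρ => f ρ / g ρ) (a - b) := by
  refine ⟨?_, (hf.tendsto.sub hg.tendsto).congr' ?_⟩
  · filter_upwards [hf.pos, hg.pos] with ρ h1 h2
    exact div_pos h1 h2
  · filter_upwards [hf.pos, hg.pos] with ρ h1 h2
    rw [Real.log_div h1.ne' h2.ne', sub_div]

theorem pow (hf : HasExponent f a) (n : ℕ) : HasExponent (fun ρ => f ρ ^ n) (n * a) := by
  refine ⟨?_, (hf.tendsto.const_mul (n : ℝ)).congr' ?_⟩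
  · filter_upwards [hf.pos] with ρ h1
    exact pow_pos h1 n
  · filter_upwards [hf.pos] with ρ h1
    rw [Real.log_pow, mul_div_assoc]

theorem of_pow {n : ℕ} (hn : n ≠ 0) (h0 : ∀ᶠ ρ in atTop, 0 < f ρ)
    (hf : HasExponent (fun ρ => f ρ ^ n) a) : HasExponent f (a / n) := by
  refine ⟨h0, (hf.tendsto.div_const (n : ℝ)).congr fun ρ => ?_⟩
  have : (n : ℝ) ≠ 0 := Nat.cast_ne_zero.mpr hn
  rw [Real.log_pow]
  field_simp

theorem prod {ι : Type*} {s : Finset ι} {f : ι → ℝ → ℝ} {a : ι → ℝ}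
    (h : ∀ i ∈ s, HasExponent (f i) (a i)) :
    HasExponent (fun ρ => ∏ i ∈ s, f i ρ) (∑ i ∈ s, a i) := by
  classical
  induction s using Finset.induction_on with
  | empty => simpa using const one_pos
  | insert i s hi ih =>
    simp only [Finset.prod_insert hi, Finset.sum_insert hi]
    exact (h i (Finset.mem_insert_self i s)).mul
      (ih fun j hj => h j (Finset.mem_insert_of_mem hj))

theorem min (hf : HasExponent f a) (hg : HasExponent g b) :
    HasExponent (fun ρ => min (f ρ) (g ρ)) (min a b) := by
  refine ⟨?_, (hf.tendsto.min hg.tendsto).congr' ?_⟩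
  · filter_upwards [hf.pos, hg.pos] with ρ h1 h2
    exact lt_min h1 h2
  · filter_upwards [hf.pos, hg.pos, eventually_gt_atTop 1] with ρ h1 h2 hρ
    have h3 := (Real.log_pos hρ).le
    rcases le_total (f ρ) (g ρ) with h | h
    · rw [min_eq_left h, min_eq_left (div_le_div_of_nonneg_right (Real.log_le_log h1 h) h3)]
    · rw [min_eq_right h, min_eq_right (div_le_div_of_nonneg_right (Real.log_le_log h2 h) h3)]

theorem max (hf : HasExponent f a) (hg : HasExponent g b) :
    HasExponent (fun ρ => max (f ρ) (g ρ)) (max a b) := by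
  refine ⟨?_, (hf.tendsto.max hg.tendsto).congr' ?_⟩
  · filter_upwards [hf.pos] with ρ h1
    exact lt_max_of_lt_left h1
  · filter_upwards [hf.pos, hg.pos, eventually_gt_atTop 1] with ρ h1 h2 hρ
    have h3 := (Real.log_pos hρ).le
    rcases le_total (f ρ) (g ρ) with h | h
    · rw [max_eq_right h, max_eq_right (div_le_div_of_nonneg_right (Real.log_le_log h1 h) h3)]
    · rw [max_eq_left h, max_eq_left (div_le_div_of_nonneg_right (Real.log_le_log h2 h) h3)]

/-- A function within constant factors of `g` has the exponent of `g`. -/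
theorem of_le_of_le (hg : HasExponent g a) {c C : ℝ} (hc : 0 < c) (hC : 0 < C)
    (h1 : ∀ᶠ ρ in atTop, c * g ρ ≤ f ρ) (h2 : ∀ᶠ ρ in atTop, f ρ ≤ C * g ρ) :
    HasExponent f a := by
  have hl := (const hc).mul hg
  have hu := (const hC).mul hg
  rw [zero_add] at hl hu
  have hpos : ∀ᶠ ρ in atTop, 0 < f ρ := by
    filter_upwards [hl.pos, h1] with ρ h3 h4 using h3.trans_le h4
  refine ⟨hpos, tendsto_of_tendsto_of_tendsto_of_le_of_le' hl.tendsto hu.tendsto ?_ ?_⟩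
  · filter_upwards [hl.pos, h1, eventually_gt_atTop 1] with ρ h3 h4 hρ
    exact div_le_div_of_nonneg_right (Real.log_le_log h3 h4) (Real.log_pos hρ).le
  · filter_upwards [hpos, h2, eventually_gt_atTop 1] with ρ h3 h4 hρ
    exact div_le_div_of_nonneg_right (Real.log_le_log h3 h4) (Real.log_pos hρ).le

theorem one_add (hf : HasExponent f a) : HasExponent (fun ρ => 1 + f ρ) (Max.max 0 a) := by
  refine ((const one_pos).max hf).of_le_of_le one_pos two_pos ?_ ?_
  · filter_upwards [hf.pos] with ρ h
    rw [one_mul]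
    exact max_le (by linarith) (by linarith)
  · filter_upwards with ρ
    linarith [le_max_left 1 (f ρ), le_max_right 1 (f ρ)]

theorem eventually_lt (hf : HasExponent f a) (hg : HasExponent g b) (hab : a < b) :
    ∀ᶠ ρ in atTop, f ρ < g ρ := by
  filter_upwards [hf.pos, hg.pos, hf.tendsto.eventually_lt hg.tendsto hab,
    eventually_gt_atTop 1] with ρ h1 h2 h3 hρ
  exact (Real.log_lt_log_iff h1 h2).mp ((div_lt_div_iff_of_pos_right (Real.log_pos hρ)).mp h3)

end HasExponent

theorem tendsto_decayRate_ofReal {f : ℝ → ℝ} {a : ℝ} (hf : HasExponent f (-a)) :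
    Tendsto (decayRate fun ρ => ENNReal.ofReal (f ρ)) atTop (𝓝 (a : EReal)) := by
  have h := (continuous_coe_real_ereal.tendsto _).comp hf.tendsto.neg
  rw [neg_neg] at h
  refine h.congr' ?_
  filter_upwards [hf.pos, eventually_gt_atTop 1] with ρ h1 hρ
  rw [decayRate, ENNReal.log_ofReal_of_pos h1, ← EReal.coe_div, ← EReal.coe_neg]
  rfl

theorem decayRate_le_decayRate {p q : ℝ → ℝ≥0∞} {ρ : ℝ} (hρ : 1 < ρ) (h : p ρ ≤ q ρ) :
    decayRate q ρ ≤ decayRate p ρ :=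
  EReal.neg_le_neg_iff.mpr (EReal.div_le_div_right_of_nonneg
    (by exact_mod_cast (Real.log_pos hρ).le) (ENNReal.log_monotone h))

theorem le_liminf_decayRate {p : ℝ → ℝ≥0∞} {f : ℝ → ℝ} {a : ℝ} (hf : HasExponent f (-a))
    (h : ∀ᶠ ρ in atTop, p ρ ≤ ENNReal.ofReal (f ρ)) :
    (a : EReal) ≤ liminf (decayRate p) atTop := by
  rw [← (tendsto_decayRate_ofReal hf).liminf_eq]
  refine liminf_le_liminf ?_
  filter_upwards [h, eventually_gt_atTop 1] with ρ h1 hρ using decayRate_le_decayRate hρ h1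

theorem limsup_decayRate_le {p : ℝ → ℝ≥0∞} {f : ℝ → ℝ} {a : ℝ} (hf : HasExponent f (-a))
    (h : ∀ᶠ ρ in atTop, ENNReal.ofReal (f ρ) ≤ p ρ) :
    limsup (decayRate p) atTop ≤ (a : EReal) := by
  rw [← (tendsto_decayRate_ofReal hf).limsup_eq]
  refine limsup_le_limsup ?_
  filter_upwards [h, eventually_gt_atTop 1] with ρ h1 hρ using decayRate_le_decayRate hρ h1

/-- The decay exponent of a family of probabilities is nonnegative. -/
theorem nonneg_of_tendsto_decayRate {p : ℝ → ℝ≥0∞} {d : ℝ} (hp : ∀ᶠ ρ in atTop, p ρ ≤ 1)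
    (h : Tendsto (decayRate p) atTop (𝓝 (d : EReal))) : 0 ≤ d := by
  have h1 : (0 : ℝ) ≤ (d : EReal) := by
    rw [← h.liminf_eq]
    refine le_liminf_decayRate (f := fun _ => 1) ?_ (by simpa using hp)
    simpa using HasExponent.const one_pos
  exact_mod_cast h1

end

/-! ### Probability bounds for the joint law -/

/-- Since `E` need not be measurable, it is replaced by a measurable superset of the same measure. -/
theorem mul_measure_le_prod {α β : Type*} [MeasurableSpace α] [MeasurableSpace β]
    (μ : Measure α) (ν : Measure β) [SFinite ν] {A : Set α} (hA : MeasurableSet A)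
    (E : Set (α × β)) (c : ℝ≥0∞) (h : ∀ a ∈ A, c ≤ ν (Prod.mk a ⁻¹' E)) :
    c * μ A ≤ μ.prod ν E := by
  rw [← measure_toMeasurable E, Measure.prod_apply (measurableSet_toMeasurable _ _)]
  calc c * μ A = ∫⁻ _ in A, c ∂μ := by rw [setLIntegral_const]
    _ ≤ ∫⁻ a in A, ν (Prod.mk a ⁻¹' toMeasurable (μ.prod ν) E) ∂μ :=
        setLIntegral_mono' hA fun a ha =>
          (h a ha).trans (measure_mono (Set.preimage_mono (subset_toMeasurable _ _)))
    _ ≤ _ := setLIntegral_le_lintegral _ _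

theorem symbolVectors_nonempty (k : ℕ) {η : ℝ} (hη : 0 ≤ η) : (symbolVectors k η).Nonempty :=
  ⟨0, Fintype.mem_piFinset.mpr fun _ => zero_mem_constellation hη⟩

theorem isProbabilityMeasure_uniformOn_symbolVectors (k : ℕ) {η : ℝ} (hη : 0 ≤ η) :
    IsProbabilityMeasure (uniformOn (symbolVectors k η : Set (Fin k → ℂ))) :=
  isProbabilityMeasure_uniformOn (Finset.finite_toSet _)
    (Finset.coe_nonempty.mpr (symbolVectors_nonempty k hη))

theorem half_le_uniformOn {α : Type*} [MeasurableSpace α] [MeasurableSingletonClass α]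
    {S good : Finset α} (hS : S.Nonempty) (hgood : good ⊆ S) (h : S.card ≤ 2 * good.card) :
    2⁻¹ ≤ uniformOn (S : Set α) (good : Set α) := by
  classical
  rw [uniformOn, cond_apply S.finite_toSet.measurableSet, ← Finset.coe_inter,
    Finset.inter_eq_right.mpr hgood, Measure.count_apply_finset, Measure.count_apply_finset]
  have h1 : (S.card : ℝ≥0∞) ≠ 0 := by exact_mod_cast hS.card_pos.ne'
  rw [← ENNReal.div_eq_inv_mul, ENNReal.le_div_iff_mul_le (Or.inl h1)
    (Or.inl (ENNReal.natCast_ne_top _))]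
  calc (2 : ℝ≥0∞)⁻¹ * S.card ≤ 2⁻¹ * ((2 * good.card : ℕ) : ℝ≥0∞) := by gcongr
    _ = good.card := by
      push_cast
      rw [← mul_assoc, ENNReal.inv_mul_cancel two_ne_zero ENNReal.ofNat_ne_top, one_mul]

theorem sampleLaw_le {nt nr T : ℕ} {η : ℝ} (hη : 0 ≤ η) (E : Set (Sample nt nr T))
    (A : Set (Fin nr → Fin nt → ℂ)) (h : ∀ ω ∈ E, ω.1 ∈ A) :
    sampleLaw nt nr T η E ≤ gaussianMatrix nr nt A := by
  have := isProbabilityMeasure_uniformOn_symbolVectors (nt * T) hη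
  calc sampleLaw nt nr T η E ≤ sampleLaw nt nr T η (A ×ˢ Set.univ) :=
        measure_mono fun ω hω => ⟨h ω hω, trivial⟩
    _ = gaussianMatrix nr nt A := by
        rw [sampleLaw, Measure.prod_prod, measure_univ, mul_one]
        rfl

theorem sampleLaw_le_one {nt nr T : ℕ} {η : ℝ} (hη : 0 ≤ η) (E : Set (Sample nt nr T)) :
    sampleLaw nt nr T η E ≤ 1 :=
  (sampleLaw_le hη E Set.univ fun _ _ => trivial).trans prob_le_one

/-- The probability of an event which, for every channel in `A` and every noise in `B`, holds for
at least half of the symbol vectors. -/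
theorem le_sampleLaw {nt nr T : ℕ} {η : ℝ} (hη : 0 ≤ η) (E : Set (Sample nt nr T))
    {A : Set (Fin nr → Fin nt → ℂ)} (hA : MeasurableSet A) (B : Set (Fin nr → Fin T → ℂ))
    (h : ∀ H ∈ A, ∃ good ⊆ symbolVectors (nt * T) η,
      (symbolVectors (nt * T) η).card ≤ 2 * good.card ∧
        ∀ s ∈ good, ∀ w ∈ B, ((H, w, s) : Sample nt nr T) ∈ E) :
    gaussianMatrix nr T B * 2⁻¹ * gaussianMatrix nr nt A ≤ sampleLaw nt nr T η E := by
  have := isProbabilityMeasure_uniformOn_symbolVectors (nt * T) hη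
  refine mul_measure_le_prod _ _ hA E _ fun H hH => ?_
  obtain ⟨good, h1, h2, h3⟩ := h H hH
  calc gaussianMatrix nr T B * 2⁻¹
      ≤ gaussianMatrix nr T B * uniformOn (symbolVectors (nt * T) η : Set (Fin (nt * T) → ℂ))
          (good : Set (Fin (nt * T) → ℂ)) :=
        mul_le_mul_right (half_le_uniformOn (symbolVectors_nonempty _ hη) h1 h2) _
    _ = _ := (Measure.prod_prod (μ := gaussianMatrix nr T) B _).symm
    _ ≤ _ := measure_mono fun x hx => h3 x.2 hx.2 x.1 hx.1

theorem exists_le_gaussianMatrix_sqNorm_le (m n : ℕ) :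
    ∃ c : ℝ, 0 < c ∧ ∀ ξ : ℝ, 0 ≤ ξ →
      ENNReal.ofReal (c * (min 1 ξ ^ 2) ^ (m * n)) ≤
        gaussianMatrix m n {w | sqNorm (Matrix.of w).vec ≤ ξ ^ 2} := by
  obtain ⟨c, hc, hball⟩ := exists_le_complexGaussian_closedBall
  set K : ℝ := m * n + 1 with hK
  have hK1 : 1 ≤ K := by rw [hK]; have : (0:ℝ) ≤ m * n := by positivity
                         linarith
  have hK0 : 0 < K := by linarith
  refine ⟨(c * (1 / K) ^ 2) ^ (m * n), by positivity, fun ξ hξ => ?_⟩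
  set ε := min 1 ξ / K with hε
  have hm0 : 0 ≤ min 1 ξ := le_min zero_le_one hξ
  have hε0 : 0 ≤ ε := by positivity
  have hε1 : ε ≤ 1 := (div_le_one hK0).mpr ((min_le_left _ _).trans hK1)
  calc _ = ENNReal.ofReal (c * ε ^ 2) ^ (m * n) := by
        rw [← ENNReal.ofReal_pow (by positivity), hε]
        congr 1
        rw [← mul_pow]
        congr 1
        field_simp
    _ ≤ complexGaussian (Metric.closedBall 0 ε) ^ (m * n) := by
        gcongr
        exact hball ε hε0 hε1
    _ = gaussianMatrix m n
          (Set.pi Set.univ fun _ => Set.pi Set.univ fun _ => Metric.closedBall 0 ε) := by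
        rw [gaussianMatrix, Measure.pi_pi]
        simp only [Measure.pi_pi, Finset.prod_const, Finset.card_univ, Fintype.card_fin]
        rw [← pow_mul, mul_comm]
    _ ≤ _ := measure_mono fun w hw => by
        have hw1 : ∀ i j, ‖w i j‖ ≤ ε := fun i j => by
          simpa using hw i trivial j trivial
        have h1 : sqNorm (Matrix.of w).vec ≤ (m * n : ℝ) * ε ^ 2 := by
          calc sqNorm (Matrix.of w).vec ≤ ∑ _a : Fin n × Fin m, ε ^ 2 :=
                Finset.sum_le_sum fun a _ =>
                  pow_le_pow_left₀ (norm_nonneg _) (hw1 a.2 a.1) 2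
            _ = _ := by
                rw [Finset.sum_const, Finset.card_univ, Fintype.card_prod]
                simp [mul_comm]
        refine h1.trans ?_
        have h2 : ε * K = min 1 ξ := by rw [hε]; field_simp
        have h3 : ε * K ≤ ξ := h2.le.trans (min_le_right _ _)
        have h4 : (ε * K) ^ 2 ≤ ξ ^ 2 := pow_le_pow_left₀ (by positivity) h3 2
        have h5 : (m * n : ℝ) ≤ K ^ 2 := by nlinarith
        nlinarith [sq_nonneg ε]

/-! ### The growth of the constellation and of the power normalization -/

section

theorem card_constellation {η : ℝ} (hη : 0 ≤ η) :
    ((constellation η).card : ℝ) = (2 * (⌊η⌋ : ℝ) + 1) ^ 2 := by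
  classical
  have hm : 0 ≤ ⌊η⌋ := Int.floor_nonneg.mpr hη
  rw [constellation, Finset.card_image_of_injective, Finset.card_product, Int.card_Icc]
  · have h : (((⌊η⌋ + 1 - -⌊η⌋).toNat : ℕ) : ℝ) = 2 * (⌊η⌋ : ℝ) + 1 := by
      have : (((⌊η⌋ + 1 - -⌊η⌋).toNat : ℕ) : ℤ) = 2 * ⌊η⌋ + 1 := by omega
      exact_mod_cast this
    rw [Nat.cast_mul, h, sq]
  · rintro ⟨a, b⟩ ⟨a', b'⟩ h
    simpa [Complex.ext_iff] using h

theorem mem_constellation_of_norm_le {η η' : ℝ} {s : ℂ} (hs : s ∈ constellation η)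
    (h : ‖s‖ ≤ η') : s ∈ constellation η' := by
  obtain ⟨a, b, -, -, rfl⟩ := (mem_constellation η s).mp hs
  exact (mem_constellation η' _).mpr ⟨a, b, (Complex.abs_re_le_norm _).trans h,
    (Complex.abs_im_le_norm _).trans h, rfl⟩

theorem frobSq_eq_sqNorm_vec {m n : Type*} [Fintype m] [Fintype n] (A : Matrix m n ℂ) :
    frobSq A = sqNorm A.vec := by
  rw [frobSq, sqNorm, Finset.sum_comm, Fintype.sum_prod_type]
  rfl

theorem norm_sq_le_sqNorm_pi {ι : Type*} [Fintype ι] (v : ι → ℂ) : ‖v‖ ^ 2 ≤ sqNorm v := by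
  have h : ‖v‖ ≤ √(sqNorm v) := (pi_norm_le_iff_of_nonneg (Real.sqrt_nonneg _)).mpr fun i =>
    Real.le_sqrt_of_sq_le (norm_sq_le_sqNorm v i)
  exact (Real.le_sqrt (norm_nonneg _) (sqNorm_nonneg v)).mp h

theorem sqNorm_le_card_mul {ι : Type*} [Fintype ι] (v : ι → ℂ) :
    sqNorm v ≤ Fintype.card ι * ‖v‖ ^ 2 := by
  calc sqNorm v ≤ ∑ _i : ι, ‖v‖ ^ 2 :=
        Finset.sum_le_sum fun i _ => pow_le_pow_left₀ (norm_nonneg _) (norm_le_pi_norm v i) 2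
    _ = _ := by simp

theorem sqNorm_smul {ι : Type*} [Fintype ι] (c : ℂ) (v : ι → ℂ) :
    sqNorm (c • v) = ‖c‖ ^ 2 * sqNorm v := by
  simp [sqNorm, mul_pow, Finset.mul_sum]

variable {nt T : ℕ} {D : Fin (nt * T) → Matrix (Fin nt) (Fin T) ℂ}

theorem exists_frobSq_codeword_bounds (hD : LinearIndependent ℂ D) :
    ∃ c C : ℝ, 0 < c ∧ 0 < C ∧ ∀ θ s, c * (θ ^ 2 * ‖s‖ ^ 2) ≤ frobSq (codeword D θ s) ∧
      frobSq (codeword D θ s) ≤ C * (θ ^ 2 * ‖s‖ ^ 2) := by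
  obtain ⟨C₁, hC₁, h1⟩ := exists_norm_le_of_injective _ (generator_mulVec_injective hD)
  obtain ⟨C₂, hC₂, h2⟩ :=
    (LinearMap.toContinuousLinearMap (generator D).mulVecLin).bound
  simp only [LinearMap.coe_toContinuousLinearMap'] at h2
  refine ⟨1 / C₁ ^ 2, (Fintype.card (Fin T × Fin nt) + 1) * C₂ ^ 2, by positivity, by positivity,
    fun θ s => ?_⟩
  rw [frobSq_eq_sqNorm_vec, vec_codeword, sqNorm_smul, Complex.norm_real, Real.norm_eq_abs, sq_abs]
  constructor
  · have h3 := norm_sq_le_sqNorm_pi ((generator D).mulVecLin s)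
    have h4 : ‖s‖ ^ 2 ≤ C₁ ^ 2 * ‖(generator D).mulVecLin s‖ ^ 2 := by
      rw [← mul_pow]
      exact pow_le_pow_left₀ (norm_nonneg _) (h1 s) 2
    calc 1 / C₁ ^ 2 * (θ ^ 2 * ‖s‖ ^ 2) = θ ^ 2 * (‖s‖ ^ 2 / C₁ ^ 2) := by ring
      _ ≤ _ := by
        refine mul_le_mul_of_nonneg_left (le_trans ?_ h3) (sq_nonneg θ)
        rw [div_le_iff₀ (by positivity), mul_comm _ (C₁ ^ 2)]
        exact h4
  · have h3 := sqNorm_le_card_mul ((generator D).mulVecLin s)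
    have h4 : ‖(generator D).mulVecLin s‖ ^ 2 ≤ C₂ ^ 2 * ‖s‖ ^ 2 := by
      rw [← mul_pow]
      exact pow_le_pow_left₀ (norm_nonneg _) (h2 s) 2
    calc θ ^ 2 * sqNorm ((generator D).mulVecLin s)
        ≤ θ ^ 2 * ((Fintype.card (Fin T × Fin nt) + 1) * (C₂ ^ 2 * ‖s‖ ^ 2)) := by
          refine mul_le_mul_of_nonneg_left (h3.trans ?_) (sq_nonneg θ)
          exact mul_le_mul (by linarith) h4 (by positivity) (by positivity)
      _ = _ := by ring

theorem codeword_injective (hD : LinearIndependent ℂ D) {θ : ℝ} (hθ : θ ≠ 0) :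
    Function.Injective (codeword D θ) := by
  intro s s' h
  have h1 := congrArg Matrix.vec h
  rw [vec_codeword, vec_codeword] at h1
  exact generator_mulVec_injective hD (smul_right_injective _ (Complex.ofReal_ne_zero.mpr hθ) h1)

theorem card_codebook (hD : LinearIndependent ℂ D) {θ : ℝ} (hθ : θ ≠ 0) (η : ℝ) :
    (codebook D θ η).card = (constellation η).card ^ (nt * T) := by
  classical
  rw [← card_symbolVectors, codebook, Finset.card_image_of_injective _ (codeword_injective hD hθ)]

theorem sum_codebook (hD : LinearIndependent ℂ D) {θ : ℝ} (hθ : θ ≠ 0) (η : ℝ) :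
    ∑ X ∈ codebook D θ η, frobSq X
      = ∑ s ∈ symbolVectors (nt * T) η, frobSq (codeword D θ s) := by
  classical
  rw [codebook, Finset.sum_image fun s _ s' _ h => codeword_injective hD hθ h]

theorem card_le_two_mul_card_sdiff {α : Type*} [DecidableEq α] {S S' : Finset α}
    (h : 2 * S'.card ≤ S.card) : S.card ≤ 2 * (S \ S').card := by
  have := Finset.card_le_card_sdiff_add_card (s := S) (t := S')
  omega

/-- The average codeword energy is of the order `θ² η²` once `η ≥ 1`. -/
theorem exists_energy_bounds (hκ : 0 < nt * T) (hD : LinearIndependent ℂ D) :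
    ∃ c C : ℝ, 0 < c ∧ 0 < C ∧ ∀ θ η, 0 < θ → 1 ≤ η →
      c * (θ ^ 2 * η ^ 2) ≤ (∑ X ∈ codebook D θ η, frobSq X) / ((codebook D θ η).card : ℝ) ∧
      (∑ X ∈ codebook D θ η, frobSq X) / ((codebook D θ η).card : ℝ) ≤ C * (θ ^ 2 * η ^ 2) := by
  classical
  obtain ⟨c, C, hc, hC, h⟩ := exists_frobSq_codeword_bounds hD
  refine ⟨c / 32, C * 4, by positivity, by positivity, fun θ η hθ hη => ?_⟩
  have hη0 : 0 ≤ η := by linarith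
  have hcard : (codebook D θ η).card = (symbolVectors (nt * T) η).card := by
    rw [card_codebook hD hθ.ne', card_symbolVectors]
  have hpos : (0 : ℝ) < (symbolVectors (nt * T) η).card := by
    exact_mod_cast (symbolVectors_nonempty _ hη0).card_pos
  rw [hcard, sum_codebook hD hθ.ne']
  constructor
  · rw [le_div_iff₀ hpos]
    obtain ⟨S, hS⟩ : ∃ S, symbolVectors (nt * T) η = S := ⟨_, rfl⟩
    obtain ⟨S', hS'⟩ : ∃ S, symbolVectors (nt * T) (η / 4) = S := ⟨_, rfl⟩
    rw [hS]
    -- at most half of the symbol vectors have all entries below `η / 4`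
    have h1 : 2 * (S'.card : ℝ) ≤ S.card := by
      have hm1 : (1 : ℝ) ≤ ⌊η⌋ := by exact_mod_cast Int.le_floor.mpr (by exact_mod_cast hη)
      have ha0 : (0 : ℝ) ≤ ⌊η / 4⌋ := by exact_mod_cast Int.floor_nonneg.mpr (by positivity)
      have ha1 : 4 * (⌊η / 4⌋ : ℝ) ≤ ⌊η⌋ := by
        have : 4 * ⌊η / 4⌋ ≤ ⌊η⌋ := by
          rw [Int.le_floor]
          push_cast
          linarith [Int.floor_le (η / 4)]
        exact_mod_cast this
      have h2 : 2 * ((constellation (η / 4)).card : ℝ) ≤ (constellation η).card := by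
        rw [card_constellation (by positivity), card_constellation hη0]
        nlinarith
      rw [← hS, ← hS', card_symbolVectors, card_symbolVectors]
      push_cast
      calc 2 * ((constellation (η / 4)).card : ℝ) ^ (nt * T)
          ≤ 2 ^ (nt * T) * ((constellation (η / 4)).card : ℝ) ^ (nt * T) := by
            gcongr
            exact le_self_pow₀ one_le_two hκ.ne'
        _ = (2 * ((constellation (η / 4)).card : ℝ)) ^ (nt * T) := (mul_pow _ _ _).symm
        _ ≤ _ := pow_le_pow_left₀ (by positivity) h2 _
    have h2 : (S.card : ℝ) ≤ 2 * (S \ S').card := by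
      have h3 := card_le_two_mul_card_sdiff (S := S) (S' := S') (by exact_mod_cast h1)
      exact_mod_cast h3
    have h3 : ∀ s ∈ S \ S', c * (θ ^ 2 * (η / 4) ^ 2) ≤ frobSq (codeword D θ s) := by
      intro s hs
      obtain ⟨hs1, hs2⟩ := Finset.mem_sdiff.mp hs
      refine le_trans ?_ (h θ s).1
      gcongr
      by_contra hlt
      push Not at hlt
      rw [← hS] at hs1
      rw [← hS'] at hs2
      exact hs2 (Fintype.mem_piFinset.mpr fun i => mem_constellation_of_norm_le
        (Fintype.mem_piFinset.mp hs1 i) ((norm_le_pi_norm s i).trans hlt.le))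
    calc c / 32 * (θ ^ 2 * η ^ 2) * S.card
        ≤ c / 32 * (θ ^ 2 * η ^ 2) * (2 * (S \ S').card) := by gcongr
      _ = ∑ _s ∈ S \ S', c * (θ ^ 2 * (η / 4) ^ 2) := by
          rw [Finset.sum_const, nsmul_eq_mul]
          ring
      _ ≤ ∑ s ∈ S \ S', frobSq (codeword D θ s) := Finset.sum_le_sum h3
      _ ≤ ∑ s ∈ S, frobSq (codeword D θ s) := by
          refine Finset.sum_le_sum_of_subset_of_nonneg Finset.sdiff_subset fun s _ _ => ?_
          rw [frobSq_eq_sqNorm_vec]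
          exact sqNorm_nonneg _
  · rw [div_le_iff₀ hpos]
    calc ∑ s ∈ symbolVectors (nt * T) η, frobSq (codeword D θ s)
        ≤ ∑ _s ∈ symbolVectors (nt * T) η, C * 4 * (θ ^ 2 * η ^ 2) := by
          refine Finset.sum_le_sum fun s hs => (h θ s).2.trans ?_
          have h1 : ‖s‖ ≤ 2 * η := (pi_norm_le_iff_of_nonneg (by positivity)).mpr fun i =>
            norm_le_of_mem_constellation (Fintype.mem_piFinset.mp hs i)
          have h2 : ‖s‖ ^ 2 ≤ (2 * η) ^ 2 := pow_le_pow_left₀ (norm_nonneg _) h1 2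
          calc C * (θ ^ 2 * ‖s‖ ^ 2) ≤ C * (θ ^ 2 * (2 * η) ^ 2) := by gcongr
            _ = _ := by ring
      _ = _ := by
          rw [Finset.sum_const, nsmul_eq_mul]
          ring

namespace IsCodeScaling

variable {r : ℝ} {θ η : ℝ → ℝ}

theorem eventually_one_le_eta (hκ : 0 < nt * T) (h : IsCodeScaling D r θ η) :
    ∀ᶠ ρ in atTop, 1 ≤ η ρ := by
  classical
  filter_upwards [h.eta_pos, h.power, eventually_gt_atTop 0] with ρ h1 h2 hρ
  by_contra hlt
  push Not at hlt
  -- otherwise zero is the only codeword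
  have hm : ⌊η ρ⌋ = 0 := Int.floor_eq_zero_iff.mpr ⟨h1.le, hlt⟩
  have h3 : ∀ X ∈ codebook D (θ ρ) (η ρ), frobSq X = 0 := by
    intro X hX
    obtain ⟨s, hs, rfl⟩ := Finset.mem_image.mp hX
    have hs0 : s = 0 := by
      funext i
      have := Fintype.mem_piFinset.mp hs i
      simp only [constellation, hm, neg_zero, Finset.Icc_self, Finset.mem_image,
        Finset.mem_product, Finset.mem_singleton, Prod.exists] at this
      obtain ⟨a, b, ⟨rfl, rfl⟩, hab⟩ := this
      rw [← hab]
      simp [Complex.ext_iff]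
    simp [hs0, codeword, frobSq]
  rw [Finset.sum_eq_zero h3, zero_div] at h2
  have hT : (0 : ℝ) < T := by exact_mod_cast Nat.pos_of_mul_pos_left hκ
  have : 0 < ρ * T := mul_pos hρ hT
  linarith

theorem hasExponent_card_constellation (hκ : 0 < nt * T) (hD : LinearIndependent ℂ D)
    (h : IsCodeScaling D r θ η) :
    HasExponent (fun ρ => ((constellation (η ρ)).card : ℝ)) (r / nt) := by
  have hT : (T : ℝ) ≠ 0 := by exact_mod_cast (Nat.pos_of_mul_pos_left hκ).ne'
  have hnt : (nt : ℝ) ≠ 0 := by exact_mod_cast (Nat.pos_of_mul_pos_right hκ).ne'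
  refine ⟨?_, (h.rate.div_const (nt : ℝ)).congr' ?_⟩
  · filter_upwards [h.eta_pos] with ρ h1
    exact_mod_cast Finset.card_pos.mpr ⟨0, zero_mem_constellation h1.le⟩
  · filter_upwards [h.theta_pos] with ρ h1
    rw [card_codebook hD h1.ne']
    push_cast
    rw [Real.log_pow]
    push_cast
    field_simp

theorem hasExponent_eta (hκ : 0 < nt * T) (hD : LinearIndependent ℂ D)
    (h : IsCodeScaling D r θ η) : HasExponent η (r / nt / 2) := by
  refine HasExponent.of_pow (n := 2) two_ne_zero h.eta_pos ?_
  refine (h.hasExponent_card_constellation hκ hD).of_le_of_le (c := 1 / 9) (C := 1) (by norm_num)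
    one_pos ?_ ?_
  · filter_upwards [h.eventually_one_le_eta hκ] with ρ h1
    rw [card_constellation (by linarith)]
    have := Int.floor_le (η ρ)
    have h2 : (1 : ℝ) ≤ ⌊η ρ⌋ := by exact_mod_cast Int.le_floor.mpr (by exact_mod_cast h1)
    nlinarith
  · filter_upwards [h.eventually_one_le_eta hκ] with ρ h1
    rw [card_constellation (by linarith)]
    have := Int.lt_floor_add_one (η ρ)
    have h2 : (1 : ℝ) ≤ ⌊η ρ⌋ := by exact_mod_cast Int.le_floor.mpr (by exact_mod_cast h1)
    nlinarith

/-- The average energy `ρ T` is of the order `θ² η²`. -/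
theorem hasExponent_theta (hκ : 0 < nt * T) (hD : LinearIndependent ℂ D)
    (h : IsCodeScaling D r θ η) : HasExponent θ ((1 - r / nt) / 2) := by
  have hT : (0 : ℝ) < T := by exact_mod_cast Nat.pos_of_mul_pos_left hκ
  have hη := h.hasExponent_eta hκ hD
  obtain ⟨c, C, hc, hC, hcC⟩ := exists_energy_bounds hκ hD
  refine HasExponent.of_pow (n := 2) two_ne_zero h.theta_pos ?_
  have h1 : HasExponent (fun ρ => θ ρ ^ 2 * η ρ ^ 2) 1 := by
    refine (HasExponent.rpow 1).of_le_of_le (c := T / C) (C := T / c) (by positivity)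
      (by positivity) ?_ ?_
    · filter_upwards [h.eventually_one_le_eta hκ, h.theta_pos, h.power] with ρ h1 h2 h3
      have h4 := (hcC (θ ρ) (η ρ) h2 h1).2
      rw [h3] at h4
      rw [Real.rpow_one, div_mul_eq_mul_div, div_le_iff₀ hC]
      linarith
    · filter_upwards [h.eventually_one_le_eta hκ, h.theta_pos, h.power] with ρ h1 h2 h3
      have h4 := (hcC (θ ρ) (η ρ) h2 h1).1
      rw [h3] at h4
      rw [Real.rpow_one, div_mul_eq_mul_div, le_div_iff₀ hc]
      linarith
  have h2 := h1.div (hη.pow 2)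
  have h3 : 1 - ((2 : ℕ) : ℝ) * (r / nt / 2) = 1 - r / nt := by push_cast; ring
  rw [h3] at h2
  refine h2.congr ?_
  filter_upwards [h.eta_pos] with ρ h4
  field_simp

end IsCodeScaling

end

/-! ### The optimization problem -/

section

variable {nt nr T : ℕ}

theorem one_le_weight (hnr : nt ≤ nr) (i : Fin nt) :
    1 ≤ (nr : ℝ) - nt + 2 * ((i : ℝ) + 1) - 1 := by
  have h1 : (nt : ℝ) ≤ nr := Nat.cast_le.mpr hnr
  have h2 : (0 : ℝ) ≤ (i : ℕ) := Nat.cast_nonneg _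
  linarith

theorem isCompact_feasible (hnr : nt ≤ nr) (d : ℝ) : IsCompact (feasible nt nr d) := by
  refine IsCompact.of_isClosed_subset (isCompact_univ_pi fun _ : Fin nt => isCompact_Icc)
    (s := Set.univ.pi fun _ => Set.Icc 0 d) ?_ ?_
  · have h1 : IsClosed {α : Fin nt → ℝ |
        ∑ i : Fin nt, ((nr : ℝ) - nt + 2 * ((i : ℝ) + 1) - 1) * α i ≤ d} :=
      isClosed_le (by fun_prop) continuous_const
    have h2 : IsClosed {α : Fin nt → ℝ | Antitone α} := by
      simp only [Antitone, Set.ofPred_forall]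
      exact isClosed_iInter fun i => isClosed_iInter fun j => isClosed_iInter fun _ =>
        isClosed_le (by fun_prop) (by fun_prop)
    have h3 : IsClosed {α : Fin nt → ℝ | ∀ i, 0 ≤ α i} := by
      simp only [Set.ofPred_forall]
      exact isClosed_iInter fun i => isClosed_le (by fun_prop) (by fun_prop)
    exact h1.inter (h2.inter h3)
  · rintro α ⟨h1, -, h3⟩ i -
    refine ⟨h3 i, le_trans ?_ h1⟩
    have h4 : α i ≤ ((nr : ℝ) - nt + 2 * ((i : ℝ) + 1) - 1) * α i :=
      le_mul_of_one_le_left (h3 i) (one_le_weight hnr i)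
    exact h4.trans (Finset.single_le_sum
      (f := fun i : Fin nt => ((nr : ℝ) - nt + 2 * ((i : ℝ) + 1) - 1) * α i)
      (fun j _ => mul_nonneg (by linarith [one_le_weight hnr j]) (h3 j)) (Finset.mem_univ i))

theorem continuous_objective (r : ℝ) : Continuous (objective nt T r) := by
  unfold objective
  fun_prop

theorem zero_mem_feasible {d : ℝ} (hd : 0 ≤ d) : (0 : Fin nt → ℝ) ∈ feasible nt nr d :=
  ⟨by simpa using hd, fun _ _ _ => le_rfl, fun _ => le_rfl⟩

theorem isGreatest_cBar (hnr : nt ≤ nr) (r : ℝ) {d : ℝ} (hd : 0 ≤ d) :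
    IsGreatest (objective nt T r '' feasible nt nr d) (cBar nt nr T r d) :=
  ((isCompact_feasible hnr d).image (continuous_objective r)).isGreatest_sSup
    ⟨_, 0, zero_mem_feasible hd, rfl⟩

/-- The rows of a triangular factor are indexed from the largest diagonal entry to the smallest, that
is, in the reverse order of the exponents in the optimization problem. -/
theorem sum_weight_rev (β : ℕ → ℝ) :
    ∑ i : Fin nt, ((nr : ℝ) - nt + 2 * ((i : ℝ) + 1) - 1) * β (Fin.rev i)
      = ∑ j ∈ Finset.range nt, ((nr : ℝ) + nt - 2 * j - 1) * β j := by
  rw [← Fin.sum_univ_eq_sum_range (fun j => ((nr : ℝ) + nt - 2 * j - 1) * β j)]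
  refine Fintype.sum_equiv Fin.revPerm _ _ fun i => ?_
  have h : (i : ℕ) + (Fin.rev i : ℕ) + 1 = nt := by rw [Fin.val_rev]; omega
  have h' : (i : ℝ) + ((Fin.rev i : ℕ) : ℝ) + 1 = nt := by exact_mod_cast h
  simp only [Fin.revPerm_apply]
  rw [← h']
  ring

theorem objective_rev (r : ℝ) (β : ℕ → ℝ) :
    objective nt T r (fun i => β (Fin.rev i))
      = ∑ j : Fin nt, (T : ℝ) * max (min (r / nt - 1 + β j) (r / nt)) 0 :=
  Fintype.sum_equiv Fin.revPerm _ _ fun _ => rfl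

theorem complexityExponent_eq {Ψ : ℝ → EReal} {d c : ℝ} (h1 : ∀ x, c < x → (d : EReal) < Ψ x)
    (h2 : ∀ x, x < c → Ψ x ≤ (d : EReal)) : complexityExponent Ψ d = (c : EReal) := by
  refine le_antisymm (le_of_forall_gt_imp_ge_of_dense fun y hy => ?_) (le_sInf ?_)
  · obtain ⟨x, hx1, hx2⟩ := EReal.lt_iff_exists_real_btwn.mp hy
    exact (sInf_le (Set.mem_image_of_mem (fun x : ℝ => (x : EReal))
      (h1 x (EReal.coe_lt_coe_iff.mp hx1)))).trans hx2.le
  · rintro _ ⟨x, hx, rfl⟩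
    by_contra hlt
    push Not at hlt
    exact absurd (h2 x (EReal.coe_lt_coe_iff.mp hlt)) (not_le.mpr hx)

end

/-! ### Large complexity is no likelier than an outage of the optimization problem -/

section

theorem complexGaussian_ne_zero : complexGaussian {z | ‖z‖ ∈ {x : ℝ | x ≠ 0}} = 1 := by
  have h1 : {z : ℂ | ‖z‖ ∈ {x : ℝ | x ≠ 0}} = ({0} : Set ℂ)ᶜ := by
    ext z
    simp
  rw [h1, prob_compl_eq_one_iff (measurableSet_singleton 0), complexGaussian_singleton_zero]

/-- Gaussian vectors, at most as many as the dimension, are almost surely independent. -/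
theorem pi_gaussianVector_gramSchmidt_eq_zero {N n : ℕ} (hn : n ≤ N) :
    Measure.pi (fun _ => gaussianVector N)
      {f : Fin n → EuclideanSpace ℂ (Fin N) | ∃ l, gramSchmidt ℂ f l = 0} = 0 := by
  have h := le_pi_gaussianVector_qrEvent (N := N) (A := fun _ => Set.univ) (B := fun _ => Set.univ)
    (fun _ => MeasurableSet.univ) (fun _ => MeasurableSet.univ)
    (S := fun l i => if i < l then Set.univ else {x | x ≠ 0})
    (fun l i => by
      split_ifs
      · exact MeasurableSet.univ
      · exact (measurableSet_singleton 0).compl)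
    (fun l i h => if_pos h)
    (fun l hl a ha haS t ht htsum => by
      refine ⟨trivial, fun h0 => ?_⟩
      have h1 := haS ⟨l, hl⟩ le_rfl
      simp only [lt_irrefl, if_false, Set.mem_ofPred_eq] at h1
      have h2 : a ⟨l, hl⟩ ^ 2 ≤ t ^ 2 := by
        rw [htsum]
        refine le_trans (by simp) (Finset.single_le_sum
          (f := fun i : Fin N => if (i : ℕ) < l then 0 else a i ^ 2) (fun i _ => ?_)
          (Finset.mem_univ ⟨l, hl⟩))
        split_ifs <;> positivity
      rw [h0] at h2
      exact h1 (by nlinarith)) hn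
  have h1 : ∏ l ∈ Finset.range n, ∏ i : Fin N,
      complexGaussian {z | ‖z‖ ∈ (if (i : ℕ) < l then Set.univ else {x : ℝ | x ≠ 0})} = 1 := by
    refine Finset.prod_eq_one fun l _ => Finset.prod_eq_one fun i _ => ?_
    split_ifs
    · simp
    · exact complexGaussian_ne_zero
  rw [h1] at h
  have hm := measurableSet_qrEvent (N := N) (A := fun _ => Set.univ) (B := fun _ => Set.univ)
    (fun _ => MeasurableSet.univ) (fun _ => MeasurableSet.univ) n
  refine measure_mono_null (t := (qrEvent (fun _ => Set.univ) (fun _ => Set.univ) n)ᶜ) ?_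
    ((prob_compl_eq_zero_iff hm).mpr (le_antisymm prob_le_one h))
  rintro f ⟨l, hl⟩ hf
  exact (hf l).1 hl

/-- The grid cells of the exponents `β_j` in `d_j = ρ ^ (-β_j / 2)`, for the grid of multiples of
`1 / M` in `[0, 1]`. Negative exponents belong to the cell at `0`, and exponents above `1` to the
cell at `1`. -/
theorem exists_grid_exponent {M : ℕ} (hM : 0 < M) {n : ℕ} {d : Fin n → ℝ}
    (hd0 : ∀ j, 0 < d j) (hd : Antitone d) {ρ : ℝ} (hρ : 1 < ρ) :
    ∃ k : Fin n → Fin (M + 1), Monotone k ∧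
      (∀ j, ((k j : ℕ) : ℝ) / M = 0 ∨ d j ≤ ρ ^ (-((((k j : ℕ) : ℝ) / M) / 2))) ∧
      ∀ j, (k j : ℕ) = M ∨ ρ ^ (-((((k j : ℕ) : ℝ) / M + 1 / M) / 2)) ≤ d j := by
  have hM' : (0 : ℝ) < M := Nat.cast_pos.mpr hM
  have hlog := Real.log_pos hρ
  have hρ0 : 0 < ρ := by linarith
  set b : Fin n → ℝ := fun j => -2 * (Real.log (d j) / Real.log ρ) with hb
  have hdb : ∀ j, d j = ρ ^ (-(b j / 2)) := by
    intro j
    rw [Real.rpow_def_of_pos hρ0, ← Real.exp_log (hd0 j)]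
    simp only [hb]
    congr 1
    field_simp
  have hbm : Monotone b := by
    intro i j hij
    have h1 := Real.log_le_log (hd0 j) (hd hij)
    have h2 := div_le_div_of_nonneg_right h1 hlog.le
    simp only [hb]
    linarith
  refine ⟨fun j => ⟨min ⌊b j * M⌋₊ M, by omega⟩, ?_, ?_, ?_⟩
  · intro i j hij
    rw [Fin.le_def]
    exact min_le_min_right _ (Nat.floor_mono (mul_le_mul_of_nonneg_right (hbm hij) hM'.le))
  · intro j
    simp only
    by_cases h : 0 ≤ b j
    · right
      rw [hdb j]
      refine Real.rpow_le_rpow_of_exponent_le hρ.le ?_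
      have h1 : ((min ⌊b j * M⌋₊ M : ℕ) : ℝ) ≤ b j * M :=
        (Nat.cast_le.mpr (min_le_left _ _)).trans (Nat.floor_le (by positivity))
      have h2 := (div_le_iff₀ hM').mpr h1
      linarith
    · left
      push Not at h
      rw [Nat.floor_of_nonpos (mul_nonpos_of_nonpos_of_nonneg h.le hM'.le)]
      simp
  · intro j
    simp only
    rcases le_or_gt M ⌊b j * M⌋₊ with h | h
    · left
      exact min_eq_right h
    · right
      rw [hdb j, min_eq_left h.le]
      refine Real.rpow_le_rpow_of_exponent_le hρ.le ?_
      have h1 := (Nat.lt_floor_add_one (b j * M)).le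
      rw [← add_div]
      have h2 := (le_div_iff₀ hM').mpr h1
      linarith

/-- The growth of the number of choices in a direction of gain `ρ ^ (-b / 2)`. -/
theorem hasExponent_layer {θ η ξ : ℝ → ℝ} {u : ℝ} (hθ : HasExponent θ ((1 - u) / 2))
    (hη : HasExponent η (u / 2)) (hξ : HasExponent ξ 0) (T : ℕ) (b : ℝ) :
    HasExponent (fun ρ => (1 + min (ξ ρ / (θ ρ * ρ ^ (-(b / 2)))) (η ρ)) ^ (2 * T))
      (T * max (min (u - 1 + b) u) 0) := by
  convert (((hξ.div (hθ.mul (HasExponent.rpow (-(b / 2))))).min hη).one_add).pow (2 * T) using 1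
  have h1 : 0 - ((1 - u) / 2 + -(b / 2)) = (u - 1 + b) / 2 := by ring
  rw [h1, min_div_div_right zero_le_two, ← zero_div (2 : ℝ), max_div_div_right zero_le_two,
    max_comm, zero_div]
  push_cast
  ring

/-- The growth of the number of choices in a direction in which only the constellation limits them. -/
theorem hasExponent_full_layer {η : ℝ → ℝ} {u : ℝ} (hu : 0 ≤ u) (hη : HasExponent η (u / 2))
    (T : ℕ) : HasExponent (fun ρ => (1 + η ρ) ^ (2 * T)) (T * u) := by
  convert hη.one_add.pow (2 * T) using 1
  rw [max_eq_right (by positivity)]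
  push_cast
  ring

theorem exists_lt_forall_le {ι : Type*} (s : Finset ι) (g : ι → ℝ) {d : ℝ}
    (h : ∀ i ∈ s, d < g i) : ∃ a, d < a ∧ ∀ i ∈ s, a ≤ g i := by
  rcases s.eq_empty_or_nonempty with rfl | hs
  · exact ⟨d + 1, by linarith, by simp⟩
  · obtain ⟨i, hi, hmin⟩ := s.exists_min_image g hs
    exact ⟨g i, h i hi, hmin⟩

variable {nt nr T : ℕ} {D : Fin (nt * T) → Matrix (Fin nt) (Fin T) ℂ} {r d : ℝ} {θ η ξ : ℝ → ℝ}
  {Q : ℝ → Matrix (Fin nr) (Fin nt) ℂ → Matrix (Fin T × Fin nr) (Fin (nt * T)) ℂ}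
  {R : ℝ → Matrix (Fin nr) (Fin nt) ℂ → Matrix (Fin (nt * T)) (Fin (nt * T)) ℂ}

theorem lt_liminf_decayRate_complexityTail (hnt : 1 ≤ nt) (hT : 1 ≤ T) (hnr : nt ≤ nr)
    (hD : LinearIndependent ℂ D) (hr : 0 ≤ r) (h : IsCodeScaling D r θ η) (hd : 0 ≤ d)
    (hξ : HasExponent ξ 0)
    (hQR : ∀ᶠ ρ in atTop, ∀ H, IsThinQR (codeChannel D (θ ρ) H) (Q ρ H) (R ρ H))
    {x : ℝ} (hx : cBar nt nr T r d < x) :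
    (d : EReal) < liminf (decayRate (complexityTail D θ η ξ Q R x)) atTop := by
  classical
  have hκ : 0 < nt * T := Nat.mul_pos hnt hT
  have hnt0 : (0 : ℝ) < nt := Nat.cast_pos.mpr hnt
  have hT0 : (0 : ℝ) < T := Nat.cast_pos.mpr hT
  obtain ⟨K, hK, hcount⟩ := exists_card_visitedNodes_le nr hD
  obtain ⟨M, hM⟩ := exists_nat_gt (nt * T / (x - cBar nt nr T r d))
  have hM0 : (0 : ℝ) < M := lt_of_le_of_lt
    (div_nonneg (by positivity) (sub_nonneg.mpr hx.le)) hM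
  have hMN : 0 < M := Nat.cast_pos.mp hM0
  have hMx : (nt * T : ℝ) / M < x - cBar nt nr T r d := by
    rw [div_lt_iff₀ (sub_pos.mpr hx)] at hM
    rw [div_lt_iff₀ hM0]
    linarith
  set u := r / nt with hu
  have hu0 : 0 ≤ u := by positivity
  have hηe := h.hasExponent_eta hκ hD
  have hθe := h.hasExponent_theta hκ hD
  -- the contribution of a direction in a given cell of the grid of exponents
  let G : Fin (M + 1) → ℝ → ℝ := fun k ρ =>
    if (k : ℕ) = M then (1 + η ρ) ^ (2 * T) else
      (1 + min (ξ ρ / (θ ρ * ρ ^ (-((((k : ℕ) : ℝ) / M + 1 / M) / 2)))) (η ρ)) ^ (2 * T)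
  let e : Fin (M + 1) → ℝ := fun k =>
    if (k : ℕ) = M then T * u else T * max (min (u - 1 + (((k : ℕ) : ℝ) / M + 1 / M)) u) 0
  have hG : ∀ k, HasExponent (G k) (e k) := by
    intro k
    simp only [G, e]
    split_ifs
    · exact hasExponent_full_layer hu0 hηe T
    · exact hasExponent_layer hθe hηe hξ T _
  have he : ∀ k, e k ≤ T * max (min (u - 1 + ((k : ℕ) : ℝ) / M) u) 0 + T / M := by
    intro k
    have hM1 : 0 < 1 / (M : ℝ) := by positivity
    have h1 : e k ≤ T * (max (min (u - 1 + ((k : ℕ) : ℝ) / M) u) 0 + 1 / M) := by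
      simp only [e]
      split_ifs with hk
      · refine mul_le_mul_of_nonneg_left ?_ hT0.le
        rw [hk, div_self hM0.ne', sub_add_cancel, min_self]
        linarith [le_max_left u 0]
      · refine mul_le_mul_of_nonneg_left (max_le ?_ ?_) hT0.le
        · rw [← sub_le_iff_le_add]
          refine le_max_of_le_left (le_min ?_ ?_)
          · linarith [min_le_left (u - 1 + (((k : ℕ) : ℝ) / M + 1 / M)) u]
          · linarith [min_le_right (u - 1 + (((k : ℕ) : ℝ) / M + 1 / M)) u]
        · linarith [le_max_right (min (u - 1 + ((k : ℕ) : ℝ) / M) u) 0]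
    calc e k ≤ _ := h1
      _ = _ := by ring
  let B : (Fin nt → Fin (M + 1)) → ℝ → ℝ := fun k ρ =>
    ((nt * T : ℕ) : ℝ) * (K * ∏ j, G (k j) ρ)
  have hB : ∀ k, HasExponent (B k) (∑ j, e (k j)) := by
    intro k
    have h1 := (HasExponent.const (c := ((nt * T : ℕ) : ℝ)) (by exact_mod_cast hκ)).mul
      ((HasExponent.const hK).mul (HasExponent.prod (s := Finset.univ)
        (f := fun j => G (k j)) fun j _ => hG (k j)))
    rwa [zero_add, zero_add] at h1
  let β : (Fin nt → Fin (M + 1)) → ℕ → ℝ := fun k j =>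
    if hj : j < nt then ((k ⟨j, hj⟩ : ℕ) : ℝ) / M else 0
  have hβ : ∀ k (j : Fin nt), β k j = ((k j : ℕ) : ℝ) / M := fun k j => by simp [β]
  let bad : Finset (Fin nt → Fin (M + 1)) :=
    Finset.univ.filter fun k => Monotone k ∧ x ≤ ∑ j, e (k j)
  -- cells that allow for `ρ ^ x` nodes violate the constraint of the optimization problem
  have hbad : ∀ k ∈ bad, d < ∑ j ∈ Finset.range nt, ((nr : ℝ) + nt - 2 * j - 1) * β k j := by
    intro k hk
    obtain ⟨hk1, hk2⟩ := (Finset.mem_filter.mp hk).2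
    by_contra hle
    push Not at hle
    rw [← sum_weight_rev] at hle
    have hfeas : (fun i : Fin nt => β k (Fin.rev i)) ∈ feasible nt nr d := by
      refine ⟨hle, ?_, ?_⟩
      · intro i j hij
        simp only [hβ]
        have : ((k (Fin.rev j) : ℕ) : ℝ) ≤ ((k (Fin.rev i) : ℕ) : ℝ) := by
          exact_mod_cast hk1 (Fin.rev_le_rev.mpr hij)
        exact div_le_div_of_nonneg_right this hM0.le
      · intro i
        simp only [hβ]
        positivity
    have h1 := (isGreatest_cBar (T := T) hnr r hd).2 ⟨_, hfeas, rfl⟩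
    rw [objective_rev] at h1
    have h2 : ∑ j, e (k j) ≤
        ∑ j : Fin nt, (T * max (min (u - 1 + β k j) u) 0 + (T : ℝ) / M) := by
      refine Finset.sum_le_sum fun j _ => ?_
      rw [hβ]
      exact he (k j)
    rw [Finset.sum_add_distrib, Finset.sum_const, Finset.card_univ, Fintype.card_fin,
      nsmul_eq_mul, ← mul_div_assoc] at h2
    linarith
  obtain ⟨a, hda, ha⟩ := exists_lt_forall_le bad _ hbad
  refine lt_of_lt_of_le (EReal.coe_lt_coe_iff.mpr hda) ?_
  set C : ℝ := Fintype.card (Equiv.Perm (Fin nt)) * (bad.card * 4 ^ (nr * nt)) + 1 with hC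
  have hC0 : 0 < C := by positivity
  refine le_liminf_decayRate (f := fun ρ => C * ρ ^ (-a)) ?_ ?_
  · simpa using (HasExponent.const hC0).mul (HasExponent.rpow (-a))
  have hBx : ∀ᶠ ρ in atTop, ∀ k, ∑ j, e (k j) < x → B k ρ < ρ ^ x := by
    refine eventually_all.mpr fun k => ?_
    by_cases hk : ∑ j, e (k j) < x
    · filter_upwards [(hB k).eventually_lt (HasExponent.rpow x) hk] with ρ h1 _ using h1
    · exact Eventually.of_forall fun ρ h1 => absurd h1 hk
  filter_upwards [hBx, hQR, hξ.pos, h.theta_pos, h.eta_pos, eventually_gt_atTop 1]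
    with ρ hBx hQR hξ0 hθ0 hη0 hρ
  have hρ0 : 0 < ρ := by linarith
  let null : Equiv.Perm (Fin nt) → Set (Fin nr → Fin nt → ℂ) := fun σ =>
    columns (columnPerm σ) ⁻¹' {f | ∃ l, gramSchmidt ℂ f l = 0}
  let cell : Equiv.Perm (Fin nt) → (Fin nt → Fin (M + 1)) → Set (Fin nr → Fin nt → ℂ) :=
    fun σ k => columns (columnPerm σ) ⁻¹' qrEvent (rowBound ρ (β k)) (rowBound ρ (β k)) nt
  have hnull : ∀ σ, gaussianMatrix nr nt (null σ) = 0 := fun σ =>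
    (measurePreserving_columns (columnPerm_mem_unitaryGroup σ)).quasiMeasurePreserving.preimage_null
      (pi_gaussianVector_gramSchmidt_eq_zero hnr)
  have hcell : ∀ σ, ∀ k ∈ bad, gaussianMatrix nr nt (cell σ k) ≤
      ENNReal.ofReal (4 ^ (nr * nt) * ρ ^ (-a)) := by
    intro σ k hk
    rw [(measurePreserving_columns (columnPerm_mem_unitaryGroup σ)).measure_preimage
      (measurableSet_qrEvent (measurableSet_rowBound ρ _)
        (measurableSet_rowBound ρ _) nt).nullMeasurableSet]
    refine (pi_gaussianVector_rowBound_le hnr (β k) hρ0).trans (ENNReal.ofReal_le_ofReal ?_)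
    refine mul_le_mul_of_nonneg_left (Real.rpow_le_rpow_of_exponent_le hρ.le ?_) (by positivity)
    linarith [ha k hk]
  refine (sampleLaw_le hη0.le _ (⋃ σ, (null σ ∪ ⋃ k ∈ bad, cell σ k)) ?_).trans ?_
  · intro ω hω
    have hω' : ρ ^ x ≤ (complexity D (θ ρ) (η ρ) (ξ ρ) (Q ρ) (R ρ) ω : ℝ) := hω
    obtain ⟨σ, hσ⟩ := exists_perm_isPivoted (columns 1 ω.1)
    rw [← columns_columnPerm] at hσ
    refine Set.mem_iUnion.mpr ⟨σ, ?_⟩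
    by_cases hn : ω.1 ∈ null σ
    · exact Or.inl hn
    refine Or.inr ?_
    have hgs : ∀ l, gramSchmidt ℂ (columns (columnPerm σ) ω.1) l ≠ 0 := fun l hl => hn ⟨l, hl⟩
    obtain ⟨k, hk1, hk2, hk3⟩ := exists_grid_exponent hMN
      (d := fun j => ‖gramSchmidt ℂ (columns (columnPerm σ) ω.1) j‖)
      (fun j => norm_pos_iff.mpr (hgs j)) (fun j l hjl => (hσ j l hjl).2) hρ
    have hprod : ∏ j, (1 + min (ξ ρ / (θ ρ * ‖gramSchmidt ℂ (columns (columnPerm σ) ω.1) j‖))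
        (η ρ)) ^ (2 * T) ≤ ∏ j, G (k j) ρ := by
      have hmin : ∀ j, 0 ≤ min
          (ξ ρ / (θ ρ * ‖gramSchmidt ℂ (columns (columnPerm σ) ω.1) j‖)) (η ρ) :=
        fun j => le_min (by positivity) hη0.le
      refine Finset.prod_le_prod (fun j _ => by have := hmin j; positivity) fun j _ => ?_
      have h1 := hmin j
      simp only [G]
      split_ifs with hkM
      · gcongr
        exact min_le_right _ _
      · have h2 := (hk3 j).resolve_left hkM
        gcongr
    have hN : (complexity D (θ ρ) (η ρ) (ξ ρ) (Q ρ) (R ρ) ω : ℝ) ≤ B k ρ := by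
      rw [complexity, numVisited]
      push_cast
      calc _ ≤ ∑ _k : Fin (nt * T), K * ∏ j, G (k j) ρ := by
            refine Finset.sum_le_sum fun i _ => ?_
            exact (hcount (θ ρ) (η ρ) (ξ ρ) hθ0 hη0.le hξ0 ω.1 _ (columnPerm_mem_unitaryGroup σ)
              hgs hσ _ _ (hQR ω.channel) _ _ i.isLt).trans
              (mul_le_mul_of_nonneg_left hprod hK.le)
        _ = B k ρ := by
            simp [B]
    have hkbad : k ∈ bad := by
      refine Finset.mem_filter.mpr ⟨Finset.mem_univ _, hk1, ?_⟩
      by_contra hlt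
      push Not at hlt
      linarith [hBx k hlt]
    refine Set.mem_biUnion hkbad fun l => ⟨hgs l, fun j hj => ?_, ?_⟩
    · simp only [rowBound, Set.mem_ofPred_eq, hβ]
      exact (hk2 j).imp_right fun h1 => (hσ j l hj.le).1.trans h1
    · simp only [rowBound, Set.mem_ofPred_eq, hβ]
      exact hk2 l
  · calc gaussianMatrix nr nt (⋃ σ, (null σ ∪ ⋃ k ∈ bad, cell σ k))
        ≤ ∑ σ, gaussianMatrix nr nt (null σ ∪ ⋃ k ∈ bad, cell σ k) := measure_iUnion_fintype_le _ _
      _ ≤ ∑ _σ : Equiv.Perm (Fin nt), ∑ _k ∈ bad, ENNReal.ofReal (4 ^ (nr * nt) * ρ ^ (-a)) := by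
          refine Finset.sum_le_sum fun σ _ => (measure_union_le _ _).trans ?_
          rw [hnull, zero_add]
          exact (measure_biUnion_finset_le _ _).trans (Finset.sum_le_sum fun k hk => hcell σ k hk)
      _ = ENNReal.ofReal (Fintype.card (Equiv.Perm (Fin nt)) *
            (bad.card * (4 ^ (nr * nt) * ρ ^ (-a)))) := by
          rw [Finset.sum_const, Finset.sum_const, Finset.card_univ, nsmul_eq_mul, nsmul_eq_mul,
            ENNReal.ofReal_mul (Nat.cast_nonneg _), ENNReal.ofReal_mul (Nat.cast_nonneg _),
            ENNReal.ofReal_natCast, ENNReal.ofReal_natCast]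
      _ ≤ ENNReal.ofReal (C * ρ ^ (-a)) := by
          refine ENNReal.ofReal_le_ofReal ?_
          have h1 : 0 < ρ ^ (-a) := Real.rpow_pos_of_pos hρ0 _
          rw [hC, add_mul, one_mul]
          linarith

end

/-! ### Large complexity is at least as likely as an outage of the optimization problem -/

section

variable {nt nr T : ℕ} {D : Fin (nt * T) → Matrix (Fin nt) (Fin T) ℂ} {r d : ℝ} {θ η ξ : ℝ → ℝ}
  {Q : ℝ → Matrix (Fin nr) (Fin nt) ℂ → Matrix (Fin T × Fin nr) (Fin (nt * T)) ℂ}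
  {R : ℝ → Matrix (Fin nr) (Fin nt) ℂ → Matrix (Fin (nt * T)) (Fin (nt * T)) ℂ}

theorem card_visitedNodes_le_numVisited {n : ℕ} (rv : Fin n → ℂ) (R : Matrix (Fin n) (Fin n) ℂ)
    (η ξ : ℝ) {k : ℕ} (hk0 : 0 < k) (hk : k ≤ n) :
    (visitedNodes rv R η ξ k hk).card ≤ numVisited rv R η ξ := by
  obtain ⟨k, rfl⟩ := Nat.exists_eq_succ_of_ne_zero hk0.ne'
  exact Finset.single_le_sum (f := fun i : Fin n => (visitedNodes rv R η ξ (i + 1) i.isLt).card)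
    (fun _ _ => Nat.zero_le _) (Finset.mem_univ (⟨k, hk⟩ : Fin n))

/-- If the complexity in the situation of `exists_le_card_visitedNodes` is at least `ρ ^ x`, then the
tail at `x` decays no faster than the probability of that situation. The noise and the choice of the
transmitted symbols only cost a factor `ρ ^ o(1)`. -/
theorem exists_limsup_decayRate_complexityTail_le (hnt : 1 ≤ nt) (hT : 1 ≤ T) (hnr : nt ≤ nr)
    (hrank : RankCondition (generator D)) (h : IsCodeScaling D r θ η)
    (hξ : HasExponent ξ 0)
    (hQR : ∀ᶠ ρ in atTop, ∀ H, IsThinQR (codeChannel D (θ ρ) H) (Q ρ H) (R ρ H))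
    {p : ℕ} (hp : p < nt) {β : ℕ → ℝ} (hβ : ∀ j, 0 ≤ β j) (hβp : ∀ j < p, β j = 0) :
    ∃ K : ℝ, 0 < K ∧ ∀ x : ℝ,
      (∀ᶠ ρ in atTop, ∀ n : ℕ, ((constellation (η ρ)).card : ℝ) ^ ((nt - p) * T) ≤
        (K * ∏ j ∈ Finset.univ.filter fun j : Fin nt => p ≤ (j : ℕ),
          (1 + θ ρ * ρ ^ (-(β j / 2)) * η ρ / ξ ρ) ^ (2 * T)) * n → ρ ^ x ≤ n) →
      limsup (decayRate (complexityTail D θ η ξ Q R x)) atTop ≤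
        ((∑ j ∈ Finset.range nt, ((nr : ℝ) + nt - 2 * j - 1) * β j : ℝ) : EReal) := by
  obtain ⟨W, hW, hinj⟩ := exists_strongCoords_injective hrank hp.le
  have hk : (nt - p) * T ≤ nt * T := Nat.mul_le_mul_right T (Nat.sub_le nt p)
  have hk0 : 0 < (nt - p) * T := Nat.mul_pos (by omega) hT
  obtain ⟨δ, K, hδ0, hδ1, hK, hcount⟩ := exists_le_card_visitedNodes nr hnt hT D hW hp.le hinj hk
  obtain ⟨c₁, hc₁, hchan⟩ := exists_le_pi_gaussianVector_decay hnr p hδ0 hδ1 β hβ hβp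
  obtain ⟨c₂, hc₂, hnoise⟩ := exists_le_gaussianMatrix_sqNorm_le nr T
  refine ⟨K, hK, fun x hx => ?_⟩
  set a := ∑ j ∈ Finset.range nt, ((nr : ℝ) + nt - 2 * j - 1) * β j with ha
  refine limsup_decayRate_le
    (f := fun ρ => c₂ * (min 1 (ξ ρ / 2) ^ 2) ^ (nr * T) * 2⁻¹ * (c₁ * ρ ^ (-a))) ?_ ?_
  · have h1 := (((HasExponent.const one_pos).min (hξ.div (HasExponent.const two_pos))).pow 2).pow
      (nr * T)
    have h2 := (((HasExponent.const hc₂).mul h1).mul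
      (HasExponent.const (c := (2 : ℝ)⁻¹) (by norm_num))).mul
      ((HasExponent.const hc₁).mul (HasExponent.rpow (-a)))
    simpa using h2
  filter_upwards [hx, hQR, hξ.pos, h.theta_pos, h.eta_pos, eventually_ge_atTop 1]
    with ρ hx hQR hξ0 hθ0 hη0 hρ
  have hρ0 : 0 ≤ ρ := by linarith
  have hAm : MeasurableSet (qrEvent (N := nr) (offDiagBound p δ ρ β) (diagBound p ρ β) nt) :=
    measurableSet_qrEvent (measurableSet_offDiagBound p δ ρ β) (measurableSet_diagBound p ρ β) nt
  have hmp := measurePreserving_columns (m := nr) hW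
  have hmain := le_sampleLaw (nr := nr) hη0.le
    {ω | ρ ^ x ≤ (complexity D (θ ρ) (η ρ) (ξ ρ) (Q ρ) (R ρ) ω : ℝ)}
    (hmp.measurable hAm) {w | sqNorm (Matrix.of w).vec ≤ (ξ ρ / 2) ^ 2} (by
      intro H hH
      obtain ⟨good, h1, h2, h3⟩ := hcount (θ ρ) (η ρ) (ξ ρ) hθ0 hη0.le hξ0 H ρ β hρ0 hH _ _
        (hQR (Matrix.of H))
      refine ⟨good, h1, h2, fun s hs w hw => (hx _ (h3 s hs w hw)).trans ?_⟩
      exact Nat.cast_le.mpr (card_visitedNodes_le_numVisited _ _ _ _ hk0 hk))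
  refine le_trans ?_ hmain
  rw [hmp.measure_preimage hAm.nullMeasurableSet, ENNReal.ofReal_mul (by positivity),
    ENNReal.ofReal_mul (by positivity), ENNReal.ofReal_inv_of_pos two_pos, ENNReal.ofReal_ofNat]
  gcongr
  · exact hnoise _ (by positivity)
  · exact hchan ρ hρ

theorem limsup_decayRate_complexityTail_le (hnt : 1 ≤ nt) (hT : 1 ≤ T) (hnr : nt ≤ nr)
    (hD : LinearIndependent ℂ D) (hrank : RankCondition (generator D)) (hr : r ∈ Set.Icc (0 : ℝ) nt)
    (h : IsCodeScaling D r θ η) (hd : 0 ≤ d) (hξ : HasExponent ξ 0)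
    (hQR : ∀ᶠ ρ in atTop, ∀ H, IsThinQR (codeChannel D (θ ρ) H) (Q ρ H) (R ρ H))
    {x : ℝ} (hx : x < cBar nt nr T r d) :
    limsup (decayRate (complexityTail D θ η ξ Q R x)) atTop ≤ (d : EReal) := by
  have hκ : 0 < nt * T := Nat.mul_pos hnt hT
  have hnt0 : (0 : ℝ) < nt := Nat.cast_pos.mpr hnt
  have hT0 : (0 : ℝ) < T := Nat.cast_pos.mpr hT
  set u := r / nt with hu
  have hu0 : 0 ≤ u := div_nonneg hr.1 hnt0.le
  have hu1 : u ≤ 1 := (div_le_one hnt0).mpr hr.2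
  have hηe := h.hasExponent_eta hκ hD
  have hθe := h.hasExponent_theta hκ hD
  have hqe := h.hasExponent_card_constellation hκ hD
  rw [← hu] at hηe hθe hqe
  obtain ⟨⟨α, ⟨hα1, hα2, hα3⟩, hαc⟩, -⟩ := isGreatest_cBar (T := T) hnr r hd
  rw [← hαc] at hx
  let β₀ : ℕ → ℝ := fun j => if hj : j < nt then α (Fin.rev ⟨j, hj⟩) else 0
  have hβ₀ : ∀ j : Fin nt, β₀ j = α (Fin.rev j) := fun j => by simp [β₀]
  have hαβ : α = fun i : Fin nt => β₀ (Fin.rev i) := by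
    funext i
    rw [hβ₀, Fin.rev_rev]
  have hobj : objective nt T r α = ∑ j : Fin nt, (T : ℝ) * max (min (u - 1 + β₀ j) u) 0 := by
    conv_lhs => rw [hαβ]
    rw [objective_rev]
  have hβmono : ∀ i j : Fin nt, i ≤ j → β₀ i ≤ β₀ j := fun i j hij => by
    rw [hβ₀, hβ₀]
    exact hα2 (Fin.rev_le_rev.mpr hij)
  have hβ₀0 : ∀ j, 0 ≤ β₀ j := fun j => by
    simp only [β₀]
    split_ifs
    · exact hα3 _
    · exact le_rfl
  have hweight : ∀ j ∈ Finset.range nt, 0 ≤ (nr : ℝ) + nt - 2 * j - 1 := fun j hj => by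
    have h1 : ((j + 1 : ℕ) : ℝ) ≤ nt := Nat.cast_le.mpr (Finset.mem_range.mp hj)
    have h2 : (nt : ℝ) ≤ nr := Nat.cast_le.mpr hnr
    push_cast at h1
    linarith
  have hsum : ∑ j ∈ Finset.range nt, ((nr : ℝ) + nt - 2 * j - 1) * β₀ j ≤ d := by
    rw [← sum_weight_rev]
    refine le_trans (le_of_eq (Finset.sum_congr rfl fun i _ => ?_)) hα1
    rw [hβ₀, Fin.rev_rev]
  rcases lt_or_ge x 0 with hx0 | hx0
  · -- a single visited node suffices, and there is one without any channel outage
    obtain ⟨K, hK, hlim⟩ := exists_limsup_decayRate_complexityTail_le hnt hT hnr hrank h hξ hQR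
      (p := nt - 1) (by omega) (β := fun _ => 0) (fun _ => le_rfl) (fun _ _ => rfl)
    refine (hlim x ?_).trans (by simpa using hd)
    filter_upwards [hqe.pos, eventually_ge_atTop 1] with ρ hq hρ n hn
    have hn0 : n ≠ 0 := by
      rintro rfl
      rw [Nat.cast_zero, mul_zero] at hn
      exact absurd hn (not_le.mpr (pow_pos hq _))
    calc ρ ^ x ≤ 1 := Real.rpow_le_one_of_one_le_of_nonpos hρ hx0.le
      _ ≤ n := by exact_mod_cast Nat.one_le_iff_ne_zero.mpr hn0
  · -- the strong directions are those that do not contribute to the objective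
    have hex : ∃ p, p < nt ∧ (∀ j : Fin nt, p ≤ (j : ℕ) ↔ 1 - u < β₀ j) := by
      have hne : ∃ j : ℕ, j < nt ∧ 1 - u < β₀ j := by
        by_contra hall
        push Not at hall
        have h1 : objective nt T r α = 0 := by
          rw [hobj]
          refine Finset.sum_eq_zero fun j _ => ?_
          rw [max_eq_right, mul_zero]
          exact (min_le_left _ _).trans (by linarith [hall j j.isLt])
        linarith
      classical
      refine ⟨Nat.find hne, (Nat.find_spec hne).1, fun j => ⟨fun hj => ?_, fun hj => ?_⟩⟩
      · exact (Nat.find_spec hne).2.trans_le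
          (hβmono ⟨Nat.find hne, (Nat.find_spec hne).1⟩ j hj)
      · exact Nat.find_min' hne ⟨j.isLt, hj⟩
    obtain ⟨p, hp, hpiff⟩ := hex
    let β : ℕ → ℝ := fun j => if j < p then 0 else β₀ j
    have hββ₀ : ∀ j, β j ≤ β₀ j := fun j => by
      simp only [β]
      split_ifs
      · exact hβ₀0 j
      · exact le_rfl
    have hβ0 : ∀ j, 0 ≤ β j := fun j => by
      simp only [β]
      split_ifs
      · exact le_rfl
      · exact hβ₀0 j
    obtain ⟨K, hK, hlim⟩ := exists_limsup_decayRate_complexityTail_le hnt hT hnr hrank h hξ hQR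
      hp hβ0 (fun j hj => if_pos hj)
    refine (hlim x ?_).trans (EReal.coe_le_coe_iff.mpr (le_trans ?_ hsum))
    swap
    · exact Finset.sum_le_sum fun j hj => mul_le_mul_of_nonneg_left (hββ₀ j) (hweight j hj)
    set weak := Finset.univ.filter fun j : Fin nt => p ≤ (j : ℕ) with hweak
    have hcard : weak.card = nt - p := by
      have h1 := Fin.card_filter_val_lt (n := nt) (m := p)
      have h2 := Finset.card_filter_add_card_filter_not (s := (Finset.univ : Finset (Fin nt)))
        (fun j => (j : ℕ) < p)
      simp only [not_lt, Finset.card_univ, Fintype.card_fin] at h2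
      rw [← hweak] at h2
      omega
    have hden := (HasExponent.const hK).mul (HasExponent.prod (s := weak)
      (f := fun j ρ => (1 + θ ρ * ρ ^ (-(β j / 2)) * η ρ / ξ ρ) ^ (2 * T))
      fun j _ => (((((hθe.mul (HasExponent.rpow (-(β j / 2)))).mul hηe).div hξ).one_add).pow
        (2 * T)))
    have hexp : x < ((nt - p) * T : ℕ) * u - (0 + ∑ j ∈ weak, ((2 * T : ℕ) : ℝ) *
        max 0 ((1 - u) / 2 + -(β j / 2) + u / 2 - 0)) := by
      refine hx.trans_eq ?_
      have h1 : (((nt - p) * T : ℕ) : ℝ) * u = ∑ _j ∈ weak, (T : ℝ) * u := by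
        rw [Finset.sum_const, hcard, nsmul_eq_mul]
        push_cast
        ring
      rw [hobj, zero_add, h1, ← Finset.sum_sub_distrib, hweak, Finset.sum_filter]
      refine Finset.sum_congr rfl fun j _ => ?_
      split_ifs with hj
      · have hβj : β j = β₀ j := if_neg (not_lt.mpr hj)
        have h2 := (hpiff j).mp hj
        rw [hβj, max_eq_left (le_min (by linarith) hu0)]
        have h3 : (1 - u) / 2 + -(β₀ j / 2) + u / 2 - 0 = (1 - β₀ j) / 2 := by ring
        rw [h3]
        push_cast
        rcases le_total (β₀ j) 1 with h4 | h4
        · rw [min_eq_left (by linarith), max_eq_right (by linarith)]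
          ring
        · rw [min_eq_right (by linarith), max_eq_left (by linarith)]
          ring
      · have h2 : β₀ j ≤ 1 - u := not_lt.mp fun h3 => hj ((hpiff j).mpr h3)
        rw [max_eq_right, mul_zero]
        exact (min_le_left _ _).trans (by linarith)
    filter_upwards [(HasExponent.rpow x).eventually_lt ((hqe.pow ((nt - p) * T)).div hden) hexp,
      hden.pos] with ρ h1 h2 n hn
    exact h1.le.trans ((div_le_iff₀ h2).mpr (hn.trans_eq (mul_comm _ _)))

end

end SphereDecoding

open SphereDecoding in
theorem lemma2 (nt nr T : ℕ) (hnt : 1 ≤ nt) (hT : 1 ≤ T) (hnr : nt ≤ nr)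
    (D : Fin (nt * T) → Matrix (Fin nt) (Fin T) ℂ) (hD : LinearIndependent ℂ D)
    (hrank : RankCondition (generator D)) :
    ∀ r ∈ Set.Icc (0 : ℝ) nt,
    -- the code at multiplexing gain `r`
    ∀ θ η : ℝ → ℝ, IsCodeScaling D r θ η →
    -- its diversity gain `d` under ML decoding
    ∀ (dec : ℝ → Matrix (Fin nr) (Fin T) ℂ → Matrix (Fin nr) (Fin nt) ℂ →
        Matrix (Fin nt) (Fin T) ℂ) (d : ℝ),
      (∀ᶠ ρ in atTop, IsMLDecoder (codebook D (θ ρ) (η ρ)) (dec ρ)) →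
      Tendsto (decayRate fun ρ => errorProb D (θ ρ) (η ρ) (dec ρ)) atTop (𝓝 (d : EReal)) →
    -- a sphere decoder with a non-random search radius `ξ` of SNR exponent zero
    ∀ ξ : ℝ → ℝ, (∀ᶠ ρ in atTop, 0 < ξ ρ) →
      Tendsto (fun ρ => Real.log (ξ ρ) / Real.log ρ) atTop (𝓝 0) →
    ∀ (Q : ℝ → Matrix (Fin nr) (Fin nt) ℂ → Matrix (Fin T × Fin nr) (Fin (nt * T)) ℂ)
      (R : ℝ → Matrix (Fin nr) (Fin nt) ℂ → Matrix (Fin (nt * T)) (Fin (nt * T)) ℂ),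
      (∀ᶠ ρ in atTop, ∀ H, IsThinQR (codeChannel D (θ ρ) H) (Q ρ H) (R ρ H)) →
    ∀ Ψ : ℝ → EReal, IsDecayExponent (complexityTail D θ η ξ Q R) Ψ →
      IsGreatest (objective nt T r '' feasible nt nr d) (cBar nt nr T r d) ∧
      complexityExponent Ψ d = (cBar nt nr T r d : EReal) := by
  intro r hr θ η h dec d _ hd ξ hξ0 hξ Q R hQR Ψ hΨ
  have hd0 : 0 ≤ d := by
    refine nonneg_of_tendsto_decayRate ?_ hd
    filter_upwards [h.eta_pos] with ρ hη using sampleLaw_le_one hη.le _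
  refine ⟨isGreatest_cBar hnr r hd0, complexityExponent_eq (fun x hx => ?_) fun x hx => ?_⟩
  · exact (lt_liminf_decayRate_complexityTail hnt hT hnr hD hr.1 h hd0 ⟨hξ0, hξ⟩ hQR hx).trans_le
      (hΨ x).1
  · exact (hΨ x).2.trans
      (limsup_decayRate_complexityTail_le hnt hT hnr hD hrank hr h hd0 ⟨hξ0, hξ⟩ hQR hx)
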